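/- **Model.** There are a set $V$ of $n\ge 2$ nodes and a set of $k$ distinct tokens; initially every token is held by at least one node. An oblivious adversary fixes in advance an infinite sequence $G_0,G_1,\dots$ of connected graphs on $V$. In round $t$ each node may send, along each edge of $G_t$ incident to it, one token that it currently holds (possibly different tokens on different edges); nodes keep all tokens they have ever held. A centralized (randomized) token-forwarding algorithm decides all transmissions of round $t$ from its coin tosses, the present and past token sets of all nodes, and the graphs $G_0,\dots,G_t$. It completes $k$-gossip in $T$ rounds if it stops after at most $T$ rounds and every node then holds all $k$ tokens. **The algorithm for $n$-gossip** ($k=n$), with constants $\kappa,\varphi,\sigma>0$: *LoadBalance$(F,T,R)$* (every node of $F$ has the list $T$ of items; the items are to be placed on the nodes of $R$). Rank the items by a uniformly random permutation. For $i=1,\dots,|T|$, in one round: call $v\in R$ eligible if fewer than $\lfloor |T|/|R|\rfloor$ items are placed at it (if no such $v$ is left: fewer than $\lceil |T|/|R|\rceil$); take a shortest path $v_0,\dots,v_\ell$ in the current graph from $F$ to an eligible node closest to $F$; $v_0$ sends the item of rank $i$ to $v_1$, and each $v_j$ with $1\le j<\ell$ sends on to $v_{j+1}$ some item placed at it before (if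 $\ell=0$, the item is placed at $v_0$). Choices depend only on graphs and ranks. *GreedyExchange* (one round, from item sets $S(v)$): for each node $v$, transmissions towards $v$ follow a maximum matching between the neighbours $u$ of $v$ and the items outside $S(v)$, where $u$ may be matched to $x$ only if $x\in S(u)$. 1. *Consolidation.* For each token in turn, all nodes holding it send it to all neighbours for $\lceil\sqrt n\rceil$ rounds. 2. *Distribution.* Take a smallest set $S$ of nodes that together hold all tokens, and allocate each token to one node of $S$ holding it. For each $u\in S$ in turn, run LoadBalance$(\{u\},V,\cdot)$ (i.e. with $R=V$) on $\lceil\sqrt n\rceil$ copies of each token allocated to $u$, filled up with dummies to at least $n$ items. 3. *Exchange.* Repeat GreedyExchange (on the actual token sets) until some node $s$ holds at least $n-\kappa\sqrt n\log n$ tokens. If gossip is not complete, let $T$ be the token set of $s$ and (a) broadcast $T$ (padded with dummies to $n$ items) in $\lceil\sigma\log n\rceil$ stages: with $F$ the nodes holding all of $T$ at the start of the stage and $R=V\setminus F$, if $R\neq\emptyset$ carry out $\lceil\varphi\sqrt n\log n\rceil$ phases, each consisting of LoadBalance from $F$ to $R$ followed by $n$ rounds of GreedyExchange started from the item sets in which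 nodes of $F$ have all items and nodes of $R$ exactly those just placed at them; (b) for each token not in $T$ in turn, flood it for $n$ rounds. **Theorem.** (1) For every $c>0$ there are constants $\kappa,\varphi,\sigma,C>0$ such that for all $n\ge2$, all oblivious adversaries and all initial distributions of $n$ tokens, the algorithm above completes $n$-gossip in at most $C\,n^{3/2}\log^2 n$ rounds with probability at least $1-n^{-c}$. (2) There is $d\in\mathbb N$ such that for every $c>0$ there is $C>0$ such that for all $n\ge2$ and $k\ge0$ there is a centralized token-forwarding algorithm that, against every oblivious adversary and from every initial distribution of $k$ tokens, completes $k$-gossip in at most $\min\{nk,\;C\,(n+k)\sqrt n\,\log^d n\}$ rounds with probability at least $1-n^{-c}$. -/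

import Mathlib

namespace Gossip

/-! ### Centralized token forwarding in a dynamic network -/

/-- The set of tokens that each node holds. -/
abbrev Holdings (V K : Type) : Type := V → Finset K

/-- `s u v` is the at most one item that node `u` sends to node `v` in a round. -/
abbrev Sends (V ι : Type) : Type := V → V → Option ι

/-- A centralized randomized token-forwarding algorithm on the nodes `V` with the tokens `K`, which
returns a value in `α` when it stops. It may look at all current token sets, toss coins, and carry
out a round of communication; in a round it sees the network of that round (and nothing of the
later ones) before it decides which token goes over which edge in which direction. -/
inductive Protocol (V K α : Type) : Type 1
  | halt (a : α) : Protocol V K α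
  | look (next : Holdings V K → Protocol V K α) : Protocol V K α
  | toss {Ω : Type} (p : PMF Ω) (next : Ω → Protocol V K α) : Protocol V K α
  | round (send : SimpleGraph V → Sends V K) (next : SimpleGraph V → Protocol V K α) :
      Protocol V K α

/-- Sequential composition. -/
def Protocol.bind {V K α β : Type} (A : Protocol V K α) (f : α → Protocol V K β) :
    Protocol V K β :=
  match A with
  | .halt a => f a
  | .look next => .look fun H => (next H).bind f
  | .toss p next => .toss p fun x => (next x).bind f
  | .round send next => .round send fun G => (next G).bind f

instance {V K : Type} : Monad (Protocol V K) where
  pure := Protocol.halt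
  bind := Protocol.bind

open Classical in
/-- The effect of a round on the network `G`: a token is handed over only along an edge of `G` and
only by a node that holds it, and nodes never lose tokens. -/
noncomputable def deliver {V K : Type} [Fintype K] (G : SimpleGraph V) (s : Sends V K)
    (H : Holdings V K) : Holdings V K := fun v =>
  Finset.univ.filter fun τ => τ ∈ H v ∨ ∃ u, G.Adj u v ∧ τ ∈ H u ∧ s u v = some τ

/-- The joint law of the returned value, the number of rounds that have passed and the final token
sets, when the algorithm is started after `t` rounds with the token sets `H`. The sequence `G` of
networks is fixed in advance (oblivious adversary). -/
noncomputable def Protocol.run {V K α : Type} [Fintype K] (G : ℕ → SimpleGraph V)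
    (A : Protocol V K α) (t : ℕ) (H : Holdings V K) : PMF (α × ℕ × Holdings V K) :=
  match A with
  | .halt a => PMF.pure (a, t, H)
  | .look next => (next H).run G t H
  | .toss p next => p.bind fun x => (next x).run G t H
  | .round send next => (next (G t)).run G (t + 1) (deliver (G t) (send (G t)) H)

/-- The probability that the algorithm stops after at most `T` rounds and that every node then holds
every token. -/
noncomputable def Protocol.completionProb {V K α : Type} [Fintype K] (A : Protocol V K α)
    (G : ℕ → SimpleGraph V) (H₀ : Holdings V K) (T : ℝ) : ENNReal :=
  (A.run G 0 H₀).toOuterMeasure {o | (o.2.1 : ℝ) ≤ T ∧ ∀ v, o.2.2 v = Finset.univ}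

/-! ### Elementary procedures -/

section Procedures

variable {V K : Type}

/-- The uniformly random element of a finite type. -/
noncomputable def uniform (Ω : Type) [Fintype Ω] [Nonempty Ω] : Protocol V K Ω :=
  .toss (PMF.uniformOfFintype Ω) .halt

/-- The token sets at present. -/
def current : Protocol V K (Holdings V K) := .look .halt

/-- Carry out `A` exactly `m` times. -/
def repeatTimes (m : ℕ) (A : Protocol V K Unit) : Protocol V K Unit :=
  (List.range m).foldlM (fun _ _ => A) ()

/-- Carry out `f i` for the entries `i` of the list `l`, one after the other. -/
def forEach {ι : Type} (l : List ι) (f : ι → Protocol V K Unit) : Protocol V K Unit :=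
  l.foldlM (fun _ i => f i) ()

/-- One round in which items of type `ι` travel; `label x` is the token that the item `x` is a copy
of, and `none` if `x` is a dummy (nothing is then transmitted). The bookkeeping `upd` depends on the
network of the round. -/
def itemRound {ι σ : Type} (label : ι → Option K) (send : SimpleGraph V → Sends V ι)
    (upd : SimpleGraph V → σ) : Protocol V K σ :=
  .round (fun G u v => (send G u v).bind label) fun G => .halt (upd G)

/-- Flooding of `τ` for `m` rounds: every node that holds `τ` sends it to all its neighbours. (A
node that does not hold `τ` cannot send it, see `deliver`.) -/
def flood (τ : K) (m : ℕ) : Protocol V K Unit :=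
  repeatTimes m (itemRound (ι := K) some (fun _ _ _ => some τ) fun _ => ())

end Procedures

/-! ### Greedy token exchange -/

/-- `m` is a matching between the neighbours of `v` and the items that `v` lacks; `m u = some x`
says that `u` holds `x` and is matched to it. -/
def IsMatchingAt {V ι : Type} (G : SimpleGraph V) (S : V → Finset ι) (v : V)
    (m : V → Option ι) : Prop :=
  (∀ u x, m u = some x → G.Adj u v ∧ x ∈ S u ∧ x ∉ S v) ∧
    ∀ u u' x, m u = some x → m u' = some x → u = u'

/-- The number of pairs in a matching. -/
def matchingSize {V ι : Type} [Fintype V] (m : V → Option ι) : ℕ :=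
  (Finset.univ.filter fun u => (m u).isSome).card

/-- `m` is a matching at `v` of the largest possible size. -/
def IsMaximumMatchingAt {V ι : Type} [Fintype V] (G : SimpleGraph V) (S : V → Finset ι) (v : V)
    (m : V → Option ι) : Prop :=
  IsMatchingAt G S v m ∧ ∀ m', IsMatchingAt G S v m' → matchingSize m' ≤ matchingSize m

/-- The transmissions of `GreedyExchange`: towards every node `v`, those of a maximum matching. -/
noncomputable def greedySend {V ι : Type} [Fintype V] (S : V → Finset ι) (G : SimpleGraph V) :
    Sends V ι := fun u v =>
  Classical.epsilon (IsMaximumMatchingAt G S v) u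

open Classical in
/-- The item sets after a round of `GreedyExchange`. -/
noncomputable def greedyUpdate {V ι : Type} [Fintype V] [Fintype ι] (S : V → Finset ι)
    (G : SimpleGraph V) : V → Finset ι := fun v =>
  Finset.univ.filter fun x => x ∈ S v ∨ ∃ u, greedySend S G u v = some x

/-- One round of `GreedyExchange` from the item sets `S`. -/
noncomputable def greedyExchange {V K ι : Type} [Fintype V] [Fintype ι] (label : ι → Option K)
    (S : V → Finset ι) : Protocol V K (V → Finset ι) :=
  itemRound label (greedySend S) (greedyUpdate S)

/-! ### Random load balancing

Items are named by their ranks `0, …, N - 1`, and `h v` is the set of items placed at `v`. -/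

open Classical in
/-- The nodes of `R` that may get an item: those with fewer than `⌊N / |R|⌋` items and, when there
are none left, those with fewer than `⌈N / |R|⌉` items. -/
noncomputable def eligible {V : Type} (R : Finset V) {N : ℕ} (h : V → Finset (Fin N)) : Finset V :=
  if ∃ v ∈ R, (h v).card < N / R.card then R.filter fun v => (h v).card < N / R.card
  else R.filter fun v => (h v).card < N ⌈/⌉ R.card

/-- `p` lists the nodes of a path of `G` from `F` to `E` of length `d(F, E)`. -/
def IsRoute {V : Type} (G : SimpleGraph V) (F E : Finset V) (p : List V) : Prop :=
  p.IsChain G.Adj ∧ (∃ u ∈ F, p.head? = some u) ∧ (∃ v ∈ E, p.getLast? = some v) ∧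
    ∀ u ∈ F, ∀ v ∈ E, p.length ≤ G.dist u v + 1

/-- A shortest path from `F` to an eligible node of `R` that is closest to `F`. -/
noncomputable def route {V : Type} (F R : Finset V) {N : ℕ} (h : V → Finset (Fin N))
    (G : SimpleGraph V) : List V :=
  Classical.epsilon (IsRoute G F (eligible R h))

open Classical in
/-- The transmissions in the round that brings in the item `i`: the first node of the path sends
`i` to the next one, every other node sends on some item placed at it before. -/
noncomputable def balanceSend {V : Type} (F R : Finset V) {N : ℕ} (i : Fin N)
    (h : V → Finset (Fin N)) (G : SimpleGraph V) : Sends V (Fin N) := fun u w =>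
  if [u, w] <:+: route F R h G then
    if (route F R h G).head? = some u then some i else (h u).toList.head?
  else none

open Classical in
/-- The placement after that round. Sent items are moved, not copied; if the path is a single node,
then `i` is placed there. -/
noncomputable def balanceUpdate {V : Type} (F R : Finset V) {N : ℕ} (i : Fin N)
    (h : V → Finset (Fin N)) (G : SimpleGraph V) : V → Finset (Fin N) := fun v =>
  Finset.univ.filter fun x =>
    (x ∈ h v ∧ ¬ ∃ w, balanceSend F R i h G v w = some x) ∨
      (∃ u, balanceSend F R i h G u v = some x) ∨ (route F R h G = [v] ∧ x = i)

/-- `LoadBalance(F, T, R)` for the list `T` of items (`none` is a dummy). The items are ranked by a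
uniformly random permutation and brought in one per round. It returns the item of each rank and
the final placement of the ranks. -/
noncomputable def loadBalance {V K : Type} (F : Finset V) (T : List (Option K)) (R : Finset V) :
    Protocol V K ((Fin T.length → Option K) × (V → Finset (Fin T.length))) := do
  let π ← uniform (Equiv.Perm (Fin T.length))
  let h ← (List.finRange T.length).foldlM
    (fun h i => itemRound (fun x => T.get (π x)) (balanceSend F R i h) (balanceUpdate F R i h))
    (fun _ => ∅)
  pure (fun x => T.get (π x), h)

/-! ### Broadcast of the tokens of one node -/

section Broadcast

variable {V K : Type} [Fintype V] [Fintype K]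

open Classical in
/-- The tokens of `T`, padded with dummies (one for every token outside `T`). -/
noncomputable def paddedTokens (T : Finset K) : List (Option K) :=
  (Finset.univ : Finset K).toList.map fun τ => if τ ∈ T then some τ else none

open Classical in
/-- A phase: distribute the items among the nodes of `R`, then carry out `n` rounds of
`GreedyExchange` in which at first a node of `F` has all items and a node of `R` has exactly the
items just placed at it. -/
noncomputable def broadcastPhase (T : Finset K) (F R : Finset V) : Protocol V K Unit := do
  let (label, h) ← loadBalance F (paddedTokens T) R
  let _ ← (List.range (Fintype.card V)).foldlM (fun S _ => greedyExchange label S)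
    (fun v => if v ∈ F then Finset.univ else h v)
  pure ()

open Classical in
/-- A stage: `phases` phases, with `F` the nodes that hold all of `T` when the stage starts and `R`
the others (nothing is done if there are no others). -/
noncomputable def broadcastStage (phases : ℕ) (T : Finset K) : Protocol V K Unit := do
  let H ← current
  let F := Finset.univ.filter fun v => T ⊆ H v
  let R := Finset.univ.filter fun v => ¬ T ⊆ H v
  if R = ∅ then pure () else repeatTimes phases (broadcastPhase T F R)

/-- Broadcast of `T`: `⌈σ log n⌉` stages of `⌈φ √n log n⌉` phases each. -/
noncomputable def broadcast (φ σ : ℝ) (T : Finset K) : Protocol V K Unit :=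
  repeatTimes ⌈σ * Real.log (Fintype.card V)⌉₊
    (broadcastStage ⌈φ * √(Fintype.card V) * Real.log (Fintype.card V)⌉₊ T)

end Broadcast

/-! ### The algorithm for `n`-gossip -/

section Algorithm

variable {V K : Type} [Fintype V] [Fintype K]

/-- Every token is held by some node of `S`. -/
def Hits (H : Holdings V K) (S : Finset V) : Prop := ∀ τ, ∃ v ∈ S, τ ∈ H v

/-- A smallest set of nodes that together hold all tokens. -/
noncomputable def leaders (H : Holdings V K) : Finset V :=
  Classical.epsilon fun S => Hits H S ∧ ∀ S', Hits H S' → S.card ≤ S'.card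

/-- An assignment of each token to exactly one of the leaders that hold it. -/
noncomputable def allocation (H : Holdings V K) : V → Finset K :=
  Classical.epsilon fun A =>
    (∀ u ∈ leaders H, A u ⊆ H u) ∧ ∀ τ, ∃! u, u ∈ leaders H ∧ τ ∈ A u

/-- Consolidation: each token in turn is flooded for `⌈√n⌉` rounds. -/
noncomputable def consolidation : Protocol V K Unit :=
  forEach (Finset.univ : Finset K).toList fun τ => flood τ ⌈√(Fintype.card V)⌉₊

/-- `⌈√n⌉` copies of each token of `A`, filled up with dummies to at least `n` items. -/
noncomputable def copies (V : Type) {K : Type} [Fintype V] (A : Finset K) : List (Option K) :=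
  let L := A.toList.flatMap fun τ => List.replicate ⌈√(Fintype.card V)⌉₊ (some τ)
  L ++ List.replicate (Fintype.card V - L.length) none

/-- Distribution: one leader after the other balances the copies of its tokens over all nodes. -/
noncomputable def distribution : Protocol V K Unit := do
  let H ← current
  forEach (leaders H).toList fun u => do
    let _ ← loadBalance {u} (copies V (allocation H u)) Finset.univ
    pure ()

/-- `T` is the token set of a node that holds at least `n - κ √n log n` tokens. -/
def IsRich (κ : ℝ) (H : Holdings V K) (T : Finset K) : Prop :=
  (∃ s, H s = T) ∧
    (Fintype.card V : ℝ) - κ * √(Fintype.card V) * Real.log (Fintype.card V) ≤ T.card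

open Classical in
/-- `GreedyExchange` until there is a rich node, and for at most `m` rounds. -/
noncomputable def exchangeUntilRich (κ : ℝ) : ℕ → Protocol V K Unit
  | 0 => pure ()
  | m + 1 => do
    let H ← current
    if ∃ T, IsRich κ H T then pure () else do
      let _ ← greedyExchange some H
      exchangeUntilRich κ m

open Classical in
/-- Exchange: `GreedyExchange` until there is a rich node `s`; then, unless gossip is complete, a
broadcast of the tokens of `s` and a separate flooding for `n` rounds of each token that `s` lacks.
(As long as gossip is incomplete, a greedy round on a connected network adds a token to some node, so
the cap of `n * n` rounds is never met before there is a rich node.) -/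
noncomputable def exchange (κ φ σ : ℝ) : Protocol V K Unit := do
  exchangeUntilRich κ (Fintype.card V * Fintype.card V)
  let H ← current
  if ∀ v, H v = Finset.univ then pure () else do
    let T := Classical.epsilon (IsRich κ H)
    broadcast φ σ T
    forEach (Finset.univ.filter fun τ => τ ∉ T).toList fun τ => flood τ (Fintype.card V)

/-- The centralized algorithm for `n`-gossip, where `n` is the number of nodes and of tokens. -/
noncomputable def nGossip (V K : Type) [Fintype V] [Fintype K] (κ φ σ : ℝ) :
    Protocol V K Unit := do
  consolidation
  distribution
  exchange κ φ σ

end Algorithm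

end Gossip

namespace Gossip

set_option linter.unusedSectionVars false

open scoped ENNReal

/-! Two deterministic facts about greedy exchange, combined with randomness that enters only through
permutations, carry the proof.

Progress of greedy exchange. By König's theorem a maximum matching towards `v` that gains few items
comes with an equally small cover: a few neighbours of `v` and a few items outside which no
neighbour has news for `v` (`exists_cover`). If the total gain of a round is at most `P`, deleting
the covered edges of a connected network leaves at most `P + 1` components, on each of which the
item sets agree up to one set of at most `P` items (`exists_components`). So slow progress forces
large groups of nodes to hold nearly the same items, and any guarantee that item sets are diverse
forces progress.

Randomness. Load balancing moves ranks along routes that depend on the networks alone, and the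
adversary is oblivious; hence the set of ranks at each node is fixed in advance and only the
assignment of items to ranks is random. The probability that `D` given ranks receive none of `P`
given items out of `N` is at most `exp (-D P / N)` (`card_perm_avoid_div_le`,
`prob_loadBalance_bind_le`).

The `n`-gossip algorithm. Consolidation gives each token to about `√n` nodes, so a greedy hitting
set has about `√n log n` nodes and there are no more leaders than that (`card_leaders_le`).
Distribution spreads `√n` copies of each token; a union bound over pairs of an `a`-set of nodes and
an `a`-set of tokens, `a` of order `√n log n`, shows that each pair meets (`prob_distribution_le`).
This is the diversity that makes every round of the exchange gain at least `n / (2a)` tokens until a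
node lacks at most `κ √n log n` of them (`le_gain_of_not_rich`); since there are only `n²` pairs of
a node and a token, `2an` rounds suffice. In a broadcast phase every node of `R` starts with an item
of its own, the weak form of diversity under which `n` greedy rounds bring about `√n` ranks to a
constant fraction of `R` (`exists_card_le_greedyRun`). Over about `√n log n` phases a constant
fraction of `R` collects order `n log n` ranks in total, and therefore all of `T` with high
probability (`prob_broadcastStage_le`). Thus each stage removes a constant fraction of the nodes
that lack `T`, and logarithmically many stages suffice. The few remaining tokens are flooded.

For `k` tokens, the algorithm is run on `n` incomplete tokens at a time, padded with dummies, in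
`2⌈k/n⌉` trials. Failure requires more than half of the trials to fail, so its probability stays
below that of a single failure, whatever `k` is (`prob_repeat_trial_le`). When `nk` is the smaller
bound, all tokens are flooded instead. -/

/-! ### Expectations and certain outcomes of protocols -/

section Calculus

variable {V K : Type} [Fintype K]

/-- The expectation of `f` (value, number of rounds, token sets) after a run of `A`. -/
noncomputable def Protocol.ew {α : Type} (G : ℕ → SimpleGraph V) (A : Protocol V K α) (t : ℕ)
    (H : Holdings V K) (f : α → ℕ → Holdings V K → ℝ≥0∞) : ℝ≥0∞ :=
  match A with
  | .halt a => f a t H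
  | .look next => (next H).ew G t H f
  | .toss p next => ∑' x, p x * (next x).ew G t H f
  | .round send next => (next (G t)).ew G (t + 1) (deliver (G t) (send (G t)) H) f

/-- `post` holds after every run of `A`, whatever the coin tosses. -/
def Protocol.Always {α : Type} (G : ℕ → SimpleGraph V) (A : Protocol V K α) (t : ℕ)
    (H : Holdings V K) (post : α → ℕ → Holdings V K → Prop) : Prop :=
  match A with
  | .halt a => post a t H
  | .look next => (next H).Always G t H post
  | .toss _ next => ∀ x, (next x).Always G t H post
  | .round send next => (next (G t)).Always G (t + 1) (deliver (G t) (send (G t)) H) post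

variable {α β : Type} {G : ℕ → SimpleGraph V} {A : Protocol V K α} {t : ℕ} {H : Holdings V K}

theorem bind_eq (A : Protocol V K α) (f : α → Protocol V K β) : (A >>= f) = A.bind f := rfl

theorem Protocol.run_toOuterMeasure (s : Set (α × ℕ × Holdings V K)) :
    (A.run G t H).toOuterMeasure s =
      A.ew G t H (fun a t' H' => s.indicator 1 (a, t', H')) := by
  induction A generalizing t H with
  | halt a =>
    classical
    simp [Protocol.run, Protocol.ew, PMF.toOuterMeasure_pure_apply, Set.indicator_apply]
  | look next ih => exact ih H
  | toss p next ih =>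
    simp only [Protocol.run, Protocol.ew, PMF.toOuterMeasure_bind_apply, ih]
  | round send next ih => exact ih (G t)

theorem Protocol.ew_bind (B : α → Protocol V K β) (f : β → ℕ → Holdings V K → ℝ≥0∞) :
    (A >>= B).ew G t H f = A.ew G t H (fun a t' H' => (B a).ew G t' H' f) := by
  rw [bind_eq]
  induction A generalizing t H with
  | halt a => rfl
  | look next ih => exact ih H
  | toss p next ih => simp only [Protocol.bind, Protocol.ew, ih]
  | round send next ih => exact ih (G t)

theorem Protocol.always_bind {B : α → Protocol V K β} {post : β → ℕ → Holdings V K → Prop} :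
    (A >>= B).Always G t H post ↔
      A.Always G t H (fun a t' H' => (B a).Always G t' H' post) := by
  rw [bind_eq]
  induction A generalizing t H with
  | halt a => rfl
  | look next ih => exact ih H
  | toss p next ih => simp only [Protocol.bind, Protocol.Always, ih]
  | round send next ih => exact ih (G t)

theorem Protocol.Always.mono {p q : α → ℕ → Holdings V K → Prop} (h : A.Always G t H p)
    (hpq : ∀ a t' H', p a t' H' → q a t' H') : A.Always G t H q := by
  induction A generalizing t H with
  | halt a => exact hpq _ _ _ h
  | look next ih => exact ih H h
  | toss p next ih => exact fun x => ih x (h x)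
  | round send next ih => exact ih (G t) h

theorem Protocol.Always.and {p q : α → ℕ → Holdings V K → Prop} (h : A.Always G t H p)
    (h' : A.Always G t H q) : A.Always G t H (fun a t' H' => p a t' H' ∧ q a t' H') := by
  induction A generalizing t H with
  | halt a => exact ⟨h, h'⟩
  | look next ih => exact ih H h h'
  | toss p next ih => exact fun x => ih x (h x) (h' x)
  | round send next ih => exact ih (G t) h h'

theorem Protocol.Always.bind {B : α → Protocol V K β} {p : α → ℕ → Holdings V K → Prop}
    {post : β → ℕ → Holdings V K → Prop} (h : A.Always G t H p)
    (hB : ∀ a t' H', p a t' H' → (B a).Always G t' H' post) : (A >>= B).Always G t H post :=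
  Protocol.always_bind.2 (h.mono hB)

theorem Protocol.always_of_forall {p : α → ℕ → Holdings V K → Prop} (h : ∀ a t' H', p a t' H') :
    A.Always G t H p := by
  induction A generalizing t H with
  | halt a => exact h _ _ _
  | look next ih => exact ih H
  | toss p next ih => exact fun x => ih x
  | round send next ih => exact ih (G t)

theorem Protocol.Always.ew_mono {f g : α → ℕ → Holdings V K → ℝ≥0∞}
    (h : A.Always G t H (fun a t' H' => f a t' H' ≤ g a t' H')) :
    A.ew G t H f ≤ A.ew G t H g := by
  induction A generalizing t H with
  | halt a => exact h
  | look next ih => exact ih H h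
  | toss p next ih => exact ENNReal.tsum_le_tsum fun x => mul_le_mul_right (ih x (h x)) _
  | round send next ih => exact ih (G t) h

theorem Protocol.ew_mono {f g : α → ℕ → Holdings V K → ℝ≥0∞}
    (h : ∀ a t' H', f a t' H' ≤ g a t' H') : A.ew G t H f ≤ A.ew G t H g :=
  (Protocol.always_of_forall h).ew_mono

theorem Protocol.ew_const (c : ℝ≥0∞) : A.ew G t H (fun _ _ _ => c) = c := by
  induction A generalizing t H with
  | halt a => rfl
  | look next ih => exact ih H
  | toss p next ih => simp only [Protocol.ew, ih, ENNReal.tsum_mul_right, p.tsum_coe, one_mul]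
  | round send next ih => exact ih (G t)

theorem Protocol.Always.ew_le {f : α → ℕ → Holdings V K → ℝ≥0∞} {c : ℝ≥0∞}
    (h : A.Always G t H (fun a t' H' => f a t' H' ≤ c)) : A.ew G t H f ≤ c :=
  (Protocol.Always.ew_mono h).trans (Protocol.ew_const c).le

theorem Protocol.ew_add (f g : α → ℕ → Holdings V K → ℝ≥0∞) :
    A.ew G t H (fun a t' H' => f a t' H' + g a t' H') = A.ew G t H f + A.ew G t H g := by
  induction A generalizing t H with
  | halt a => rfl
  | look next ih => exact ih H
  | toss p next ih => simp only [Protocol.ew, ih, mul_add, ENNReal.tsum_add]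
  | round send next ih => exact ih (G t)

theorem Protocol.ew_sum {ι : Type*} (s : Finset ι) (f : ι → α → ℕ → Holdings V K → ℝ≥0∞) :
    A.ew G t H (fun a t' H' => ∑ i ∈ s, f i a t' H') = ∑ i ∈ s, A.ew G t H (f i) := by
  classical
  induction s using Finset.induction_on with
  | empty => simpa using Protocol.ew_const 0
  | insert i s hi ih => simp only [Finset.sum_insert hi, Protocol.ew_add, ih]

theorem Protocol.ew_mul_const (c : ℝ≥0∞) (f : α → ℕ → Holdings V K → ℝ≥0∞) :
    A.ew G t H (fun a t' H' => f a t' H' * c) = A.ew G t H f * c := by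
  induction A generalizing t H with
  | halt a => rfl
  | look next ih => exact ih H
  | toss p next ih =>
    simp only [Protocol.ew, ih, ← mul_assoc, ENNReal.tsum_mul_right]
  | round send next ih => exact ih (G t)

theorem subset_deliver (G : SimpleGraph V) (s : Sends V K) (H : Holdings V K) :
    H ≤ deliver G s H := fun v τ hτ => by simp [deliver, hτ]

/-- Nodes never lose tokens. -/
theorem Protocol.always_le : A.Always G t H (fun _ _ H' => H ≤ H') := by
  induction A generalizing t H with
  | halt a => exact le_rfl
  | look next ih => exact ih H
  | toss p next ih => exact fun x => ih x
  | round send next ih =>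
    exact (ih (G t) (H := deliver (G t) (send (G t)) H)).mono
      fun _ _ _ h => (subset_deliver _ _ _).trans h

open Classical in
/-- The probability that `bad` holds after a run of `A`. -/
noncomputable def Protocol.prob (G : ℕ → SimpleGraph V) (A : Protocol V K α) (t : ℕ)
    (H : Holdings V K) (bad : α → ℕ → Holdings V K → Prop) : ℝ≥0∞ :=
  A.ew G t H (fun a t' H' => if bad a t' H' then 1 else 0)

theorem Protocol.Always.prob_mono {p q : α → ℕ → Holdings V K → Prop}
    (h : A.Always G t H (fun a t' H' => p a t' H' → q a t' H')) :
    A.prob G t H p ≤ A.prob G t H q :=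
  Protocol.Always.ew_mono (h.mono fun a t' H' h => by
    by_cases hp : p a t' H'
    · simp [hp, h hp]
    · simp [hp])

theorem Protocol.Always.prob_eq_zero {p : α → ℕ → Holdings V K → Prop}
    (h : A.Always G t H (fun a t' H' => ¬ p a t' H')) : A.prob G t H p = 0 :=
  le_antisymm (Protocol.Always.ew_le (h.mono fun a t' H' h => by simp [h])) bot_le

theorem Protocol.prob_le_one {p : α → ℕ → Holdings V K → Prop} : A.prob G t H p ≤ 1 :=
  Protocol.Always.ew_le (Protocol.always_of_forall fun a t' H' => by split_ifs <;> simp)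

theorem Protocol.prob_exists_le {ι : Type*} (s : Finset ι)
    {p : ι → α → ℕ → Holdings V K → Prop} :
    A.prob G t H (fun a t' H' => ∃ i ∈ s, p i a t' H') ≤ ∑ i ∈ s, A.prob G t H (p i) := by
  classical
  unfold Protocol.prob
  rw [← Protocol.ew_sum]
  refine Protocol.ew_mono fun a t' H' => ?_
  split_ifs with h
  · obtain ⟨i, hi, hp⟩ := h
    refine le_trans ?_ (Finset.single_le_sum (f := fun i => if p i a t' H' then (1 : ℝ≥0∞) else 0)
      (fun _ _ => bot_le) hi)
    simp [hp]
  · exact bot_le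

/-- If `mid` fails with probability at most `ε`, and after it `bad` has probability at most `δ`. -/
theorem Protocol.prob_bind_le {B : α → Protocol V K β} {bad : β → ℕ → Holdings V K → Prop}
    {mid : α → ℕ → Holdings V K → Prop} {ε δ : ℝ≥0∞} (h : A.prob G t H mid ≤ ε)
    (hB : A.Always G t H
      (fun a t' H' => ¬ mid a t' H' → (B a).prob G t' H' bad ≤ δ)) :
    (A >>= B).prob G t H bad ≤ ε + δ := by
  classical
  unfold Protocol.prob at *
  rw [Protocol.ew_bind]
  refine (Protocol.Always.ew_mono
    (g := fun a t' H' => (if mid a t' H' then 1 else 0) + δ) ?_).trans ?_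
  · refine hB.mono fun a t' H' h => ?_
    by_cases hm : mid a t' H'
    · simp only [hm, if_true]
      exact le_add_right Protocol.prob_le_one
    · simpa [hm] using h hm
  · rw [Protocol.ew_add, Protocol.ew_const]
    exact add_le_add_left h _

/-- If `mid` is necessary for `bad` and has probability at most `ε`, and after it `bad` has
probability at most `δ`. -/
theorem Protocol.prob_bind_le_mul {B : α → Protocol V K β} {bad : β → ℕ → Holdings V K → Prop}
    {mid : α → ℕ → Holdings V K → Prop} {ε δ : ℝ≥0∞} (h : A.prob G t H mid ≤ ε)
    (hB : A.Always G t H (fun a t' H' => (mid a t' H' → (B a).prob G t' H' bad ≤ δ) ∧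
      (¬ mid a t' H' → (B a).Always G t' H' fun b t'' H'' => ¬ bad b t'' H''))) :
    (A >>= B).prob G t H bad ≤ ε * δ := by
  classical
  have key := Protocol.Always.ew_mono (A := A) (G := G) (t := t) (H := H)
    (f := fun a t' H' => (B a).prob G t' H' bad)
    (g := fun a t' H' => (if mid a t' H' then 1 else 0) * δ) (hB.mono fun a t' H' h => by
      by_cases hm : mid a t' H'
      · simpa [hm] using h.1 hm
      · simpa [hm] using (h.2 hm).prob_eq_zero.le)
  rw [Protocol.ew_mul_const] at key
  unfold Protocol.prob at *
  rw [Protocol.ew_bind]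
  exact key.trans (mul_le_mul_left h _)

theorem Protocol.completionProb_ge {H₀ : Holdings V K} {T : ℝ} {ε : ℝ} (hε : 0 ≤ ε)
    (h : A.prob G 0 H₀ (fun _ t' H' => ¬ ((t' : ℝ) ≤ T ∧ ∀ v, H' v = Finset.univ))
      ≤ ENNReal.ofReal ε) :
    ENNReal.ofReal (1 - ε) ≤ A.completionProb G H₀ T := by
  classical
  unfold Protocol.completionProb
  rw [Protocol.run_toOuterMeasure, ENNReal.ofReal_sub _ hε, ENNReal.ofReal_one]
  refine tsub_le_iff_left.2 ((?_ : (1 : ℝ≥0∞) ≤ _).trans (add_le_add_left h _))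
  rw [← Protocol.ew_const (A := A) (G := G) (t := 0) (H := H₀) 1]
  unfold Protocol.prob
  rw [← Protocol.ew_add]
  refine Protocol.ew_mono fun a t' H' => ?_
  by_cases hb : (t' : ℝ) ≤ T ∧ ∀ v, H' v = Finset.univ
  · simp [hb]
  · simp [hb]

/-! ### Loops -/

theorem foldlM_const (A : Protocol V K Unit) {ι κ : Type} :
    ∀ (l : List ι) (l' : List κ), l.length = l'.length →
      l.foldlM (fun _ _ => A) () = l'.foldlM (fun _ _ => A) ()
  | [], [], _ => rfl
  | _ :: l, _ :: l', h => by
    simp only [List.foldlM_cons]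
    congr 1
    funext u
    exact foldlM_const A l l' (by simpa using h)

theorem repeatTimes_zero (A : Protocol V K Unit) : repeatTimes 0 A = .halt () := rfl

theorem repeatTimes_succ (m : ℕ) (A : Protocol V K Unit) :
    repeatTimes (m + 1) A = A >>= fun _ => repeatTimes m A := by
  unfold repeatTimes
  rw [List.range_succ_eq_map, List.foldlM_cons]
  congr 1
  funext u
  exact foldlM_const A _ _ (by simp)

theorem forEach_nil {ι : Type} (f : ι → Protocol V K Unit) : forEach [] f = .halt () := rfl

theorem forEach_cons {ι : Type} (i : ι) (l : List ι) (f : ι → Protocol V K Unit) :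
    forEach (i :: l) f = f i >>= fun _ => forEach l f := rfl

end Calculus

/-! ### Progress of greedy exchange -/

section Greedy

variable {V ι : Type} [Fintype V]

theorem exists_isMaximumMatchingAt (G : SimpleGraph V) (S : V → Finset ι) (v : V) :
    ∃ m, IsMaximumMatchingAt G S v m := by
  set s : Set ℕ := {k | ∃ m, IsMatchingAt G S v m ∧ matchingSize m = k}
  have hb : BddAbove s := ⟨Fintype.card V, by
    rintro _ ⟨m, -, rfl⟩
    exact Finset.card_le_univ _⟩
  have hne : s.Nonempty := ⟨_, fun _ => none, ⟨by simp, by simp⟩, rfl⟩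
  obtain ⟨m, hm, hk⟩ := Nat.sSup_mem hne hb
  exact ⟨m, hm, fun m' hm' => hk ▸ le_csSup hb ⟨m', hm', rfl⟩⟩

theorem isMaximumMatchingAt_greedySend (G : SimpleGraph V) (S : V → Finset ι) (v : V) :
    IsMaximumMatchingAt G S v fun u => greedySend S G u v :=
  Classical.epsilon_spec (exists_isMaximumMatchingAt G S v)

/-- The number of items that `v` gets in a greedy round. -/
noncomputable def gain (G : SimpleGraph V) (S : V → Finset ι) (v : V) : ℕ :=
  matchingSize fun u => greedySend S G u v

theorem card_greedyUpdate [Fintype ι] (G : SimpleGraph V) (S : V → Finset ι) (v : V) :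
    (greedyUpdate S G v).card = (S v).card + gain G S v := by
  classical
  obtain ⟨⟨h1, h2⟩, -⟩ := isMaximumMatchingAt_greedySend G S v
  have hsplit : greedyUpdate S G v =
      S v ∪ Finset.univ.filter fun x => ∃ u, greedySend S G u v = some x := by
    ext x
    simp [greedyUpdate]
  rw [hsplit, Finset.card_union_of_disjoint]
  · congr 1
    symm
    refine Finset.card_bij (fun u hu => (greedySend S G u v).get (by simpa using hu)) ?_ ?_ ?_
    · intro u hu
      simp only [Finset.mem_filter, Finset.mem_univ, true_and]
      exact ⟨u, by simp⟩
    · intro u hu u' hu' h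
      exact h2 u u' _ (Option.some_get _).symm (by rw [h]; exact (Option.some_get _).symm)
    · intro x hx
      obtain ⟨u, hu⟩ := (Finset.mem_filter.1 hx).2
      exact ⟨u, by simp [hu], by simp [hu]⟩
  · rw [Finset.disjoint_left]
    intro x hx hx'
    obtain ⟨u, hu⟩ := (Finset.mem_filter.1 hx').2
    exact (h1 u x hu).2.2 hx

theorem subset_greedyUpdate [Fintype ι] (G : SimpleGraph V) (S : V → Finset ι) (v : V) :
    S v ⊆ greedyUpdate S G v := fun x hx => by simp [greedyUpdate, hx]

/-- A vertex cover that is no larger than the greedy matching at `v`. -/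
theorem exists_cover (G : SimpleGraph V) (S : V → Finset ι) (v : V) :
    ∃ (C : Finset V) (X : Finset ι), C.card ≤ gain G S v ∧ X.card ≤ gain G S v ∧
      C.card + X.card ≤ gain G S v ∧
      ∀ u, G.Adj u v → u ∉ C → ∀ x ∈ S u, x ∈ S v ∨ x ∈ X := by
  classical
  set U : Finset V := Finset.univ.filter fun u => G.Adj u v with hU
  set N : V → Finset ι := fun u => S u \ S v with hN
  -- The deficiency form of Hall's theorem: `A` violates Hall's condition the most, by `δ`. With `δ`
  -- extra items available to every neighbour the condition holds, and discarding the extra items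
  -- from the injection costs at most `δ` matched neighbours.
  obtain ⟨A, hAU, hA⟩ := Finset.exists_max_image U.powerset
    (fun A => (A.card : ℤ) - (A.biUnion N).card) ⟨∅, by simp⟩
  rw [Finset.mem_powerset] at hAU
  have h0 : (0 : ℤ) ≤ A.card - (A.biUnion N).card := by simpa using hA ∅ (by simp)
  obtain ⟨δ, hδ⟩ := Int.eq_ofNat_of_zero_le h0
  obtain ⟨f, hf, hft⟩ := (Finset.all_card_le_biUnion_card_iff_exists_injective
    (fun u : U => (N u).disjSum (Finset.univ : Finset (Fin δ)))).1 (by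
      intro s
      rcases s.eq_empty_or_nonempty with rfl | hs
      · simp
      have h1 := hA (s.map (Function.Embedding.subtype _)) (by
        rw [Finset.mem_powerset]
        intro u
        simp
        tauto)
      have h2 : ((s.map (Function.Embedding.subtype _)).biUnion N).disjSum
          (Finset.univ : Finset (Fin δ)) ⊆
          s.biUnion fun u : U => (N u).disjSum (Finset.univ : Finset (Fin δ)) := by
        obtain ⟨u₀, hu₀⟩ := hs
        rintro (x | x) hx
        · simp at hx ⊢
          tauto
        · simp
          exact ⟨_, _, hu₀⟩
      have h3 := Finset.card_le_card h2
      rw [Finset.card_disjSum, Finset.card_univ, Fintype.card_fin] at h3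
      rw [Finset.card_map] at h1
      omega)
  set m : V → Option ι := fun u => if h : u ∈ U then (f ⟨u, h⟩).getLeft? else none with hm
  have hmm : IsMatchingAt G S v m := by
    constructor
    · intro u x hx
      by_cases hu : u ∈ U
      · simp only [hm, hu, dite_true, Sum.getLeft?_eq_some_iff] at hx
        have := hft ⟨u, hu⟩
        rw [hx] at this
        simp [hN] at this
        exact ⟨by simpa [hU] using hu, this.1, this.2⟩
      · simp [hm, hu] at hx
    · intro u u' x hx hx'
      by_cases hu : u ∈ U
      · by_cases hu' : u' ∈ U
        · simp only [hm, hu, hu', dite_true, Sum.getLeft?_eq_some_iff] at hx hx'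
          exact congrArg Subtype.val (hf (hx.trans hx'.symm))
        · simp [hm, hu'] at hx'
      · simp [hm, hu] at hx
  have hsize : U.card ≤ matchingSize m + δ := by
    have h4 : (U.attach.filter fun u => (f u).isLeft).card ≤ matchingSize m := by
      refine Finset.card_le_card_of_injOn Subtype.val ?_ Subtype.val_injective.injOn
      intro u hu
      simp at hu
      simp [hm]
      rcases hfu : f u with x | x
      · simp
      · simp [hfu] at hu
    have h5 : (U.attach.filter fun u => ¬ (f u).isLeft).card ≤ δ := by
      have : (U.attach.filter fun u => ¬ (f u).isLeft).card ≤
          ((Finset.univ : Finset (Fin δ)).map ⟨Sum.inr (α := ι), Sum.inr_injective⟩).card := by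
        refine Finset.card_le_card_of_injOn f ?_ hf.injOn
        intro u hu
        simp at hu
        rcases hfu : f u with x | x
        · simp [hfu] at hu
        · simp
      simpa using this
    have h6 := Finset.card_filter_add_card_filter_not (s := U.attach) (fun u => (f u).isLeft)
    rw [Finset.card_attach] at h6
    omega
  have hmax : matchingSize m ≤ gain G S v := (isMaximumMatchingAt_greedySend G S v).2 m hmm
  have hUA := Finset.card_sdiff_add_card_eq_card hAU
  -- The size of this cover is `|U| - |A| + |N(A)| = |U| - δ`, at most the size of the matching just
  -- built.
  refine ⟨U \ A, A.biUnion N, by omega, by omega, by omega, fun u hu huC x hx => ?_⟩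
  have huA : u ∈ A := by
    by_contra h
    exact huC (by simp [hU, hu, h])
  by_cases hxv : x ∈ S v
  · exact Or.inl hxv
  · exact Or.inr (Finset.mem_biUnion.2 ⟨u, huA, by simp [hN, hx, hxv]⟩)

theorem exists_adj_dist_lt {G : SimpleGraph V} (hG : G.Connected) {v r : V} (h : v ≠ r) :
    ∃ u, G.Adj v u ∧ G.dist u r < G.dist v r := by
  obtain ⟨p, hp⟩ := hG.exists_walk_length_eq_dist v r
  cases p with
  | nil => exact absurd rfl h
  | cons hadj q =>
    refine ⟨_, hadj, ?_⟩
    have := SimpleGraph.dist_le q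
    simp at hp
    omega

/-- Deleting the edges `D` from a connected graph leaves at most `|D| + 1` components. -/
theorem card_connectedComponent_le {G : SimpleGraph V} (hG : G.Connected) (D : Finset (V × V))
    (H : SimpleGraph V) (hH : ∀ u v, G.Adj u v → (u, v) ∉ D → (v, u) ∉ D → H.Adj u v) :
    Nat.card H.ConnectedComponent ≤ D.card + 1 := by
  classical
  obtain ⟨r⟩ := hG.nonempty
  -- The node of `c` nearest to `r` in `G` has a neighbour still nearer, which lies outside `c`; the
  -- edge to it must have been deleted. Its farther endpoint identifies `c`, so different components
  -- get different elements of `D`.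
  have key : ∀ c : H.ConnectedComponent, c ≠ H.connectedComponentMk r →
      ∃ u v : V, H.connectedComponentMk v = c ∧ G.dist u r < G.dist v r ∧
        ((u, v) ∈ D ∨ (v, u) ∈ D) := by
    intro c hc
    obtain ⟨v, hv, hmin⟩ := Finset.exists_min_image
      (Finset.univ.filter fun v => H.connectedComponentMk v = c) (fun v => G.dist v r) (by
        obtain ⟨v, hv⟩ := c.exists_rep
        exact ⟨v, Finset.mem_filter.2 ⟨Finset.mem_univ _, hv⟩⟩)
    simp only [Finset.mem_filter, Finset.mem_univ, true_and] at hv hmin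
    obtain ⟨u, hu, hlt⟩ := exists_adj_dist_lt hG (v := v) (r := r) (by rintro rfl; exact hc hv.symm)
    refine ⟨u, v, hv, hlt, ?_⟩
    by_contra hD
    push Not at hD
    have hadj := hH u v hu.symm hD.1 hD.2
    have := hmin u ((SimpleGraph.ConnectedComponent.eq.2 hadj.reachable).trans hv)
    omega
  have : Nonempty V := ⟨r⟩
  choose! a b hb hlt hD using key
  have : ((Finset.univ : Finset H.ConnectedComponent).erase (H.connectedComponentMk r)).card
      ≤ D.card := by
    refine Finset.card_le_card_of_injOn (fun c => if (a c, b c) ∈ D then (a c, b c) else (b c, a c))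
      ?_ ?_
    · intro c hc
      have := hD c (by simpa using hc)
      simp only
      split_ifs with h
      · exact h
      · tauto
    · intro c hc c' hc' hcc
      have hc := (Finset.mem_erase.1 hc).1
      have hc' := (Finset.mem_erase.1 hc').1
      have h1 := hlt c hc
      have h2 := hlt c' hc'
      have : b c = b c' := by
        simp only at hcc
        split_ifs at hcc <;> simp only [Prod.mk.injEq] at hcc
        · exact hcc.2
        · rw [hcc.1, hcc.2] at h1; omega
        · rw [hcc.1, hcc.2] at h1; omega
        · exact hcc.1
      rw [← hb c hc, ← hb c' hc', this]
  rw [Finset.card_erase_of_mem (Finset.mem_univ _), Finset.card_univ] at this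
  rw [Nat.card_eq_fintype_card]
  omega

/-- If the nodes with fewer than `w` items make little progress, then up to the items in a small set
`X` the item sets are constant on the few components of a graph, as far as they stay small. -/
theorem exists_components {G : SimpleGraph V} (hG : G.Connected) (S : V → Finset ι) (w : ℕ) :
    ∃ (H : SimpleGraph V) (X : Finset ι),
      X.card ≤ ∑ v with (S v).card < w, gain G S v ∧
      Nat.card H.ConnectedComponent ≤ (∑ v with (S v).card < w, gain G S v) + 1 ∧
      ∀ v u, (S v).card + X.card < w → H.Reachable v u → ∀ x ∈ S u, x ∈ S v ∨ x ∈ X := by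
  classical
  -- The edges from `C v` to `v` are deleted for the nodes `v` with fewer than `w` items, and `X`
  -- collects their covering items.
  choose C X hC hX _ hcov using exists_cover G S
  set W : Finset V := Finset.univ.filter fun v => (S v).card < w with hW
  set D : Finset (V × V) := W.biUnion fun v => (C v).image fun u => (u, v) with hD
  have hDmem : ∀ u v, (u, v) ∈ D ↔ (S v).card < w ∧ u ∈ C v := by
    intro u v
    simp [hD, hW]
  have hDcard : D.card ≤ ∑ v ∈ W, gain G S v :=
    Finset.card_biUnion_le.trans
      (Finset.sum_le_sum fun v _ => Finset.card_image_le.trans (hC v))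
  refine ⟨G.deleteEdges {e | ∃ u v, e = s(u, v) ∧ (u, v) ∈ D}, W.biUnion X, ?_, ?_, ?_⟩
  · exact Finset.card_biUnion_le.trans (Finset.sum_le_sum fun v _ => hX v)
  · refine (card_connectedComponent_le hG D _ ?_).trans (by omega)
    intro u v huv h1 h2
    rw [SimpleGraph.deleteEdges_adj]
    refine ⟨huv, ?_⟩
    rintro ⟨a, b, hab, hm⟩
    rcases Sym2.eq_iff.1 hab with ⟨rfl, rfl⟩ | ⟨rfl, rfl⟩
    · exact h1 hm
    · exact h2 hm
  · intro v u hv hr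
    induction (SimpleGraph.reachable_iff_reflTransGen _ _).1 hr with
    | refl => exact fun x hx => Or.inl hx
    | @tail b c hb hbc ih =>
      have ih := ih ((SimpleGraph.reachable_iff_reflTransGen _ _).2 hb)
      -- The hypothesis `|S v| + |X| < w` keeps every node reached so far below `w`, so its cover
      -- was among those deleted and applies to the next edge.
      have hSb : (S b).card < w := by
        have : S b ⊆ S v ∪ W.biUnion X := fun x hx => Finset.mem_union.2 (ih x hx)
        exact ((Finset.card_le_card this).trans (Finset.card_union_le _ _)).trans_lt hv
      rw [SimpleGraph.deleteEdges_adj] at hbc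
      have hnC : c ∉ C b := fun h => hbc.2 ⟨c, b, Sym2.eq_swap, (hDmem c b).2 ⟨hSb, h⟩⟩
      intro x hx
      rcases hcov b c hbc.1.symm hnC x hx with h | h
      · exact ih x h
      · exact Or.inr (Finset.mem_biUnion.2 ⟨b, by simp [hW, hSb], h⟩)

end Greedy

/-! ### Random permutations -/

section Permutations

variable {α : Type} [Fintype α] [DecidableEq α]

/-- Composing with the transposition of `y` and `z` shows that, among permutations that keep `D`
away from `B`, all values outside `B` are hit equally often. The image of `D` has `|D|` elements
among these at most `n` values, so each is hit with conditional probability at least `|D| / n`. -/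
theorem card_perm_hit (D B : Finset α) {y : α} (hy : y ∉ B) :
    D.card * (Finset.univ.filter fun π : Equiv.Perm α => ∀ x ∈ D, π x ∉ B).card ≤
      Fintype.card α * (Finset.univ.filter fun π : Equiv.Perm α =>
        (∀ x ∈ D, π x ∉ B) ∧ ∃ x ∈ D, π x = y).card := by
  set E := Finset.univ.filter fun π : Equiv.Perm α => ∀ x ∈ D, π x ∉ B with hE
  have hsym : ∀ z ∈ Bᶜ, (E.filter fun π => ∃ x ∈ D, π x = z).card =
      (E.filter fun π => ∃ x ∈ D, π x = y).card := by
    intro z hz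
    rw [Finset.mem_compl] at hz
    have hB : ∀ w, Equiv.swap y z w ∈ B ↔ w ∈ B := by
      intro w
      by_cases h1 : w = y
      · subst h1; simp [hy, hz]
      by_cases h2 : w = z
      · subst h2; simp [hy, hz]
      rw [Equiv.swap_apply_of_ne_of_ne h1 h2]
    refine Finset.card_equiv (Equiv.mulLeft (Equiv.swap y z)) fun π => ?_
    simp [hE, hB, Equiv.swap_apply_eq_iff]
  have hsum : ∑ z ∈ Bᶜ, (E.filter fun π => ∃ x ∈ D, π x = z).card = D.card * E.card := by
    simp_rw [Finset.card_filter (p := fun π : Equiv.Perm α => ∃ x ∈ D, π x = _)]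
    rw [Finset.sum_comm]
    simp_rw [← Finset.card_filter]
    rw [Finset.sum_const_nat (m := D.card), mul_comm]
    intro π hπ
    rw [← Finset.card_image_of_injective D π.injective]
    congr 1
    ext z
    simp only [Finset.mem_filter, Finset.mem_compl, Finset.mem_image]
    constructor
    · exact fun h => h.2
    · rintro ⟨x, hx, rfl⟩
      exact ⟨(Finset.mem_filter.1 hπ).2 x hx, x, hx, rfl⟩
  rw [Finset.sum_congr rfl hsym, Finset.sum_const, smul_eq_mul] at hsum
  rw [← hsum, hE, Finset.filter_filter]
  exact Nat.mul_le_mul_right _ (Finset.card_le_univ _)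

/-- A random permutation sends no element of `D` into `B` with probability at most
`(1 - |D| / n) ^ |B|`. -/
theorem card_perm_avoid_le (D B : Finset α) :
    Fintype.card α ^ B.card *
        (Finset.univ.filter fun π : Equiv.Perm α => ∀ x ∈ D, π x ∉ B).card ≤
      (Fintype.card α - D.card) ^ B.card * Fintype.card (Equiv.Perm α) := by
  induction B using Finset.induction_on with
  | empty => simp [Finset.card_univ]
  | insert y B hy ih =>
    have h1 := card_perm_hit D B hy
    have h2 := Finset.card_filter_add_card_filter_not
      (s := Finset.univ.filter fun π : Equiv.Perm α => ∀ x ∈ D, π x ∉ B)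
      (fun π => ∃ x ∈ D, π x = y)
    rw [Finset.filter_filter, Finset.filter_filter] at h2
    have h3 : (Finset.univ.filter fun π : Equiv.Perm α => ∀ x ∈ D, π x ∉ insert y B) =
        Finset.univ.filter fun π : Equiv.Perm α => (∀ x ∈ D, π x ∉ B) ∧ ¬ ∃ x ∈ D, π x = y := by
      ext π
      simp only [Finset.mem_filter, Finset.mem_univ, true_and, Finset.mem_insert, not_or]
      push Not
      exact ⟨fun h => ⟨fun x hx => (h x hx).2, fun x hx => (h x hx).1⟩,
        fun h x hx => ⟨h.2 x hx, h.1 x hx⟩⟩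
    rw [h3, Finset.card_insert_of_notMem hy, pow_succ, pow_succ]
    set e := (Finset.univ.filter fun π : Equiv.Perm α => ∀ x ∈ D, π x ∉ B).card
    set e' := (Finset.univ.filter fun π : Equiv.Perm α =>
      (∀ x ∈ D, π x ∉ B) ∧ ¬ ∃ x ∈ D, π x = y).card
    have hD := Finset.card_le_univ D
    have h4 : Fintype.card α * e' ≤ (Fintype.card α - D.card) * e := by
      rw [tsub_mul]
      refine le_tsub_of_add_le_right ?_
      rw [← h2, mul_add]
      rw [← h2] at h1
      linarith
    calc Fintype.card α ^ B.card * Fintype.card α * e'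
        = Fintype.card α ^ B.card * (Fintype.card α * e') := by ring
      _ ≤ Fintype.card α ^ B.card * ((Fintype.card α - D.card) * e) := Nat.mul_le_mul_left _ h4
      _ = (Fintype.card α - D.card) * (Fintype.card α ^ B.card * e) := by ring
      _ ≤ _ := Nat.mul_le_mul_left _ ih
      _ = _ := by ring

theorem card_perm_avoid_div_le [Nonempty α] (D B : Finset α) :
    ((Finset.univ.filter fun π : Equiv.Perm α => ∀ x ∈ D, π x ∉ B).card : ℝ) /
      Fintype.card (Equiv.Perm α) ≤
      Real.exp (-((D.card : ℝ) * B.card / Fintype.card α)) := by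
  have h := card_perm_avoid_le D B
  have hD : D.card ≤ Fintype.card α := Finset.card_le_univ D
  have hN : (0 : ℝ) < Fintype.card α := by exact_mod_cast Fintype.card_pos
  have hP : (0 : ℝ) < Fintype.card (Equiv.Perm α) := by exact_mod_cast Fintype.card_pos
  have h' : (Fintype.card α : ℝ) ^ B.card *
        (Finset.univ.filter fun π : Equiv.Perm α => ∀ x ∈ D, π x ∉ B).card ≤
      ((Fintype.card α : ℝ) - D.card) ^ B.card * Fintype.card (Equiv.Perm α) := by
    rw [← Nat.cast_sub hD]
    exact_mod_cast h
  calc _ ≤ (1 - (D.card : ℝ) / Fintype.card α) ^ B.card := by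
        rw [div_le_iff₀ hP, one_sub_div hN.ne', div_pow, div_mul_eq_mul_div,
          le_div_iff₀ (by positivity), mul_comm]
        exact h'
    _ ≤ Real.exp (-((D.card : ℝ) / Fintype.card α)) ^ B.card := by
        refine pow_le_pow_left₀ ?_ (Real.one_sub_le_exp_neg _) _
        rw [sub_nonneg, div_le_one hN]
        exact_mod_cast hD
    _ = _ := by
        rw [← Real.exp_nat_mul]
        congr 1
        ring

end Permutations

/-! ### Routes of the load balancing -/

section Routes

variable {V : Type}

theorem exists_isRoute {G : SimpleGraph V} (hG : G.Connected) {F E : Finset V}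
    (hF : F.Nonempty) (hE : E.Nonempty) : ∃ p, IsRoute G F E p := by
  obtain ⟨⟨u, v⟩, huv, hmin⟩ := Finset.exists_min_image (F ×ˢ E) (fun e => G.dist e.1 e.2)
    (hF.product hE)
  obtain ⟨hu, hv⟩ := Finset.mem_product.1 huv
  obtain ⟨p, hp⟩ := hG.exists_walk_length_eq_dist u v
  refine ⟨p.support, p.isChain_adj_support, ⟨u, hu, ?_⟩, ⟨v, hv, ?_⟩, fun u' hu' v' hv' => ?_⟩
  · rw [List.head?_eq_some_head p.support_ne_nil, p.head_support]
  · rw [List.getLast?_eq_some_getLast p.support_ne_nil, p.getLast_support]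
  · rw [p.length_support, hp]
    exact Nat.succ_le_succ (hmin (u', v') (Finset.mem_product.2 ⟨hu', hv'⟩))

theorem dist_le_of_adj {G : SimpleGraph V} (hG : G.Connected) {f : ℕ → V} {ℓ : ℕ}
    (hf : ∀ j < ℓ, G.Adj (f j) (f (j + 1))) (i k : ℕ) (h : i + k ≤ ℓ) :
    G.dist (f i) (f (i + k)) ≤ k := by
  induction k with
  | zero => simp
  | succ k ih =>
    have h1 := hG.dist_triangle (u := f i) (v := f (i + k)) (w := f (i + (k + 1)))
    have h2 := SimpleGraph.dist_eq_one_iff_adj.2 (hf (i + k) (by omega))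
    have h3 := ih (by omega)
    rw [← add_assoc] at h1 ⊢
    omega

/-- The nodes `f 0, …, f ℓ` of a route. -/
structure RouteData (G : SimpleGraph V) (F E : Finset V) (p : List V) (ℓ : ℕ) (f : ℕ → V) :
    Prop where
  head_mem : f 0 ∈ F
  last_mem : f ℓ ∈ E
  adj : ∀ j < ℓ, G.Adj (f j) (f (j + 1))
  notMem_left : ∀ j ≤ ℓ, 0 < j → f j ∉ F
  notMem_right : ∀ j < ℓ, f j ∉ E
  inj : ∀ i ≤ ℓ, ∀ j ≤ ℓ, f i = f j → i = j
  head : p.head? = some (f 0)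
  infix_iff : ∀ u w, [u, w] <:+: p ↔ ∃ j < ℓ, f j = u ∧ f (j + 1) = w
  eq_singleton_iff : ∀ v, p = [v] ↔ ℓ = 0 ∧ f 0 = v

/-- All properties follow from minimality: a repeated node, a later node in `F` or an earlier node
in `E` would give a pair in `F × E` at distance less than `ℓ`. -/
theorem IsRoute.exists_routeData {G : SimpleGraph V} (hG : G.Connected) {F E : Finset V}
    {p : List V} (hp : IsRoute G F E p) : ∃ ℓ f, RouteData G F E p ℓ f := by
  obtain ⟨hch, ⟨u, hu, hhead⟩, ⟨v, hv, hlast⟩, hmin⟩ := hp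
  obtain ⟨ℓ, f, rfl⟩ : ∃ (ℓ : ℕ) (f : ℕ → V), p = (List.range (ℓ + 1)).map f := by
    refine ⟨p.length - 1, fun j => p.getD j u, ?_⟩
    have : 0 < p.length := List.length_pos_iff.2 (by rintro rfl; simp at hhead)
    apply List.ext_getElem
    · simp; omega
    · intro i h1 h2
      simp [List.getElem?_eq_getElem h1]
  have hadj : ∀ j < ℓ, G.Adj (f j) (f (j + 1)) := by
    intro j hj
    have := List.isChain_iff_getElem.1 hch j (by simpa using hj)
    simpa using this
  have hu' : f 0 = u := by simpa [List.range_succ_eq_map] using hhead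
  have hv' : f ℓ = v := by simpa [List.range_succ] using hlast
  subst hu' hv'
  simp only [List.length_map, List.length_range, add_le_add_iff_right] at hmin
  have hdist : ∀ i j, i ≤ j → j ≤ ℓ → G.dist (f i) (f j) ≤ j - i := by
    intro i j hij hj
    have := dist_le_of_adj hG hadj i (j - i) (by omega)
    rwa [Nat.add_sub_cancel' hij] at this
  have hlt : ∀ i j, i < j → j ≤ ℓ → f i ≠ f j := by
    intro i j hij hj h
    have h1 := hdist 0 i (by omega) (by omega)
    have h2 := hdist j ℓ (by omega) le_rfl
    have h3 := hG.dist_triangle (u := f 0) (v := f i) (w := f ℓ)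
    have h4 := hmin _ hu _ hv
    rw [← h] at h2
    omega
  refine ⟨ℓ, f, hu, hv, hadj, ?_, ?_, ?_, ?_, ?_, ?_⟩
  · intro j hj h0 h
    have h1 := hmin _ h _ hv
    have h2 := hdist j ℓ hj le_rfl
    omega
  · intro j hj h
    have h1 := hmin _ hu _ h
    have h2 := hdist 0 j (by omega) hj.le
    omega
  · intro i hi j hj h
    rcases lt_trichotomy i j with h' | h' | h'
    · exact absurd h (hlt i j h' hj)
    · exact h'
    · exact absurd h.symm (hlt j i h' hi)
  · simp [List.range_succ_eq_map]
  · intro a b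
    rw [List.infix_iff_getElem?]
    constructor
    · rintro ⟨k, hk, h⟩
      simp only [List.length_map, List.length_range, List.length_cons, List.length_nil] at hk
      have h0 := h 0 (by simp)
      have h1 := h 1 (by simp)
      rw [List.getElem?_eq_getElem (by simp; omega)] at h0 h1
      simp at h0 h1
      refine ⟨k, by omega, h0, ?_⟩
      rw [← h1, add_comm]
    · rintro ⟨j, hj, rfl, rfl⟩
      refine ⟨j, by simp; omega, fun i hi => ?_⟩
      simp only [List.length_cons, List.length_nil] at hi
      have : i = 0 ∨ i = 1 := by omega
      rcases this with rfl | rfl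
      · rw [List.getElem?_eq_getElem (by simp; omega)]
        simp
      · rw [List.getElem?_eq_getElem (by simp; omega)]
        simp [add_comm]
  · intro w
    constructor
    · intro h
      have hl := congrArg List.length h
      simp at hl
      subst hl
      simpa [List.range_succ] using h
    · rintro ⟨rfl, rfl⟩
      simp [List.range_succ]

theorem exists_routeData {G : SimpleGraph V} (hG : G.Connected) {F R : Finset V} {N : ℕ}
    {h : V → Finset (Fin N)} (hF : F.Nonempty) (hE : (eligible R h).Nonempty) :
    ∃ ℓ f, RouteData G F (eligible R h) (route F R h G) ℓ f :=
  IsRoute.exists_routeData hG (Classical.epsilon_spec (exists_isRoute hG hF hE))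

end Routes

/-! ### Load balancing -/

section Balance

variable {V : Type}

/-- What is known about the placement `h` when the items of ranks below `i` have been brought in. -/
structure Balanced (R : Finset V) {N : ℕ} (i : ℕ) (h : V → Finset (Fin N)) : Prop where
  disj : ∀ v v' x, x ∈ h v → x ∈ h v' → v = v'
  lt : ∀ v, ∀ x ∈ h v, x.val < i
  ex : ∀ x : Fin N, x.val < i → ∃ v, x ∈ h v
  out : ∀ v ∉ R, h v = ∅
  level : (∀ v ∈ R, (h v).card ≤ N / R.card) ∨ ∀ v ∈ R, N / R.card ≤ (h v).card

variable {R F : Finset V} {N i : ℕ} {h : V → Finset (Fin N)} {G : SimpleGraph V}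

theorem balanced_zero (R : Finset V) (N : ℕ) :
    Balanced R 0 (fun _ => ∅ : V → Finset (Fin N)) :=
  ⟨by simp, by simp, by simp, by simp, Or.inl (by simp)⟩

theorem Balanced.sum_card (hb : Balanced R i h) (hi : i ≤ N) : ∑ v ∈ R, (h v).card = i := by
  classical
  rw [← Finset.card_biUnion]
  · have : R.biUnion h = (Finset.range i).attachFin (fun x hx => by simp at hx; omega) := by
      ext x
      simp only [Finset.mem_biUnion, Finset.mem_attachFin, Finset.mem_range]
      constructor
      · rintro ⟨v, -, hx⟩
        exact hb.lt v x hx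
      · intro hx
        obtain ⟨v, hv⟩ := hb.ex x hx
        refine ⟨v, ?_, hv⟩
        by_contra hvR
        simp [hb.out v hvR] at hv
    rw [this, Finset.card_attachFin, Finset.card_range]
  · intro v _ v' _ hvv
    rw [Function.onFun, Finset.disjoint_left]
    exact fun x hx hx' => hvv (hb.disj v v' x hx hx')

/-- If all loads were at most the floor and one was below it, their sum would be less than `|R| ⌊N /
|R|⌋ ≤ N`. -/
theorem Balanced.le_card (hb : Balanced R N h) {v : V} (hv : v ∈ R) :
    N / R.card ≤ (h v).card := by
  rcases hb.level with hl | hl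
  · by_contra hlt
    push Not at hlt
    have h1 := Finset.sum_lt_sum hl ⟨v, hv, hlt⟩
    rw [hb.sum_card le_rfl, Finset.sum_const, smul_eq_mul] at h1
    have := Nat.mul_div_le N R.card
    omega
  · exact hl v hv

theorem Balanced.eligible_nonempty (hb : Balanced R i h) (hR : R.Nonempty) (hi : i < N) :
    (eligible R h).Nonempty := by
  classical
  unfold eligible
  split_ifs with hlt
  · obtain ⟨v, hv, hlt⟩ := hlt
    exact ⟨v, Finset.mem_filter.2 ⟨hv, hlt⟩⟩
  · by_contra hne
    rw [Finset.not_nonempty_iff_eq_empty, Finset.filter_eq_empty_iff] at hne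
    have h1 : ∑ _v ∈ R, N ⌈/⌉ R.card ≤ ∑ v ∈ R, (h v).card :=
      Finset.sum_le_sum fun v hv => not_lt.1 (hne hv)
    rw [hb.sum_card hi.le, Finset.sum_const] at h1
    have := le_smul_ceilDiv (a := R.card) (b := N) hR.card_pos
    omega

theorem eligible_subset : eligible R h ⊆ R := by
  unfold eligible
  split_ifs <;> exact Finset.filter_subset _ _

/-- Since `|R| ≤ N`, both thresholds are positive. This is why every inner node of a route, being in
`R` and not eligible, has an item to send on. -/
theorem nonempty_of_notMem_eligible (hR : R.Nonempty) (hRN : R.card ≤ N) {v : V} (hv : v ∈ R)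
    (hE : v ∉ eligible R h) : (h v).Nonempty := by
  have hfl : 0 < N / R.card := Nat.div_pos hRN hR.card_pos
  have hce : 0 < N ⌈/⌉ R.card := by
    by_contra h0
    have := le_smul_ceilDiv (a := R.card) (b := N) hR.card_pos
    have h0 : N ⌈/⌉ R.card = 0 := by omega
    rw [h0, smul_zero] at this
    have := hR.card_pos
    omega
  rw [← Finset.card_pos]
  unfold eligible at hE
  split_ifs at hE <;> rw [Finset.mem_filter] at hE <;> push Not at hE <;> have := hE hv <;> omega

/-- The items sent along the route. -/
theorem exists_sentItems (hG : G.Connected) (hF : F.Nonempty) (hR : R.Nonempty)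
    (hFR : ∀ v ∉ F, v ∈ R) (hRN : R.card ≤ N) (hb : Balanced R i h) (hi : i < N) :
    ∃ (ℓ : ℕ) (f : ℕ → V) (y : ℕ → Fin N),
      RouteData G F (eligible R h) (route F R h G) ℓ f ∧ y 0 = ⟨i, hi⟩ ∧
      (∀ j, 0 < j → j < ℓ → y j ∈ h (f j)) ∧
      ∀ u w x, balanceSend F R ⟨i, hi⟩ h G u w = some x ↔
        ∃ j < ℓ, f j = u ∧ f (j + 1) = w ∧ y j = x := by
  classical
  obtain ⟨ℓ, f, hr⟩ := exists_routeData hG hF (hb.eligible_nonempty hR hi)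
  have hne : ∀ j, 0 < j → j < ℓ → ∃ y, (h (f j)).toList.head? = some y := by
    intro j hj hjl
    have h1 := nonempty_of_notMem_eligible hR hRN (hFR _ (hr.notMem_left j hjl.le hj))
      (hr.notMem_right j hjl)
    have h2 : (h (f j)).toList ≠ [] := by simpa [Finset.nonempty_iff_ne_empty] using h1
    exact ⟨_, List.head?_eq_some_head h2⟩
  have : ∀ j, ∃ y : Fin N, j < ℓ → (if j = 0 then y = ⟨i, hi⟩ else
      (h (f j)).toList.head? = some y) := by
    intro j
    by_cases hj : j = 0
    · exact ⟨⟨i, hi⟩, by simp [hj]⟩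
    · by_cases hjl : j < ℓ
      · obtain ⟨y, hy⟩ := hne j (by omega) hjl
        exact ⟨y, by simp [hj, hy]⟩
      · exact ⟨⟨i, hi⟩, fun h => absurd h hjl⟩
  choose y hy using this
  refine ⟨ℓ, f, fun j => if j = 0 then ⟨i, hi⟩ else y j, hr, by simp, ?_, ?_⟩
  · intro j hj hjl
    have := hy j hjl
    have hj0 : j ≠ 0 := by omega
    simp only [hj0, if_false] at this ⊢
    rw [← Finset.mem_toList]
    exact List.mem_of_mem_head? this
  · intro u w x
    have key : ∀ j < ℓ, ((if (route F R h G).head? = some (f j) then some (⟨i, hi⟩ : Fin N)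
        else (h (f j)).toList.head?) = some x ↔ (if j = 0 then ⟨i, hi⟩ else y j) = x) := by
      intro j hjl
      rw [hr.head]
      by_cases hj : j = 0
      · simp [hj]
      · have h1 : f 0 ≠ f j := fun e => hj (hr.inj _ (by omega) _ (by omega) e).symm
        have := hy j hjl
        simp only [hj, if_false] at this
        simp [hj, h1, this]
    unfold balanceSend
    split_ifs with hinf hhead
    · obtain ⟨j, hjl, rfl, rfl⟩ := (hr.infix_iff _ _).1 hinf
      have := key j hjl
      rw [if_pos hhead] at this
      rw [this]
      constructor
      · exact fun h => ⟨j, hjl, rfl, rfl, h⟩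
      · rintro ⟨j', hj', h1, -, h2⟩
        rwa [hr.inj j' hj'.le j hjl.le h1] at h2
    · obtain ⟨j, hjl, rfl, rfl⟩ := (hr.infix_iff _ _).1 hinf
      have := key j hjl
      rw [if_neg hhead] at this
      rw [this]
      constructor
      · exact fun h => ⟨j, hjl, rfl, rfl, h⟩
      · rintro ⟨j', hj', h1, -, h2⟩
        rwa [hr.inj j' hj'.le j hjl.le h1] at h2
    · simp only [false_iff]
      rintro ⟨j, hjl, h1, h2, -⟩
      exact hinf ((hr.infix_iff _ _).2 ⟨j, hjl, h1, h2⟩)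

/-- An inner node of the route passes on one item and gets one, and the first node sends the new
item, so only the load at the far end grows. That end is eligible: it is below the floor as long as
any node is, which preserves `level`. -/
theorem Balanced.step (hG : G.Connected) (hF : F.Nonempty) (hR : R.Nonempty)
    (hFR : ∀ v ∉ F, v ∈ R) (hRN : R.card ≤ N) (hb : Balanced R i h) (hi : i < N) :
    Balanced R (i + 1) (balanceUpdate F R ⟨i, hi⟩ h G) := by
  classical
  obtain ⟨ℓ, f, y, hr, hy0, hy, hs⟩ := exists_sentItems hG hF hR hFR hRN hb hi
  have hmem : ∀ v x, x ∈ balanceUpdate F R ⟨i, hi⟩ h G v ↔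
      (x ∈ h v ∧ ¬ ∃ j < ℓ, f j = v ∧ y j = x) ∨ (∃ j < ℓ, f (j + 1) = v ∧ y j = x) ∨
        (ℓ = 0 ∧ f 0 = v ∧ x = ⟨i, hi⟩) := by
    intro v x
    simp only [balanceUpdate, Finset.mem_filter, Finset.mem_univ, true_and, hs,
      hr.eq_singleton_iff, and_assoc]
    have h1 : (∃ w, ∃ j < ℓ, f j = v ∧ f (j + 1) = w ∧ y j = x) ↔
        ∃ j < ℓ, f j = v ∧ y j = x :=
      ⟨fun ⟨w, j, a, b, c, d⟩ => ⟨j, a, b, d⟩, fun ⟨j, a, b, d⟩ => ⟨_, j, a, b, rfl, d⟩⟩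
    have h2 : (∃ u, ∃ j < ℓ, f j = u ∧ f (j + 1) = v ∧ y j = x) ↔
        ∃ j < ℓ, f (j + 1) = v ∧ y j = x :=
      ⟨fun ⟨w, j, a, b, c, d⟩ => ⟨j, a, c, d⟩, fun ⟨j, a, b, d⟩ => ⟨_, j, a, rfl, b, d⟩⟩
    rw [h1, h2]
  -- Earlier items have rank below `i` and sit at a unique node, so the items travelling along the
  -- route are pairwise distinct and new to their receivers.
  have hyi : ∀ j < ℓ, y j = ⟨i, hi⟩ ↔ j = 0 := by
    intro j hj
    constructor
    · intro h0
      by_contra hj0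
      have := hb.lt _ _ (hy j (by omega) hj)
      simp [h0] at this
    · rintro rfl; exact hy0
  have hyinj : ∀ j < ℓ, ∀ j' < ℓ, y j = y j' → j = j' := by
    intro j hj j' hj' h0
    rcases Nat.eq_zero_or_pos j with rfl | hp
    · exact ((hyi j' hj').1 (by rw [← h0, hy0])).symm
    rcases Nat.eq_zero_or_pos j' with rfl | hp'
    · exact (hyi j hj).1 (by rw [h0, hy0])
    have h1 := hy j hp hj
    rw [h0] at h1
    exact hr.inj _ hj.le _ hj'.le (hb.disj _ _ _ h1 (hy j' hp' hj'))
  have hnot : ∀ v, (⟨i, hi⟩ : Fin N) ∉ h v := fun v hv => absurd (hb.lt v _ hv) (by simp)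
  have hynext : ∀ j < ℓ, y j ∉ h (f (j + 1)) := by
    intro j hj hmem
    rcases Nat.eq_zero_or_pos j with rfl | hp
    · rw [hy0] at hmem
      exact hnot _ hmem
    · have := hr.inj _ hj.le _ (by omega) (hb.disj _ _ _ (hy j hp hj) hmem)
      omega
  have hcard : ∀ v, (balanceUpdate F R ⟨i, hi⟩ h G v).card =
      (h v).card + if v = f ℓ then 1 else 0 := by
    intro v
    by_cases hv : ∃ j ≤ ℓ, f j = v
    · obtain ⟨j, hj, rfl⟩ := hv
      have hjeq : ∀ j' < ℓ, f j' = f j ↔ j' = j :=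
        fun j' hj' => ⟨hr.inj _ hj'.le _ hj, fun h => by rw [h]⟩
      have hjeq' : ∀ j' < ℓ, f (j' + 1) = f j ↔ j' + 1 = j :=
        fun j' hj' => ⟨hr.inj _ hj' _ hj, fun h => by rw [h]⟩
      by_cases hjl : j = ℓ
      · subst hjl
        simp only [if_true]
        rcases Nat.eq_zero_or_pos j with h0 | hp
        · rw [← Finset.card_insert_of_notMem (hnot (f j))]
          congr 1
          ext x
          rw [hmem, Finset.mem_insert]
          subst h0
          simp
          tauto
        · obtain ⟨k, rfl⟩ : ∃ k, j = k + 1 := ⟨j - 1, by omega⟩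
          rw [← Finset.card_insert_of_notMem (hynext k (by omega))]
          congr 1
          ext x
          rw [hmem, Finset.mem_insert]
          constructor
          · rintro (h1 | ⟨k', hk', h1, h2⟩ | h1)
            · exact Or.inr h1.1
            · have := (hjeq' k' hk').1 h1
              obtain rfl : k' = k := by omega
              exact Or.inl h2.symm
            · omega
          · rintro (rfl | h1)
            · exact Or.inr (Or.inl ⟨k, by omega, rfl, rfl⟩)
            · refine Or.inl ⟨h1, ?_⟩
              rintro ⟨j', hj', h2, -⟩
              have := (hjeq j' hj').1 h2
              omega
      · have hjl' : j < ℓ := by omega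
        have hne : f j ≠ f ℓ := fun e => hjl (hr.inj _ hj _ le_rfl e)
        simp only [hne, if_false, add_zero]
        rcases Nat.eq_zero_or_pos j with rfl | hp
        · congr 1
          ext x
          rw [hmem]
          constructor
          · rintro (h1 | ⟨k', hk', h1, h2⟩ | h1)
            · exact h1.1
            · have := (hjeq' k' hk').1 h1
              omega
            · omega
          · intro hx
            refine Or.inl ⟨hx, ?_⟩
            rintro ⟨j', hj', h2, rfl⟩
            obtain rfl := (hjeq j' hj').1 h2
            rw [hy0] at hx
            exact hnot _ hx
        · obtain ⟨k, rfl⟩ : ∃ k, j = k + 1 := ⟨j - 1, by omega⟩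
          have h1 := hynext k (by omega)
          have h2 := hy (k + 1) hp hjl'
          have : balanceUpdate F R ⟨i, hi⟩ h G (f (k + 1)) =
              insert (y k) ((h (f (k + 1))).erase (y (k + 1))) := by
            ext x
            rw [hmem, Finset.mem_insert, Finset.mem_erase]
            constructor
            · rintro (⟨h3, h4⟩ | ⟨k', hk', h3, h4⟩ | h3)
              · exact Or.inr ⟨fun e => h4 ⟨k + 1, hjl', rfl, e.symm⟩, h3⟩
              · have := (hjeq' k' hk').1 h3
                obtain rfl : k' = k := by omega
                exact Or.inl h4.symm
              · omega
            · rintro (rfl | ⟨h3, h4⟩)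
              · exact Or.inr (Or.inl ⟨k, by omega, rfl, rfl⟩)
              · refine Or.inl ⟨h4, ?_⟩
                rintro ⟨j', hj', h5, h6⟩
                obtain rfl := (hjeq j' hj').1 h5
                exact h3 h6.symm
          rw [this, Finset.card_insert_of_notMem (fun e => h1 (Finset.mem_of_mem_erase e)),
            Finset.card_erase_of_mem h2]
          have := Finset.card_pos.2 ⟨_, h2⟩
          omega
    · push Not at hv
      rw [if_neg (fun e => hv ℓ le_rfl e.symm), add_zero]
      congr 1
      ext x
      rw [hmem]
      constructor
      · rintro (h1 | ⟨k', hk', h1, h2⟩ | h1)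
        · exact h1.1
        · exact absurd h1 (hv _ hk')
        · exact absurd h1.2.1 (hv _ (by omega))
      · exact fun hx => Or.inl ⟨hx, fun ⟨j, hj, h1, _⟩ => hv j hj.le h1⟩
  refine ⟨?_, ?_, ?_, ?_, ?_⟩
  · intro v v' x hx hx'
    rw [hmem] at hx hx'
    have hmix : ∀ v v', x ∈ h v → (¬ ∃ j < ℓ, f j = v ∧ y j = x) →
        (∃ j < ℓ, f (j + 1) = v' ∧ y j = x) → False := by
      rintro v v' h1 h2 ⟨j, hj, -, rfl⟩
      rcases Nat.eq_zero_or_pos j with rfl | hp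
      · rw [hy0] at h1
        exact hnot _ h1
      · exact h2 ⟨j, hj, hb.disj _ _ _ (hy j hp hj) h1, rfl⟩
    rcases hx with ⟨h1, h2⟩ | h1 | ⟨h1, h2, rfl⟩ <;>
      rcases hx' with ⟨h1', h2'⟩ | h1' | ⟨h1', h2', h3'⟩
    · exact hb.disj _ _ _ h1 h1'
    · exact (hmix v v' h1 h2 h1').elim
    · subst h3'; exact absurd h1 (hnot _)
    · exact (hmix v' v h1' h2' h1).elim
    · obtain ⟨j, hj, rfl, rfl⟩ := h1
      obtain ⟨j', hj', rfl, h5⟩ := h1'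
      rw [hyinj _ hj _ hj' h5.symm]
    · obtain ⟨j, hj, -⟩ := h1; omega
    · exact absurd h1' (hnot _)
    · obtain ⟨j, hj, -⟩ := h1'; omega
    · exact h2.symm.trans h2'
  · intro v x hx
    rw [hmem] at hx
    rcases hx with ⟨h1, -⟩ | ⟨j, hj, -, rfl⟩ | ⟨-, -, rfl⟩
    · exact (hb.lt v x h1).trans (Nat.lt_succ_self i)
    · rcases Nat.eq_zero_or_pos j with rfl | hp
      · simp [hy0]
      · exact (hb.lt _ _ (hy j hp hj)).trans (Nat.lt_succ_self i)
    · simp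
  · intro x hx
    by_cases hsent : ∃ j < ℓ, y j = x
    · obtain ⟨j, hj, hjx⟩ := hsent
      exact ⟨f (j + 1), (hmem _ _).2 (Or.inr (Or.inl ⟨j, hj, rfl, hjx⟩))⟩
    · by_cases hxi : x.val = i
      · have hl : ℓ = 0 := by
          by_contra hl
          exact hsent ⟨0, by omega, by rw [hy0]; exact Fin.ext hxi.symm⟩
        exact ⟨f 0, (hmem _ _).2 (Or.inr (Or.inr ⟨hl, rfl, Fin.ext hxi⟩))⟩
      · obtain ⟨v, hv⟩ := hb.ex x (by omega)
        exact ⟨v, (hmem _ _).2 (Or.inl ⟨hv, fun ⟨j, hj, _, h⟩ => hsent ⟨j, hj, h⟩⟩)⟩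
  · intro v hv
    have hne : v ≠ f ℓ := fun e => hv (e ▸ eligible_subset hr.last_mem)
    have := hcard v
    rw [if_neg hne, hb.out v hv] at this
    simpa using this
  · have hlast := hr.last_mem
    by_cases hlt : ∃ v ∈ R, (h v).card < N / R.card
    -- Some node is below the floor, which rules out the second alternative of `level`; the end of
    -- the route is itself below the floor and reaches it at most.
    · left
      have hle : ∀ v ∈ R, (h v).card ≤ N / R.card := by
        rcases hb.level with hl | hl
        · exact hl
        · obtain ⟨v, hv, h1⟩ := hlt
          exact absurd (hl v hv) (by omega)
      rw [eligible, if_pos hlt, Finset.mem_filter] at hlast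
      intro v hv
      rw [hcard]
      have := hle v hv
      split_ifs with hvf
      · subst hvf
        omega
      · omega
    · right
      push Not at hlt
      intro v hv
      rw [hcard]
      exact (hlt v hv).trans (Nat.le_add_right _ _)

end Balance

/-! ### Placement of ranks and the law of the items placed -/

section LoadBalance

variable {V K : Type} [Fintype K] {G : ℕ → SimpleGraph V}

/-- Every node of which `S` says that it has the item `x` holds the token `label x`. -/
def Labelled {ι : Type} (label : ι → Option K) (S : V → Finset ι) (H : Holdings V K) : Prop :=
  ∀ v x τ, x ∈ S v → label x = some τ → τ ∈ H v

/-- The placement of the ranks after `i` rounds of load balancing that starts at time `t`. -/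
noncomputable def placement (G : ℕ → SimpleGraph V) (F R : Finset V) (N t : ℕ) :
    ℕ → V → Finset (Fin N)
  | 0 => fun _ => ∅
  | i + 1 => if hi : i < N then balanceUpdate F R ⟨i, hi⟩ (placement G F R N t i) (G (t + i))
      else placement G F R N t i

variable {F R : Finset V} {N t : ℕ} {H : Holdings V K}

theorem balanced_placement (hG : ∀ t, (G t).Connected) (hF : F.Nonempty) (hR : R.Nonempty)
    (hFR : ∀ v ∉ F, v ∈ R) (hRN : R.card ≤ N) (i : ℕ) (hi : i ≤ N) :
    Balanced R i (placement G F R N t i) := by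
  induction i with
  | zero => exact balanced_zero R N
  | succ i ih =>
    rw [placement, dif_pos (by omega)]
    exact (ih (by omega)).step (hG _) hF hR hFR hRN (by omega)

/-- The bookkeeping moves items while `deliver` copies tokens, so the recorded items are always
truly held, and every planned transmission is legal. -/
theorem Labelled.balance {G : SimpleGraph V} {i : ℕ} {h : V → Finset (Fin N)}
    {label : Fin N → Option K} (hG : G.Connected) (hF : F.Nonempty)
    (hR : R.Nonempty) (hFR : ∀ v ∉ F, v ∈ R) (hRN : R.card ≤ N) (hb : Balanced R i h) (hi : i < N)
    (hh : Labelled label h H) (hl : ∀ u ∈ F, ∀ x τ, label x = some τ → τ ∈ H u) :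
    Labelled label (balanceUpdate F R ⟨i, hi⟩ h G)
      (deliver G (fun u v => (balanceSend F R ⟨i, hi⟩ h G u v).bind label) H) := by
  classical
  obtain ⟨ℓ, f, y, hr, hy0, hy, hs⟩ := exists_sentItems hG hF hR hFR hRN hb hi
  intro v x τ hx hτ
  simp only [balanceUpdate, Finset.mem_filter, Finset.mem_univ, true_and] at hx
  rcases hx with ⟨hx, -⟩ | ⟨u, hu⟩ | ⟨h1, rfl⟩
  · exact subset_deliver _ _ _ v (hh v x τ hx hτ)
  · obtain ⟨j, hj, rfl, rfl, rfl⟩ := (hs _ _ _).1 hu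
    simp only [deliver, Finset.mem_filter, Finset.mem_univ, true_and]
    refine Or.inr ⟨f j, hr.adj j hj, ?_, by rw [hu]; exact hτ⟩
    rcases Nat.eq_zero_or_pos j with rfl | hp
    · exact hl _ hr.head_mem _ _ hτ
    · exact hh _ _ _ (hy j hp hj) hτ
  · obtain ⟨-, rfl⟩ := (hr.eq_singleton_iff v).1 h1
    exact subset_deliver _ _ _ _ (hl _ hr.head_mem _ _ hτ)

theorem always_balance_rounds (hG : ∀ t, (G t).Connected) (hF : F.Nonempty) (hR : R.Nonempty)
    (hFR : ∀ v ∉ F, v ∈ R) (hRN : R.card ≤ N) {label : Fin N → Option K}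
    (hl : ∀ u ∈ F, ∀ x τ, label x = some τ → τ ∈ H u) (k i : ℕ) (hk : k + i = N)
    (hh : Labelled label (placement G F R N t i) H) :
    (((List.finRange N).drop i).foldlM
      (fun h i => itemRound label (balanceSend F R i h) (balanceUpdate F R i h))
      (placement G F R N t i)).Always G (t + i) H (fun h t' H' => h = placement G F R N t N ∧
        t' = t + N ∧ Labelled label h H' ∧ H ≤ H') := by
  induction k generalizing i H with
  | zero =>
    obtain rfl : i = N := by omega
    rw [List.drop_eq_nil_of_le (by simp)]
    exact ⟨rfl, rfl, hh, le_rfl⟩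
  | succ k ih =>
    have hi : i < N := by omega
    rw [List.drop_eq_getElem_cons (by simpa using hi), List.foldlM_cons]
    rw [Protocol.always_bind]
    have h1 := Labelled.balance (hG (t + i)) hF hR hFR hRN
      (balanced_placement hG hF hR hFR hRN i hi.le) hi hh hl
    have h2 := ih (H := deliver (G (t + i)) (fun u v => (balanceSend F R ⟨i, hi⟩
      (placement G F R N t i) (G (t + i)) u v).bind label) H)
      (fun u hu x τ hx => subset_deliver _ _ _ u (hl u hu x τ hx)) (i + 1) (by omega)
      (by rw [placement, dif_pos hi]; exact h1)
    rw [placement, dif_pos hi] at h2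
    simp only [List.getElem_finRange]
    exact h2.mono fun h t' H' h => ⟨h.1, h.2.1, h.2.2.1, (subset_deliver _ _ _).trans h.2.2.2⟩

theorem loadBalance_eq (F : Finset V) (T : List (Option K)) (R : Finset V) :
    loadBalance F T R = .toss (PMF.uniformOfFintype (Equiv.Perm (Fin T.length))) fun π =>
      ((List.finRange T.length).foldlM
        (fun h i => itemRound (fun x => T.get (π x)) (balanceSend F R i h)
          (balanceUpdate F R i h)) (fun _ => ∅)) >>= fun h =>
        .halt (fun x => T.get (π x), h) := rfl

variable {T : List (Option K)}

theorem always_loadBalance_aux (hG : ∀ t, (G t).Connected) (hF : F.Nonempty) (hR : R.Nonempty)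
    (hFR : ∀ v ∉ F, v ∈ R) (hRN : R.card ≤ T.length)
    (hl : ∀ u ∈ F, ∀ τ, some τ ∈ T → τ ∈ H u) (π : Equiv.Perm (Fin T.length)) :
    (((List.finRange T.length).foldlM
        (fun h i => itemRound (fun x => T.get (π x)) (balanceSend F R i h)
          (balanceUpdate F R i h)) (fun _ => ∅)) >>= fun h =>
        (.halt (fun x => T.get (π x), h) : Protocol V K _)).Always G t H
      (fun out t' H' => out = (fun x => T.get (π x), placement G F R T.length t T.length) ∧
        t' = t + T.length ∧ Labelled out.1 out.2 H' ∧ H ≤ H') := by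
  have := always_balance_rounds (t := t) (H := H) hG hF hR hFR hRN
    (label := fun x => T.get (π x)) (fun u hu x τ hx => hl u hu τ (hx ▸ List.get_mem _ _))
    T.length 0 rfl (by intro v x τ hx; simp [placement] at hx)
  refine Protocol.Always.bind this fun h t' H' h' => ?_
  obtain ⟨rfl, h2, h3, h4⟩ := h'
  exact ⟨rfl, h2, h3, h4⟩

theorem always_loadBalance (hG : ∀ t, (G t).Connected) (hF : F.Nonempty) (hR : R.Nonempty)
    (hFR : ∀ v ∉ F, v ∈ R) (hRN : R.card ≤ T.length)
    (hl : ∀ u ∈ F, ∀ τ, some τ ∈ T → τ ∈ H u) :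
    (loadBalance F T R).Always G t H (fun out t' H' =>
      out.2 = placement G F R T.length t T.length ∧ t' = t + T.length ∧
        Labelled out.1 out.2 H' ∧ H ≤ H' ∧ ∀ x, out.1 x ∈ T) := by
  rw [loadBalance_eq]
  intro π
  refine (always_loadBalance_aux hG hF hR hFR hRN hl π).mono fun out t' H' h => ?_
  obtain ⟨rfl, h1, h2, h3⟩ := h
  exact ⟨rfl, h1, h2, h3, fun x => List.get_mem _ _⟩

/-- The form in which load balancing is used: `placement` depends on the networks only, so ranks `D`
can be chosen before the permutation is drawn. If one of them receiving an item of `P` excludes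
`bad`, then `bad` requires a random permutation to keep `D` away from `P`. -/
theorem prob_loadBalance_bind_le {β : Type} (hG : ∀ t, (G t).Connected) (hF : F.Nonempty)
    (hR : R.Nonempty) (hFR : ∀ v ∉ F, v ∈ R) (hRN : R.card ≤ T.length)
    (hl : ∀ u ∈ F, ∀ τ, some τ ∈ T → τ ∈ H u)
    {B : (Fin T.length → Option K) × (V → Finset (Fin T.length)) → Protocol V K β}
    {bad : β → ℕ → Holdings V K → Prop} (D P : Finset (Fin T.length))
    (hB : ∀ (label : Fin T.length → Option K) H',
      Labelled label (placement G F R T.length t T.length) H' → H ≤ H' →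
      (∀ x, label x ∈ T) → (∃ x ∈ D, ∃ y ∈ P, label x = T.get y) →
      (B (label, placement G F R T.length t T.length)).Always G (t + T.length) H'
        (fun b t' H' => ¬ bad b t' H')) :
    (loadBalance F T R >>= B).prob G t H bad ≤
      ENNReal.ofReal (Real.exp (-((D.card : ℝ) * P.card / T.length))) := by
  classical
  have hpos : 0 < T.length := hR.card_pos.trans_le hRN
  have : Nonempty (Fin T.length) := ⟨⟨0, hpos⟩⟩
  have key : ∀ π : Equiv.Perm (Fin T.length), (((List.finRange T.length).foldlM
        (fun h i => itemRound (fun x => T.get (π x)) (balanceSend F R i h)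
          (balanceUpdate F R i h)) (fun _ => ∅)) >>= fun h =>
        (.halt (fun x => T.get (π x), h) : Protocol V K _)).ew G t H
        (fun a t' H' => (B a).prob G t' H' bad) ≤ if ∀ x ∈ D, π x ∉ P then 1 else 0 := by
    intro π
    split_ifs with hπ
    · exact Protocol.Always.ew_le (Protocol.always_of_forall fun _ _ _ => Protocol.prob_le_one)
    · refine Protocol.Always.ew_le ?_
      refine (always_loadBalance_aux hG hF hR hFR hRN hl π).mono fun out t' H' h => ?_
      obtain ⟨rfl, rfl, h3, h4⟩ := h
      push Not at hπ
      obtain ⟨x, hx, hxP⟩ := hπ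
      exact (hB _ _ h3 h4 (fun x => List.get_mem _ _) ⟨x, hx, π x, hxP, rfl⟩).prob_eq_zero.le
  unfold Protocol.prob at *
  rw [Protocol.ew_bind, loadBalance_eq, Protocol.ew]
  refine (ENNReal.tsum_le_tsum fun π => mul_le_mul_right (key π) _).trans ?_
  rw [tsum_fintype]
  simp only [PMF.uniformOfFintype_apply]
  rw [← Finset.mul_sum, Finset.sum_boole]
  refine le_trans (le_of_eq ?_) (ENNReal.ofReal_le_ofReal
    (by simpa using card_perm_avoid_div_le D P))
  rw [ENNReal.ofReal_div_of_pos (by exact_mod_cast Fintype.card_pos), ENNReal.ofReal_natCast,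
    ENNReal.ofReal_natCast, ENNReal.div_eq_inv_mul]
  congr!

end LoadBalance

/-! ### Several rounds of greedy exchange -/

section GreedyRun

variable {V ι : Type} [Fintype V] [Fintype ι]

/-- The item sets after `m` rounds of greedy exchange from the time `t` on. -/
noncomputable def greedyRun (G : ℕ → SimpleGraph V) (S : V → Finset ι) (t : ℕ) :
    ℕ → V → Finset ι
  | 0 => S
  | m + 1 => greedyRun G (greedyUpdate S (G t)) (t + 1) m

theorem le_greedyRun (G : ℕ → SimpleGraph V) (S : V → Finset ι) (t m : ℕ) :
    S ≤ greedyRun G S t m := by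
  induction m generalizing S t with
  | zero => exact le_rfl
  | succ m ih => exact le_trans (fun v => subset_greedyUpdate (G t) S v) (ih _ _)

theorem Labelled.greedy {K : Type} [Fintype K] {G : SimpleGraph V} {label : ι → Option K}
    {S : V → Finset ι} {H : Holdings V K} (h : Labelled label S H) :
    Labelled label (greedyUpdate S G)
      (deliver G (fun u v => (greedySend S G u v).bind label) H) := by
  intro v x τ hx hτ
  simp only [greedyUpdate, Finset.mem_filter, Finset.mem_univ, true_and] at hx
  rcases hx with hx | ⟨u, hu⟩
  · exact subset_deliver _ _ _ v (h v x τ hx hτ)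
  · obtain ⟨hadj, hS, -⟩ := (isMaximumMatchingAt_greedySend G S v).1.1 u x hu
    simp only [deliver, Finset.mem_filter, Finset.mem_univ, true_and]
    exact Or.inr ⟨u, hadj, h u x τ hS hτ, by rw [hu]; exact hτ⟩

theorem always_greedy_rounds {K β : Type} [Fintype K] {G : ℕ → SimpleGraph V}
    {label : ι → Option K} (l : List β) {S : V → Finset ι} {t : ℕ} {H : Holdings V K}
    (h : Labelled label S H) :
    (l.foldlM (fun S _ => greedyExchange label S) S).Always G t H (fun _ t' H' =>
      t' = t + l.length ∧ Labelled label (greedyRun G S t l.length) H') := by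
  induction l generalizing S t H with
  | nil => exact ⟨rfl, h⟩
  | cons b l ih =>
    rw [List.foldlM_cons, Protocol.always_bind]
    refine (ih (S := greedyUpdate S (G t)) (t := t + 1) h.greedy).mono fun _ t' H' h' => ?_
    refine ⟨?_, h'.2⟩
    rw [h'.1, List.length_cons]
    omega

variable {G : SimpleGraph V} {S : V → Finset ι} {F R : Finset V} {q : ℕ}

/-- The nodes of `R` with fewer than `q` items. -/
def poor (R : Finset V) (q : ℕ) (S : V → Finset ι) : Finset V := R.filter fun v => (S v).card < q

/-- The number of items in `R`, counting at most `8 q` at each node. -/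
def potential (R : Finset V) (q : ℕ) (S : V → Finset ι) : ℕ := ∑ v ∈ R, min (S v).card (8 * q)

/-- Let `P ≤ 3 q` be the total gain of the nodes with fewer than `4 q` items. In a component with a
poor node `v`, all items lie in `S v ∪ X`, which has fewer than `4 q` elements. The private items `y
u` therefore bound the poor nodes of this component by `4 q`. The node `f` is too rich to lie in it,
so at most `P` of the `P + 1` components contain poor nodes. -/
theorem card_poor_le (hG : G.Connected) (hF : ∃ f, 4 * q ≤ (S f).card) {y : V → ι}
    (hy : Set.InjOn y R) (hyS : ∀ v ∈ R, y v ∈ S v)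
    (hP : ∑ v with (S v).card < 4 * q, gain G S v ≤ 3 * q) :
    (poor R q S).card ≤ 4 * q * ∑ v with (S v).card < 4 * q, gain G S v := by
  classical
  obtain ⟨H, X, hX, hcomp, hH⟩ := exists_components hG S (4 * q)
  obtain ⟨f, hf⟩ := hF
  set P := ∑ v with (S v).card < 4 * q, gain G S v
  have hsmall : ∀ v ∈ poor R q S, v ∈ R ∧ (S v).card < q := fun v hv => Finset.mem_filter.1 hv
  have hsub : ∀ v ∈ poor R q S, ∀ u, H.Reachable v u → S u ⊆ S v ∪ X := by
    intro v hv u hu x hx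
    have := (hsmall v hv).2
    exact Finset.mem_union.2 (hH v u (by omega) hu x hx)
  have hcardle : ∀ v ∈ poor R q S, (S v ∪ X).card < 4 * q := by
    intro v hv
    have := (hsmall v hv).2
    have := Finset.card_union_le (S v) X
    omega
  refine (Finset.card_le_mul_card_image (f := H.connectedComponentMk) _ (4 * q) ?_).trans ?_
  · intro c hc
    obtain ⟨v, hv, rfl⟩ := Finset.mem_image.1 hc
    refine le_trans ?_ (hcardle v hv).le
    refine Finset.card_le_card_of_injOn y ?_ ?_
    · intro u hu
      obtain ⟨hu, huv⟩ := Finset.mem_filter.1 hu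
      exact hsub v hv u (SimpleGraph.ConnectedComponent.eq.1 huv).symm (hyS u (hsmall u hu).1)
    · intro u hu u' hu' h
      exact hy (hsmall u (Finset.mem_filter.1 hu).1).1 (hsmall u' (Finset.mem_filter.1 hu').1).1 h
  · refine Nat.mul_le_mul_left _ ?_
    have h1 : (poor R q S).image H.connectedComponentMk ⊆
        Finset.univ.erase (H.connectedComponentMk f) := by
      intro c hc
      obtain ⟨v, hv, rfl⟩ := Finset.mem_image.1 hc
      refine Finset.mem_erase.2 ⟨fun h => ?_, Finset.mem_univ _⟩
      have h2 := Finset.card_le_card (hsub v hv f (SimpleGraph.ConnectedComponent.eq.1 h))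
      have h3 := hcardle v hv
      omega
    have h2 := Finset.card_le_card h1
    rw [Finset.card_erase_of_mem (Finset.mem_univ _), Finset.card_univ,
      ← Nat.card_eq_fintype_card] at h2
    omega

theorem min_sum_le {κ : Type*} (s : Finset κ) (g : κ → ℕ) (m : ℕ) :
    min (∑ i ∈ s, g i) m ≤ ∑ i ∈ s, min (g i) m := by
  classical
  induction s using Finset.induction_on with
  | empty => simp
  | insert i s hi ih =>
    rw [Finset.sum_insert hi, Finset.sum_insert hi]
    omega

/-- A node with fewer than `4 q` items may gain `3 q` more without reaching the cap `8 q`, so gains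
truncated at `3 q` count in full. -/
theorem potential_greedyUpdate (hR : ∀ v, (S v).card < 4 * q → v ∈ R) :
    potential R q S + min (∑ v with (S v).card < 4 * q, gain G S v) (3 * q) ≤
      potential R q (greedyUpdate S G) := by
  classical
  have h1 : ∑ v with (S v).card < 4 * q, min (gain G S v) (3 * q) =
      ∑ v ∈ R, if (S v).card < 4 * q then min (gain G S v) (3 * q) else 0 := by
    rw [← Finset.sum_filter]
    refine Finset.sum_congr ?_ fun _ _ => rfl
    ext v
    simp only [Finset.mem_filter, Finset.mem_univ, true_and]
    exact ⟨fun h => ⟨hR v h, h⟩, fun h => h.2⟩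
  refine (add_le_add_right (min_sum_le _ _ _) _).trans ?_
  rw [h1, potential, potential, ← Finset.sum_add_distrib]
  refine Finset.sum_le_sum fun v _ => ?_
  rw [card_greedyUpdate]
  split_ifs <;> omega

/-- As long as 15/16 of `R` is poor, each round raises the potential by at least `3 q |R| / (2 n)`.
Item sets only grow, so it is enough to assume poverty at the end. -/
theorem potential_greedyRun {G : ℕ → SimpleGraph V} (hG : ∀ t, (G t).Connected)
    (hF : F.Nonempty) (hFR : ∀ v ∉ F, v ∈ R) {y : V → ι} (hy : Set.InjOn y R)
    {n : ℕ} (hq : 9 * q ^ 2 ≤ n) (hq0 : 0 < q) (hRn : R.card ≤ n) (m : ℕ) (t : ℕ)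
    (hFS : ∀ f ∈ F, 4 * q ≤ (S f).card) (hyS : ∀ v ∈ R, y v ∈ S v)
    (hpoor : 15 * R.card ≤ 16 * (poor R q (greedyRun G S t m)).card) :
    2 * n * potential R q S + 3 * q * R.card * m ≤
      2 * n * potential R q (greedyRun G S t m) := by
  induction m generalizing S t with
  | zero => simp [greedyRun]
  | succ m ih =>
    have hsub := fun v => subset_greedyUpdate (G t) S v
    have h1 := ih (S := greedyUpdate S (G t)) (t + 1)
      (fun f hf => (hFS f hf).trans (Finset.card_le_card (hsub f)))
      (fun v hv => hsub v (hyS v hv)) hpoor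
    have hpoor' : 15 * R.card ≤ 16 * (poor R q S).card := by
      refine hpoor.trans (Nat.mul_le_mul_left _ (Finset.card_le_card ?_))
      intro v hv
      obtain ⟨hv, hlt⟩ := Finset.mem_filter.1 hv
      exact Finset.mem_filter.2
        ⟨hv, (Finset.card_le_card (le_greedyRun G S t (m + 1) v)).trans_lt hlt⟩
    have h2 := potential_greedyUpdate (G := G t) (S := S) (R := R) (q := q) fun v hv => by
      refine hFR v fun hvF => ?_
      have := hFS v hvF
      omega
    obtain ⟨f, hf⟩ := hF
    have h3 := card_poor_le (R := R) (q := q) (hG t) ⟨f, hFS f hf⟩ hy hyS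
    set P := ∑ v with (S v).card < 4 * q, gain (G t) S v
    -- If `P ≤ 3 q`, then `15 |R| ≤ 64 q P` by `card_poor_le`, and `9 q² ≤ n` turns this into the
    -- claim; if `P ≥ 3 q`, then `|R| ≤ n` suffices.
    have h4 : 3 * q * R.card ≤ 2 * n * min P (3 * q) := by
      rcases le_total P (3 * q) with hP | hP
      · rw [min_eq_left hP]
        have h3 := h3 hP
        have h5 : 15 * R.card ≤ 64 * q * P := by linarith
        have h6 : 9 * q ^ 2 * (15 * R.card) ≤ n * (64 * q * P) := Nat.mul_le_mul hq h5
        have h7 : q * (135 * (q * R.card)) ≤ q * (64 * (n * P)) := by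
          calc _ = 9 * q ^ 2 * (15 * R.card) := by ring
            _ ≤ _ := h6
            _ = _ := by ring
        have h8 := Nat.le_of_mul_le_mul_left h7 hq0
        nlinarith
      · rw [min_eq_right hP]
        have := Nat.mul_le_mul_left (3 * q) hRn
        nlinarith
    have h5 := Nat.mul_le_mul_left (2 * n) h2
    rw [greedyRun]
    rw [mul_add] at h5
    rw [mul_add, mul_one]
    omega

/-- Greedy exchange for `n` rounds spreads at least about `√n` items to a constant fraction of the
nodes of `R`. -/
theorem exists_card_le_greedyRun {G : ℕ → SimpleGraph V} (hG : ∀ t, (G t).Connected)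
    (hF : F.Nonempty) (hR : R.Nonempty) (hFR : ∀ v ∉ F, v ∈ R) {y : V → ι} (hy : Set.InjOn y R)
    {n : ℕ} (hRn : R.card ≤ n) (hFS : ∀ f ∈ F, n ≤ (S f).card) (hyS : ∀ v ∈ R, y v ∈ S v)
    (t : ℕ) :
    ∃ q : ℕ, n ≤ 36 * q ^ 2 ∧
      R.card ≤ 16 * (R.filter fun v => q ≤ (greedyRun G S t n v).card).card := by
  classical
  rcases lt_or_ge n 9 with hn | hn
  · refine ⟨1, by omega, ?_⟩
    rw [Finset.filter_true_of_mem]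
    · omega
    · intro v hv
      exact Finset.card_pos.2 ⟨y v, le_greedyRun G S t n v (hyS v hv)⟩
  · have hs1 := Nat.sqrt_le' n
    have hs2 := Nat.lt_succ_sqrt' n
    -- The largest scale with `9 q² ≤ n`; rounding loses at most a factor of two, whence `n ≤ 36
    -- q²`.
    obtain ⟨q, hq⟩ : ∃ q, q = Nat.sqrt n / 3 := ⟨_, rfl⟩
    have hs3 : 3 ≤ Nat.sqrt n := Nat.le_sqrt'.2 hn
    have hq1 : 1 ≤ q := by omega
    have h1 : 3 * q ≤ Nat.sqrt n := by omega
    have h2 : Nat.sqrt n + 1 ≤ 6 * q := by omega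
    have h3 := Nat.pow_le_pow_left h1 2
    have h4 := Nat.pow_le_pow_left h2 2
    have hq9 : 9 * q ^ 2 ≤ n := by nlinarith
    refine ⟨q, by simp only [Nat.succ_eq_add_one] at hs2; nlinarith, ?_⟩
    by_contra hlt
    push Not at hlt
    have hsplit := Finset.card_filter_add_card_filter_not (s := R)
      (fun v => q ≤ (greedyRun G S t n v).card)
    have hpe : (R.filter fun v => ¬ q ≤ (greedyRun G S t n v).card) =
        poor R q (greedyRun G S t n) := by
      simp [poor]
    rw [hpe] at hsplit
    have key := potential_greedyRun (S := S) hG hF hFR hy hq9 hq1 hRn n t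
      (fun f hf => le_trans (by nlinarith) (hFS f hf)) hyS (by omega)
    -- After `n` rounds the potential is at least `3 q |R| / 2`. With `a < |R| / 16` nodes that are
    -- not poor and `b = |R| - a` poor ones it is at most `q b + 8 q a`, which is less.
    have hpot : potential R q (greedyRun G S t n) ≤
        q * (poor R q (greedyRun G S t n)).card +
          8 * q * (R.filter fun v => q ≤ (greedyRun G S t n v).card).card := by
      rw [potential, ← Finset.sum_filter_not_add_sum_filter R
        (fun v => q ≤ (greedyRun G S t n v).card), hpe]
      refine add_le_add ?_ ?_
      · refine (Finset.sum_le_card_nsmul _ _ q fun v hv => ?_).trans (by rw [smul_eq_mul, mul_comm])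
        exact (min_le_left _ _).trans (Finset.mem_filter.1 hv).2.le
      · refine (Finset.sum_le_card_nsmul _ _ (8 * q) fun v _ => ?_).trans
          (by rw [smul_eq_mul, mul_comm])
        exact min_le_right _ _
    have hr := hR.card_pos
    have h5 : n * (3 * q * R.card) ≤ n * (2 * potential R q (greedyRun G S t n)) := by
      calc _ = 3 * q * R.card * n := by ring
        _ ≤ _ := (Nat.le_add_left _ _).trans key
        _ = _ := by ring
    have h6 := Nat.le_of_mul_le_mul_left h5 (by omega)
    set a := (R.filter fun v => q ≤ (greedyRun G S t n v).card).card
    set b := (poor R q (greedyRun G S t n)).card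
    have h7 : q * (3 * R.card) ≤ q * (2 * b + 16 * a) := by nlinarith
    have h8 := Nat.le_of_mul_le_mul_left h7 hq1
    omega

end GreedyRun

/-! ### Broadcast -/

section Broadcast

variable {V K : Type} [Fintype V] [Fintype K] {G : ℕ → SimpleGraph V} {T : Finset K}
  {F R : Finset V} {t : ℕ} {H : Holdings V K}

theorem prob_current_bind {β : Type} (B : Holdings V K → Protocol V K β)
    (bad : β → ℕ → Holdings V K → Prop) :
    (current >>= B).prob G t H bad = (B H).prob G t H bad := rfl

theorem always_current_bind {β : Type} {B : Holdings V K → Protocol V K β}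
    {post : β → ℕ → Holdings V K → Prop} (h : (B H).Always G t H post) :
    (current >>= B).Always G t H post := h

theorem length_paddedTokens (T : Finset K) : (paddedTokens T).length = Fintype.card K := by
  simp [paddedTokens]

theorem mem_of_some_mem_paddedTokens {τ : K} (h : some τ ∈ paddedTokens T) : τ ∈ T := by
  simp only [paddedTokens, List.mem_map] at h
  obtain ⟨x, -, hx⟩ := h
  split_ifs at hx with hxT
  rwa [← Option.some.inj hx]

theorem some_mem_paddedTokens {τ : K} (h : τ ∈ T) : some τ ∈ paddedTokens T := by
  simp only [paddedTokens, List.mem_map]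
  exact ⟨τ, by simp, by simp [h]⟩

open Classical in
/-- The item sets at the beginning of the greedy rounds of a phase that starts at time `t`. -/
noncomputable def phaseStart (G : ℕ → SimpleGraph V) (F R : Finset V) (N t : ℕ) :
    V → Finset (Fin N) :=
  fun v => if v ∈ F then Finset.univ else placement G F R N t N v

/-- The ranks of the items that a node has at the end of a phase that starts at time `t`. -/
noncomputable def phaseEnd (G : ℕ → SimpleGraph V) (F R : Finset V) (N t : ℕ) :
    V → Finset (Fin N) :=
  greedyRun G (phaseStart G F R N t) (t + N) (Fintype.card V)

theorem always_phase_rounds {label : Fin (paddedTokens T).length → Option K} {t t' : ℕ}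
    (hT : ∀ u ∈ F, T ⊆ H u) (hlab : ∀ x, label x ∈ paddedTokens T)
    (ht : t' = t + (paddedTokens T).length)
    (h : Labelled label (placement G F R _ t (paddedTokens T).length) H) :
    (((List.range (Fintype.card V)).foldlM (fun S _ => greedyExchange label S)
      (phaseStart G F R _ t) >>= fun _ => pure () : Protocol V K Unit)).Always G t' H
      (fun _ t'' H' => t'' = t + (Fintype.card K + Fintype.card V) ∧
        Labelled label (phaseEnd G F R _ t) H') := by
  have hS : Labelled label (phaseStart G F R _ t) H := by
    intro v x τ hx hτ
    unfold phaseStart at hx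
    split_ifs at hx with hv
    · exact hT v hv (mem_of_some_mem_paddedTokens (hτ ▸ hlab x))
    · exact h v x τ hx hτ
  refine Protocol.Always.bind (always_greedy_rounds _ hS) fun _ t'' H' h' => ?_
  rw [List.length_range] at h'
  refine ⟨by rw [h'.1, ht, length_paddedTokens]; omega, ?_⟩
  rw [phaseEnd, ← ht]
  exact h'.2

open Classical in
theorem broadcastPhase_eq (T : Finset K) (F R : Finset V) :
    broadcastPhase T F R = loadBalance F (paddedTokens T) R >>= fun p =>
      ((List.range (Fintype.card V)).foldlM (fun S _ => greedyExchange p.1 S)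
        (fun v => if v ∈ F then Finset.univ else p.2 v) >>=
          fun _ => pure ()) := rfl

variable (hG : ∀ t, (G t).Connected) (hF : F.Nonempty) (hR : R.Nonempty)
  (hFR : ∀ v ∉ F, v ∈ R) (hRN : R.card ≤ Fintype.card K) (hT : ∀ u ∈ F, T ⊆ H u)

include hG hF hR hFR hRN hT

theorem always_broadcastPhase : (broadcastPhase T F R).Always G t H
      (fun _ t' _ => t' = t + (Fintype.card K + Fintype.card V)) := by
  rw [broadcastPhase_eq]
  refine Protocol.Always.bind (always_loadBalance hG hF hR hFR (by rwa [length_paddedTokens])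
    fun u hu τ hτ => hT u hu (mem_of_some_mem_paddedTokens hτ)) ?_
  rintro ⟨label, h⟩ t' H' ⟨h1, h2, h3, h4, h5⟩
  dsimp only at h1 h3 h5
  subst h1
  exact (always_phase_rounds (fun u hu => (hT u hu).trans (h4 u)) h5 h2 h3).mono
    fun _ _ _ h => h.1

/-- The set of ranks that `v` ends up with is determined by the networks; the token `τ` has one
uniformly random rank, and `v` gets `τ` if that rank is in the set. -/
theorem prob_broadcastPhase_le {τ : K} (hτ : τ ∈ T) (v : V) :
    (broadcastPhase T F R).prob G t H (fun _ _ H' => τ ∉ H' v) ≤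
      ENNReal.ofReal (Real.exp
        (-((phaseEnd G F R (Fintype.card K) t v).card / Fintype.card K : ℝ))) := by
  have hl : ∀ u ∈ F, ∀ τ, some τ ∈ paddedTokens T → τ ∈ H u :=
    fun u hu τ hτ => hT u hu (mem_of_some_mem_paddedTokens hτ)
  obtain ⟨y, hy⟩ := List.mem_iff_get.1 (some_mem_paddedTokens hτ)
  rw [broadcastPhase_eq]
  refine (prob_loadBalance_bind_le (T := paddedTokens T) (t := t) (H := H) hG hF hR hFR
    (by rwa [length_paddedTokens]) hl (phaseEnd G F R _ t v) {y} ?_).trans ?_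
  · rintro label H' h3 h4 h5 ⟨x, hx, y', hy', hxy⟩
    rw [Finset.mem_singleton.1 hy', hy] at hxy
    refine (always_phase_rounds (fun u hu => (hT u hu).trans (h4 u)) h5 rfl h3).mono
      fun _ _ H'' h => ?_
    exact not_not.2 (h.2 v x τ hx hxy)
  · rw [Finset.card_singleton, Nat.cast_one, mul_one, length_paddedTokens]

theorem always_repeat_broadcastPhase (m : ℕ) : (repeatTimes m (broadcastPhase T F R)).Always G t H
      (fun _ t' _ => t' = t + m * (Fintype.card K + Fintype.card V)) := by
  induction m generalizing t H with
  | zero => simp [repeatTimes_zero, Protocol.Always]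
  | succ m ih =>
    rw [repeatTimes_succ]
    refine Protocol.Always.bind ((always_broadcastPhase hG hF hR hFR hRN hT).and
      Protocol.always_le) fun _ t' H' h => ?_
    refine (ih fun u hu => (hT u hu).trans (h.2 u)).mono fun _ t'' _ h' => ?_
    rw [h', h.1]
    ring

/-- Within a stage `F` and `R` are fixed and each phase takes the same number of rounds, so the rank
sets of all phases are known beforehand. Each phase draws a fresh permutation, and the failure
bounds multiply. -/
theorem prob_repeat_broadcastPhase_le {τ : K} (hτ : τ ∈ T) (v : V) (m : ℕ) :
    (repeatTimes m (broadcastPhase T F R)).prob G t H (fun _ _ H' => τ ∉ H' v) ≤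
      ENNReal.ofReal (Real.exp (-(∑ j ∈ Finset.range m, (phaseEnd G F R (Fintype.card K)
        (t + j * (Fintype.card K + Fintype.card V)) v).card / Fintype.card K : ℝ))) := by
  induction m generalizing t H with
  | zero => simpa using Protocol.prob_le_one
  | succ m ih =>
    rw [repeatTimes_succ, Finset.sum_range_succ', neg_add_rev, Real.exp_add,
      ENNReal.ofReal_mul (Real.exp_pos _).le]
    refine Protocol.prob_bind_le_mul (mid := fun _ _ H' => τ ∉ H' v) ?_ ?_
    · simpa using prob_broadcastPhase_le hG hF hR hFR hRN hT hτ v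
    · refine ((always_broadcastPhase hG hF hR hFR hRN hT).and
        Protocol.always_le).mono fun _ t' H' h => ⟨fun _ => ?_, fun h' => ?_⟩
      · have := ih (t := t') fun u hu => (hT u hu).trans (h.2 u)
        rw [h.1] at this ⊢
        have hj : ∀ j, t + (Fintype.card K + Fintype.card V) + j * (Fintype.card K + Fintype.card V)
            = t + (j + 1) * (Fintype.card K + Fintype.card V) := fun j => by ring
        simpa only [hj] using this
      · exact Protocol.always_le.mono fun _ _ H'' h'' hn => h' fun hv => hn (h'' v hv)

end Broadcast

/-! ### A stage serves a constant fraction of the remaining nodes -/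

section Stage

variable {V K : Type} [Fintype V] [Fintype K] {G : ℕ → SimpleGraph V} {T : Finset K}
  {F R : Finset V} {t : ℕ} {H : Holdings V K}

/-- Load balancing of `n ≥ |R|` items places at least one at each node of `R`, at different nodes
different ones; these serve as the private items of `exists_card_le_greedyRun`. -/
theorem card_le_phaseEnd (hG : ∀ t, (G t).Connected) (hF : F.Nonempty) (hR : R.Nonempty)
    (hFR : ∀ v, v ∈ R ↔ v ∉ F) (hn : Fintype.card K = Fintype.card V) (t : ℕ) :
    R.card ≤ 16 * (R.filter fun v =>
      Fintype.card V ≤ 36 * (phaseEnd G F R (Fintype.card K) t v).card ^ 2).card := by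
  classical
  have hRn : R.card ≤ Fintype.card V := Finset.card_le_univ R
  have hb := balanced_placement (t := t) (N := Fintype.card K) hG hF hR
    (fun v hv => (hFR v).2 hv) (by omega) _ le_rfl
  have hne : ∀ v, ∃ y : Fin (Fintype.card K), v ∈ R →
      y ∈ placement G F R (Fintype.card K) t (Fintype.card K) v := by
    intro v
    by_cases hv : v ∈ R
    · have h1 := hb.le_card hv
      have h2 : 0 < Fintype.card K / R.card := Nat.div_pos (by omega) hR.card_pos
      obtain ⟨y, hy⟩ := Finset.card_pos.1 (h2.trans_le h1)
      exact ⟨y, fun _ => hy⟩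
    · exact ⟨⟨0, by have := hR.card_pos; omega⟩, fun h => absurd h hv⟩
  choose y hy using hne
  obtain ⟨q, hq, h⟩ := exists_card_le_greedyRun (S := phaseStart G F R (Fintype.card K) t) (y := y)
    (n := Fintype.card V) hG hF hR
    (fun v hv => (hFR v).2 hv) (fun v hv v' hv' h => hb.disj v v' _ (hy v hv) (h ▸ hy v' hv'))
    hRn (fun f hf => by simp [phaseStart, hf, hn])
    (fun v hv => by simpa [phaseStart, (hFR v).1 hv] using hy v hv) (t + Fintype.card K)
  refine h.trans (Nat.mul_le_mul_left _ (Finset.card_le_card fun v hv => ?_))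
  obtain ⟨hv, hqv⟩ := Finset.mem_filter.1 hv
  exact Finset.mem_filter.2 ⟨hv, hq.trans (Nat.mul_le_mul_left _ (Nat.pow_le_pow_left hqv 2))⟩

/-- A constant fraction of the nodes of `R` is well supplied in a constant fraction of the
phases. -/
theorem exists_good (hG : ∀ t, (G t).Connected) (hF : F.Nonempty) (hR : R.Nonempty)
    (hFR : ∀ v, v ∈ R ↔ v ∉ F) (hn : Fintype.card K = Fintype.card V) (m : ℕ) (τ : ℕ → ℕ) :
    ∃ Q ⊆ R, R.card ≤ 32 * Q.card ∧ ∀ v ∈ Q, (m : ℝ) * √(Fintype.card V) / 192 ≤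
      ∑ j ∈ Finset.range m, ((phaseEnd G F R (Fintype.card K) (τ j) v).card : ℝ) := by
  classical
  set good : ℕ → V → Prop := fun j v =>
    Fintype.card V ≤ 36 * (phaseEnd G F R (Fintype.card K) (τ j) v).card ^ 2 with hgood
  set cnt : V → ℕ := fun v => ((Finset.range m).filter fun j => good j v).card with hcnt
  refine ⟨R.filter fun v => m ≤ 32 * cnt v, Finset.filter_subset _ _, ?_, ?_⟩
  · rcases Nat.eq_zero_or_pos m with rfl | hm
    · simp; omega
    -- Double counting of pairs of a phase and a well supplied node: each phase has at least `|R| /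
    -- 16`. Nodes with fewer than `m / 32` good phases account for at most half of the pairs, so at
    -- least `|R| / 32` nodes have `m / 32` good phases, with at least `√n / 6` ranks in each; hence
    -- `192`.
    have h1 : m * R.card ≤ 16 * ∑ v ∈ R, cnt v := by
      have hcnt' : ∀ v, cnt v = ∑ j ∈ Finset.range m, if good j v then 1 else 0 :=
        fun v => Finset.card_filter _ _
      have hgood' : ∀ j, (R.filter fun v => good j v).card = ∑ v ∈ R, if good j v then 1 else 0 :=
        fun j => Finset.card_filter _ _
      simp only [hcnt']
      rw [Finset.sum_comm]
      simp only [← hgood']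
      rw [Finset.mul_sum]
      calc m * R.card = ∑ _j ∈ Finset.range m, R.card := by simp
        _ ≤ _ := Finset.sum_le_sum fun j _ => card_le_phaseEnd hG hF hR hFR hn (τ j)
    have h2 : 32 * ∑ v ∈ R, cnt v ≤
        32 * m * (R.filter fun v => m ≤ 32 * cnt v).card + m * R.card := by
      rw [← Finset.sum_filter_add_sum_filter_not R (fun v => m ≤ 32 * cnt v), mul_add]
      refine add_le_add ?_ ?_
      · rw [mul_assoc]
        refine Nat.mul_le_mul_left _ ?_
        rw [mul_comm]
        refine (Finset.sum_le_card_nsmul _ _ m fun v _ => ?_).trans (by rw [smul_eq_mul])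
        exact (Finset.card_filter_le _ _).trans (by simp)
      · rw [Finset.mul_sum]
        refine (Finset.sum_le_card_nsmul _ _ m fun v hv => ?_).trans ?_
        · have := (Finset.mem_filter.1 hv).2
          omega
        · rw [smul_eq_mul, mul_comm]
          exact Nat.mul_le_mul_left _ (Finset.card_filter_le _ _)
    have h3 : m * R.card ≤ m * (32 * (R.filter fun v => m ≤ 32 * cnt v).card) := by
      linarith
    exact Nat.le_of_mul_le_mul_left h3 hm
  · intro v hv
    have hc : (m : ℝ) ≤ 32 * cnt v := by exact_mod_cast (Finset.mem_filter.1 hv).2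
    have hs := Real.sqrt_nonneg (Fintype.card V : ℝ)
    calc (m : ℝ) * √(Fintype.card V) / 192 ≤ cnt v * (√(Fintype.card V) / 6) := by nlinarith
      _ = ∑ j ∈ (Finset.range m).filter fun j => good j v, √(Fintype.card V) / 6 := by
        rw [Finset.sum_const, nsmul_eq_mul]
      _ ≤ ∑ j ∈ (Finset.range m).filter fun j => good j v,
          ((phaseEnd G F R (Fintype.card K) (τ j) v).card : ℝ) := by
        refine Finset.sum_le_sum fun j hj => ?_
        have h1 : Fintype.card V ≤ 36 * (phaseEnd G F R (Fintype.card K) (τ j) v).card ^ 2 :=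
          (Finset.mem_filter.1 hj).2
        rw [div_le_iff₀ (by norm_num), Real.sqrt_le_left (by positivity)]
        have h2 : (Fintype.card V : ℝ) ≤
            36 * (phaseEnd G F R (Fintype.card K) (τ j) v).card ^ 2 := by exact_mod_cast h1
        linarith
      _ ≤ _ := Finset.sum_le_sum_of_subset_of_nonneg (Finset.filter_subset _ _)
        fun _ _ _ => by positivity

open Classical in
/-- The nodes that do not hold all tokens of `T`. -/
noncomputable def lacking (T : Finset K) (H : Holdings V K) : Finset V :=
  Finset.univ.filter fun v => ¬ T ⊆ H v

theorem lacking_anti {H H' : Holdings V K} (h : H ≤ H') : lacking T H' ⊆ lacking T H := by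
  intro v hv
  simp only [lacking, Finset.mem_filter, Finset.mem_univ, true_and] at hv ⊢
  exact fun h' => hv (h'.trans (h v))

open Classical in
theorem broadcastStage_eq (m : ℕ) (T : Finset K) :
    (broadcastStage m T : Protocol V K Unit) = current >>= fun H =>
      if lacking T H = ∅ then pure () else
        repeatTimes m (broadcastPhase T (Finset.univ.filter fun v => T ⊆ H v) (lacking T H)) := rfl

variable (hG : ∀ t, (G t).Connected) (hn : Fintype.card K = Fintype.card V)
  (hs : ∃ s, T ⊆ H s)

include hG hn hs

theorem always_broadcastStage (m : ℕ) : (broadcastStage m T).Always G t H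
    (fun _ t' _ => t' ≤ t + m * (2 * Fintype.card V)) := by
  classical
  rw [broadcastStage_eq]
  refine always_current_bind ?_
  split_ifs with h0
  · exact Nat.le_add_right _ _
  · refine (always_repeat_broadcastPhase hG ?_ (Finset.nonempty_iff_ne_empty.2 h0) ?_ ?_ ?_ m).mono
      fun _ t' _ h => ?_
    · obtain ⟨s, hs⟩ := hs
      exact ⟨s, by simp [hs]⟩
    · intro v hv
      simpa [lacking] using hv
    · exact (Finset.card_le_univ _).trans hn.ge
    · intro u hu
      simpa using hu
    · rw [h, hn, two_mul]

/-- The set `Q` of nodes that will be well supplied is fixed once the stage starts, so a union bound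
over the at most `n²` pairs in `Q × T` is possible. If no pair fails, all of `Q`, at least `|R| /
32` nodes, leave the set of lacking nodes. -/
theorem prob_broadcastStage_le (m : ℕ) {δ : ℝ} (hδ : (Fintype.card V : ℝ) ^ 2 *
      Real.exp (-(m * √(Fintype.card V) / 192 / Fintype.card V)) ≤ δ) :
    (broadcastStage m T).prob G t H
      (fun _ _ H' => ¬ 32 * (lacking T H').card ≤ 31 * (lacking T H).card) ≤ ENNReal.ofReal δ := by
  classical
  rw [broadcastStage_eq, prob_current_bind]
  split_ifs with h0
  · refine (Protocol.Always.prob_eq_zero ?_).le.trans bot_le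
    show ¬¬_
    simp [h0]
  · set F := Finset.univ.filter fun v => T ⊆ H v with hFdef
    have hR := Finset.nonempty_iff_ne_empty.2 h0
    have hF : F.Nonempty := by
      obtain ⟨s, hs⟩ := hs
      exact ⟨s, by simp [hFdef, hs]⟩
    have hFR : ∀ v, v ∈ lacking T H ↔ v ∉ F := by
      intro v
      simp [lacking, hFdef]
    have hFT : ∀ u ∈ F, T ⊆ H u := by
      intro u hu
      simpa [hFdef] using hu
    obtain ⟨Q, hQR, hQ, hQs⟩ := exists_good hG hF hR hFR hn m
      (fun j => t + j * (Fintype.card K + Fintype.card V))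
    have hn0 : 0 < Fintype.card V := hR.card_pos.trans_le (Finset.card_le_univ _)
    refine (Protocol.Always.prob_mono (q := fun _ _ H' => ∃ e ∈ Q ×ˢ T, e.2 ∉ H' e.1) ?_).trans
      ((Protocol.prob_exists_le (Q ×ˢ T)).trans ?_)
    · refine Protocol.always_le.mono fun _ _ H' hle hbad => ?_
      by_contra hall
      push Not at hall
      apply hbad
      have hsub : lacking T H' ⊆ lacking T H \ Q := by
        intro v hv
        refine Finset.mem_sdiff.2 ⟨lacking_anti hle hv, fun hvQ => ?_⟩
        simp only [lacking, Finset.mem_filter, Finset.mem_univ, true_and] at hv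
        exact hv fun τ hτ => hall (v, τ) (Finset.mem_product.2 ⟨hvQ, hτ⟩)
      have h1 := Finset.card_le_card hsub
      rw [Finset.card_sdiff_of_subset hQR] at h1
      have h2 := Finset.card_le_card hQR
      omega
    · have hterm : ∀ e ∈ Q ×ˢ T,
          (repeatTimes m (broadcastPhase T F (lacking T H))).prob G t H
            (fun _ _ H' => e.2 ∉ H' e.1) ≤ ENNReal.ofReal
              (Real.exp (-(m * √(Fintype.card V) / 192 / Fintype.card V))) := by
        rintro ⟨v, τ⟩ he
        obtain ⟨hv, hτ⟩ := Finset.mem_product.1 he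
        refine (prob_repeat_broadcastPhase_le hG hF hR (fun v hv => (hFR v).2 hv)
          ((Finset.card_le_univ _).trans hn.ge) hFT hτ v m).trans ?_
        refine ENNReal.ofReal_le_ofReal (Real.exp_le_exp.2 (neg_le_neg ?_))
        rw [← Finset.sum_div]
        have := hQs v hv
        rw [show (Fintype.card K : ℝ) = Fintype.card V by exact_mod_cast hn]
        gcongr
      refine (Finset.sum_le_card_nsmul _ _ _ hterm).trans ?_
      rw [nsmul_eq_mul, ← ENNReal.ofReal_natCast, ← ENNReal.ofReal_mul (by positivity)]
      refine ENNReal.ofReal_le_ofReal (le_trans ?_ hδ)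
      refine mul_le_mul_of_nonneg_right ?_ (Real.exp_pos _).le
      rw [Finset.card_product, sq, Nat.cast_mul]
      have h1 : (Q.card : ℝ) ≤ Fintype.card V := by exact_mod_cast Finset.card_le_univ Q
      have h2 : (T.card : ℝ) ≤ Fintype.card V := by
        rw [← hn]; exact_mod_cast Finset.card_le_univ T
      gcongr

theorem always_repeat_broadcastStage (m k : ℕ) :
    (repeatTimes k (broadcastStage m T)).Always G t H
      (fun _ t' _ => t' ≤ t + k * (m * (2 * Fintype.card V))) := by
  induction k generalizing t H with
  | zero => simp [repeatTimes_zero, Protocol.Always]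
  | succ k ih =>
    rw [repeatTimes_succ]
    refine Protocol.Always.bind ((always_broadcastStage hG hn hs m).and
      Protocol.always_le) fun _ t' H' h => ?_
    obtain ⟨s, hs⟩ := hs
    refine (ih ⟨s, hs.trans (h.2 s)⟩).mono fun _ t'' _ h' => ?_
    have := h.1
    rw [add_mul, one_mul]
    omega

theorem prob_repeat_broadcastStage_le (m k : ℕ) {δ : ℝ} (hδ : (Fintype.card V : ℝ) ^ 2 *
      Real.exp (-(m * √(Fintype.card V) / 192 / Fintype.card V)) ≤ δ) :
    (repeatTimes k (broadcastStage m T)).prob G t H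
      (fun _ _ H' => ¬ 32 ^ k * (lacking T H').card ≤ 31 ^ k * (lacking T H).card) ≤
      ENNReal.ofReal (k * δ) := by
  have hδ0 : 0 ≤ δ := le_trans (by positivity) hδ
  induction k generalizing t H with
  | zero =>
    refine (Protocol.Always.prob_eq_zero ?_).le.trans bot_le
    show ¬¬_
    simp
  | succ k ih =>
    rw [repeatTimes_succ]
    have : ((k + 1 : ℕ) : ℝ) * δ = δ + k * δ := by push_cast; ring
    rw [this, ENNReal.ofReal_add hδ0 (by positivity)]
    refine Protocol.prob_bind_le (prob_broadcastStage_le hG hn hs m hδ) ?_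
    refine Protocol.always_le.mono fun _ t' H' hle hm => ?_
    rw [not_not] at hm
    obtain ⟨s, hs⟩ := hs
    refine le_trans (Protocol.Always.prob_mono (Protocol.always_of_forall fun _ _ H'' => ?_))
      (ih (t := t') ⟨s, hs.trans (hle s)⟩)
    refine mt fun h => ?_
    calc 32 ^ (k + 1) * (lacking T H'').card = 32 * (32 ^ k * (lacking T H'').card) := by ring
      _ ≤ 32 * (31 ^ k * (lacking T H').card) := Nat.mul_le_mul_left _ h
      _ = 31 ^ k * (32 * (lacking T H').card) := by ring
      _ ≤ 31 ^ k * (31 * (lacking T H).card) := Nat.mul_le_mul_left _ hm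
      _ = _ := by ring

end Stage

/-! ### Flooding -/

section Flood

variable {V K : Type} [Fintype V] [Fintype K] {G : ℕ → SimpleGraph V} {t : ℕ} {H : Holdings V K}

open Classical in
/-- The nodes that hold `τ`. -/
noncomputable def holders (τ : K) (H : Holdings V K) : Finset V :=
  Finset.univ.filter fun v => τ ∈ H v

theorem mem_holders {τ : K} {v : V} : v ∈ holders τ H ↔ τ ∈ H v := by
  simp [holders]

theorem holders_mono {τ : K} {H H' : Holdings V K} (h : H ≤ H') : holders τ H ⊆ holders τ H' :=
  fun v hv => mem_holders.2 (h v (mem_holders.1 hv))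

theorem exists_adj_of_mem_of_notMem {G : SimpleGraph V} (hG : G.Connected) {S : Finset V}
    (hS : S.Nonempty) {w : V} (hw : w ∉ S) : ∃ u ∈ S, ∃ v ∉ S, G.Adj u v := by
  classical
  obtain ⟨r, hr⟩ := hS
  obtain ⟨v, hv, hmin⟩ := Finset.exists_min_image Sᶜ (fun v => G.dist v r)
    ⟨w, Finset.mem_compl.2 hw⟩
  rw [Finset.mem_compl] at hv
  obtain ⟨u, hu, hlt⟩ := exists_adj_dist_lt hG (v := v) (r := r) (by rintro rfl; exact hv hr)
  refine ⟨u, ?_, v, hv, hu.symm⟩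
  by_contra huS
  have := hmin u (Finset.mem_compl.2 huS)
  omega

/-- Unless every node holds `τ`, a connected network has an edge leaving the set of holders. -/
theorem card_holders_flood_round {G : SimpleGraph V} (hG : G.Connected) {τ : K}
    (h : (holders τ H).Nonempty) :
    min (Fintype.card V) ((holders τ H).card + 1) ≤
      (holders τ (deliver G (fun _ _ => (some τ).bind some) H)).card := by
  classical
  by_cases hall : ∀ v, v ∈ holders τ H
  · refine (min_le_left _ _).trans ?_
    rw [← Finset.card_univ]
    exact Finset.card_le_card fun v _ => holders_mono (subset_deliver _ _ _) (hall v)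
  · push Not at hall
    obtain ⟨w, hw⟩ := hall
    obtain ⟨u, hu, v, hv, huv⟩ := exists_adj_of_mem_of_notMem hG h hw
    refine (min_le_right _ _).trans ?_
    rw [← Finset.card_insert_of_notMem hv]
    refine Finset.card_le_card (Finset.insert_subset ?_ (holders_mono (subset_deliver _ _ _)))
    rw [mem_holders]
    simp only [deliver, Finset.mem_filter, Finset.mem_univ, true_and]
    exact Or.inr ⟨u, huv, mem_holders.1 hu, rfl⟩

theorem always_flood (hG : ∀ t, (G t).Connected) {τ : K} (h : ∃ v, τ ∈ H v) (m : ℕ) :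
    (flood τ m : Protocol V K Unit).Always G t H (fun _ t' H' => t' = t + m ∧
      min (Fintype.card V) (m + 1) ≤ (holders τ H').card) := by
  have hne : (holders τ H).Nonempty := h.imp fun v hv => mem_holders.2 hv
  clear h
  suffices (flood τ m : Protocol V K Unit).Always G t H (fun _ t' H' => t' = t + m ∧
      min (Fintype.card V) ((holders τ H).card + m) ≤ (holders τ H').card) by
    refine this.mono fun _ t' H' h' => ⟨h'.1, le_trans ?_ h'.2⟩
    have := hne.card_pos
    omega
  unfold flood
  induction m generalizing t H with
  | zero => exact ⟨rfl, min_le_right _ _⟩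
  | succ m ih =>
    rw [repeatTimes_succ, Protocol.always_bind]
    have h1 := card_holders_flood_round (hG t) hne
    refine (ih (t := t + 1) (hne.mono (holders_mono (subset_deliver (G t) _ H)))).mono
      fun _ t' H' h' => ⟨by rw [h'.1]; ring, ?_⟩
    have h2 := h'.2
    dsimp only at h1 h2
    omega

theorem always_forEach_flood (hG : ∀ t, (G t).Connected) (m : ℕ) (l : List K)
    (h : ∀ τ ∈ l, ∃ v, τ ∈ H v) :
    (forEach l fun τ => flood τ m : Protocol V K Unit).Always G t H (fun _ t' H' =>
      t' = t + l.length * m ∧ ∀ τ ∈ l, min (Fintype.card V) (m + 1) ≤ (holders τ H').card) := by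
  induction l generalizing t H with
  | nil => simp [forEach_nil, Protocol.Always]
  | cons τ l ih =>
    rw [forEach_cons]
    refine Protocol.Always.bind ((always_flood hG (h τ (by simp)) m).and Protocol.always_le)
      fun _ t' H' h' => ?_
    refine ((ih (t := t') (H := H') fun τ' hτ' => ?_).and Protocol.always_le).mono
      fun _ t'' H'' h'' => ⟨?_, ?_⟩
    · obtain ⟨v, hv⟩ := h τ' (by simp [hτ'])
      exact ⟨v, h'.2 v hv⟩
    · rw [h''.1.1, h'.1.1, List.length_cons]
      ring
    · intro τ' hτ'
      rcases List.mem_cons.1 hτ' with rfl | hτ'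
      · exact h'.1.2.trans (Finset.card_le_card (holders_mono h''.2))
      · exact h''.1.2 τ' hτ'

end Flood

/-! ### Exchange -/

section Exchange

variable {V K : Type} [Fintype V] [Fintype K] {G : ℕ → SimpleGraph V} {t : ℕ} {H : Holdings V K}
  {κ : ℝ} {a : ℕ}

/-- Any `a` nodes together hold at least one of any `a` tokens. -/
def Expands (a : ℕ) (H : Holdings V K) : Prop :=
  ∀ (A : Finset V) (M : Finset K), a ≤ A.card → a ≤ M.card → ∃ v ∈ A, ∃ τ ∈ M, τ ∈ H v

theorem Expands.mono {H H' : Holdings V K} (h : Expands a H) (hH : H ≤ H') : Expands a H' :=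
  fun A M hA hM =>
    let ⟨v, hv, τ, hτ, hm⟩ := h A M hA hM
    ⟨v, hv, τ, hτ, hH v hm⟩

/-- With a gain `P < n / (2 a)` there would be so few components that one has at least `a` nodes.
Its nodes hold only tokens in `H v ∪ X`, so by expansion fewer than `a` tokens lie outside, and `v`
lacks at most `2 a`: it would be rich. -/
theorem le_gain_of_not_rich {G : SimpleGraph V} (hG : G.Connected)
    (hn : Fintype.card K = Fintype.card V) (hH : Expands a H)
    (ha : 2 * (a : ℝ) ≤ κ * √(Fintype.card V) * Real.log (Fintype.card V))
    (ha' : Fintype.card V ≤ 2 * a ^ 2) (hrich : ¬ ∃ T, IsRich κ H T) :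
    Fintype.card V ≤ 2 * a * ∑ v, gain G H v := by
  classical
  set n := Fintype.card V with hndef
  have hpoor : ∀ v, (H v).card + 2 * a < n := by
    intro v
    by_contra hv
    refine hrich ⟨H v, ⟨v, rfl⟩, ?_⟩
    have : (n : ℝ) ≤ (H v).card + 2 * a := by exact_mod_cast not_lt.1 hv
    linarith
  by_contra hlt
  push Not at hlt
  -- The threshold exceeds any possible `|H v| + |X|`, so here it imposes no restriction.
  obtain ⟨E, X, hX, hcomp, hE⟩ := exists_components hG H (2 * n + 2)
  have hfil : (Finset.univ.filter fun v => (H v).card < 2 * n + 2) = Finset.univ := by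
    refine Finset.filter_true_of_mem fun v _ => ?_
    have := hpoor v
    omega
  rw [hfil] at hX hcomp
  set P := ∑ v, gain G H v
  have hn0 : 0 < n := by omega
  have ha0 : 0 < a := by
    rcases Nat.eq_zero_or_pos a with rfl | h
    · simp at ha'; omega
    · exact h
  have hPa : P < a := by
    by_contra h
    push Not at h
    have := Nat.mul_le_mul_left (2 * a) h
    nlinarith
  obtain ⟨v₀⟩ : Nonempty V := hG.nonempty
  have hpa := hpoor v₀
  rw [Nat.card_eq_fintype_card] at hcomp
  obtain ⟨c, -, hc⟩ := Finset.exists_le_card_fiber_of_mul_le_card_of_maps_to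
    (s := (Finset.univ : Finset V)) (t := (Finset.univ : Finset E.ConnectedComponent)) (n := a)
    (f := E.connectedComponentMk) (fun _ _ => Finset.mem_univ _) ⟨E.connectedComponentMk v₀,
      Finset.mem_univ _⟩ (by
      rw [Finset.card_univ, Finset.card_univ]
      have := Nat.mul_le_mul_right a hcomp
      nlinarith)
  obtain ⟨v, hv⟩ := Finset.card_pos.1 (ha0.trans_le hc)
  have hvc := (Finset.mem_filter.1 hv).2
  have hM : (H v ∪ X)ᶜ.card < a := by
    by_contra hM
    push Not at hM
    obtain ⟨u, hu, τ, hτ, hmem⟩ := hH _ _ hc hM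
    have huc := (Finset.mem_filter.1 hu).2
    rw [Finset.mem_compl, Finset.mem_union] at hτ
    have := hpoor v
    exact hτ (hE v u (by omega) (SimpleGraph.ConnectedComponent.eq.1 (hvc.trans huc.symm)) τ hmem)
  rw [Finset.card_compl, hn] at hM
  have h1 := Finset.card_union_le (H v) X
  have h2 := hpoor v
  omega

theorem deliver_greedy (G : SimpleGraph V) (H : Holdings V K) :
    deliver G (fun u v => (greedySend H G u v).bind some) H = greedyUpdate H G := by
  classical
  funext v
  ext τ
  simp only [deliver, greedyUpdate, Finset.mem_filter, Finset.mem_univ, true_and,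
    Option.bind_fun_some]
  refine or_congr_right (exists_congr fun u => ⟨fun h => h.2.2, fun h => ?_⟩)
  obtain ⟨h1, h2, -⟩ := (isMaximumMatchingAt_greedySend G H v).1.1 u τ h
  exact ⟨h1, h2, h⟩

/-- At most `n²` pairs of a node and a token can be gained, at least `n / (2 a)` in each round, so
the time is at most `2 a n`. The condition on `m` says that the cap is at least the number of pairs
still missing; each round gains at least one, so a cap run down to zero means that all nodes hold
everything. -/
theorem always_exchangeUntilRich (hG : ∀ t, (G t).Connected)
    (hn : Fintype.card K = Fintype.card V) (hH : Expands a H)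
    (ha : 2 * (a : ℝ) ≤ κ * √(Fintype.card V) * Real.log (Fintype.card V))
    (ha' : Fintype.card V ≤ 2 * a ^ 2) (m : ℕ)
    (hm : Fintype.card V * Fintype.card V ≤ m + ∑ v, (H v).card) :
    (exchangeUntilRich κ m).Always G t H (fun _ t' H' => (∃ T, IsRich κ H' T) ∧
      Fintype.card V * t' + 2 * a * ∑ v, (H v).card ≤
        Fintype.card V * t + 2 * a * (Fintype.card V * Fintype.card V)) := by
  have htot : ∀ H : Holdings V K, ∑ v, (H v).card ≤ Fintype.card V * Fintype.card V := by
    intro H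
    refine (Finset.sum_le_card_nsmul _ _ (Fintype.card V) fun v _ => ?_).trans ?_
    · rw [← hn]; exact Finset.card_le_univ _
    · rw [smul_eq_mul, Finset.card_univ]
  induction m generalizing t H with
  | zero =>
    refine ⟨?_, Nat.add_le_add_left (Nat.mul_le_mul_left _ (htot H)) _⟩
    obtain ⟨v⟩ := (hG 0).nonempty
    refine ⟨H v, ⟨v, rfl⟩, ?_⟩
    have hv : Fintype.card V ≤ (H v).card := by
      by_contra hlt
      push Not at hlt
      have h1 : ∑ v, (H v).card < ∑ _v : V, Fintype.card V :=
        Finset.sum_lt_sum (fun v _ => by rw [← hn]; exact Finset.card_le_univ _)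
          ⟨v, Finset.mem_univ _, hlt⟩
      rw [Finset.sum_const, smul_eq_mul, Finset.card_univ] at h1
      omega
    have hv' : (Fintype.card V : ℝ) ≤ (H v).card := by exact_mod_cast hv
    have := Nat.cast_nonneg (α := ℝ) a
    linarith
  | succ m ih =>
    rw [exchangeUntilRich]
    refine always_current_bind ?_
    split_ifs with hr
    · exact ⟨hr, Nat.add_le_add_left (Nat.mul_le_mul_left _ (htot H)) _⟩
    · rw [Protocol.always_bind]
      show (exchangeUntilRich κ m).Always G (t + 1)
        (deliver (G t) (fun u v => (greedySend H (G t) u v).bind some) H) _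
      rw [deliver_greedy]
      have hgain := le_gain_of_not_rich (hG t) hn hH ha ha' hr
      have hsum : ∑ v, (greedyUpdate H (G t) v).card = ∑ v, (H v).card + ∑ v, gain (G t) H v := by
        rw [← Finset.sum_add_distrib]
        exact Finset.sum_congr rfl fun v _ => card_greedyUpdate _ _ _
      have hn0 : 0 < Fintype.card V := by
        obtain ⟨v⟩ := (hG 0).nonempty
        exact Fintype.card_pos_iff.2 ⟨v⟩
      have hpos : 0 < ∑ v, gain (G t) H v := by
        by_contra h0
        rw [Nat.eq_zero_of_not_pos h0] at hgain
        omega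
      refine (ih (t := t + 1) (hH.mono fun v => subset_greedyUpdate (G t) H v)
        (by rw [hsum]; omega)).mono fun _ t' H' h => ⟨h.1, ?_⟩
      have h2 := h.2
      rw [hsum, mul_add, mul_add, mul_one] at h2
      omega

/-- Only the broadcast can fail here: given expansion, the search for a rich node and the final
flooding succeed with certainty. -/
theorem prob_exchange_le (hG : ∀ t, (G t).Connected) (hn : Fintype.card K = Fintype.card V)
    (hH : Expands a H)
    (ha : 2 * (a : ℝ) ≤ κ * √(Fintype.card V) * Real.log (Fintype.card V))
    (ha' : Fintype.card V ≤ 2 * a ^ 2) (hheld : ∀ τ, ∃ v, τ ∈ H v) {φ σ : ℝ} {k m : ℕ}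
    (hk : k = ⌈σ * Real.log (Fintype.card V)⌉₊)
    (hm : m = ⌈φ * √(Fintype.card V) * Real.log (Fintype.card V)⌉₊)
    (hk' : 31 ^ k * Fintype.card V < 32 ^ k) {δ : ℝ} (hδ : (Fintype.card V : ℝ) ^ 2 *
      Real.exp (-(m * √(Fintype.card V) / 192 / Fintype.card V)) ≤ δ) :
    (exchange κ φ σ).prob G t H (fun _ t' H' => ¬ ((∀ v, H' v = Finset.univ) ∧
      (t' : ℝ) ≤ t + 2 * a * Fintype.card V + k * (m * (2 * Fintype.card V)) +
        κ * √(Fintype.card V) * Real.log (Fintype.card V) * Fintype.card V)) ≤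
      ENNReal.ofReal (k * δ) := by
  classical
  have hn0 : 0 < Fintype.card V := by
    obtain ⟨v⟩ := (hG 0).nonempty
    exact Fintype.card_pos_iff.2 ⟨v⟩
  rw [← zero_add (ENNReal.ofReal _)]
  unfold exchange
  refine Protocol.prob_bind_le (mid := fun _ _ _ => False)
    (Protocol.Always.prob_eq_zero (Protocol.always_of_forall fun _ _ _ => not_false)).le ?_
  refine ((always_exchangeUntilRich hG hn hH ha ha' _ (Nat.le_add_right _ _)).and
    Protocol.always_le).mono fun _ t' H' h _ => ?_
  obtain ⟨⟨hrich, ht'⟩, hle⟩ := h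
  have ht1 : t' ≤ t + 2 * a * Fintype.card V := by
    refine Nat.le_of_mul_le_mul_left ((Nat.le_add_right _ _).trans (ht'.trans (le_of_eq ?_))) hn0
    ring
  have ht1' : (t' : ℝ) ≤ t + 2 * a * Fintype.card V := by exact_mod_cast ht1
  have ha0 := Nat.cast_nonneg (α := ℝ) a
  have hκ0 : 0 ≤ κ * √(Fintype.card V) * Real.log (Fintype.card V) := by linarith
  rw [prob_current_bind]
  split_ifs with hall
  · refine (Protocol.Always.prob_eq_zero ?_).le.trans bot_le
    show ¬¬_
    rw [not_not]
    have h1 := mul_nonneg hκ0 (Nat.cast_nonneg (α := ℝ) (Fintype.card V))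
    have h2 : (0 : ℝ) ≤ k * (m * (2 * Fintype.card V)) := by positivity
    exact ⟨hall, by linarith⟩
  · set T := Classical.epsilon (IsRich κ H') with hT
    have hTrich : IsRich κ H' T := Classical.epsilon_spec hrich
    obtain ⟨⟨s, hs⟩, hTcard⟩ := hTrich
    have hsT : ∃ s, T ⊆ H' s := ⟨s, hs.ge⟩
    rw [← add_zero (ENNReal.ofReal _)]
    have hb := prob_repeat_broadcastStage_le (t := t') hG hn hsT m k hδ
    rw [hk] at hb
    nth_rewrite 1 [hm] at hb
    have hb' : (broadcast φ σ T).prob G t' H' _ ≤ _ := hb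
    rw [← hk] at hb'
    refine Protocol.prob_bind_le hb' ?_
    have hb2 := always_repeat_broadcastStage (t := t') hG hn hsT m k
    rw [hk] at hb2
    nth_rewrite 1 [hm] at hb2
    have hb3 : (broadcast φ σ T).Always G t' H' _ := hb2
    rw [← hk] at hb3
    refine (hb3.and Protocol.always_le).mono fun _ t₂ H₂ h₂ hgood => ?_
    rw [not_not] at hgood
    -- The number of lacking nodes has dropped below `(31 / 32) ^ k n < 1`, hence to zero.
    have hfull : ∀ v, T ⊆ H₂ v := by
      have h0 : (lacking T H₂).card = 0 := by
        by_contra h0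
        have h1 : (lacking T H').card ≤ Fintype.card V := Finset.card_le_univ _
        have h2 : 32 ^ k * 1 ≤ 32 ^ k * (lacking T H₂).card :=
          Nat.mul_le_mul_left _ (by omega)
        have h3 := Nat.mul_le_mul_left (31 ^ k) h1
        omega
      intro v
      by_contra hv
      have : v ∈ lacking T H₂ := by simp [lacking, hv]
      rw [Finset.card_eq_zero] at h0
      simp [h0] at this
    refine (Protocol.Always.prob_eq_zero ?_).le
    refine ((always_forEach_flood hG _ _ fun τ _ => ?_).and Protocol.always_le).mono
      fun _ t₃ H₃ h₃ => ?_
    · obtain ⟨v, hv⟩ := hheld τ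
      exact ⟨v, h₂.2 v (hle v hv)⟩
    · rw [not_not]
      refine ⟨fun v => Finset.eq_univ_iff_forall.2 fun τ => ?_, ?_⟩
      · by_cases hτ : τ ∈ T
        · exact h₃.2 v (hfull v hτ)
        · have h4 := h₃.1.2 τ (by simp [hτ])
          rw [min_eq_left (Nat.le_succ _)] at h4
          have h5 := (Finset.card_eq_iff_eq_univ _).1
            (le_antisymm (Finset.card_le_univ _) h4)
          exact mem_holders.1 (h5 ▸ Finset.mem_univ v)
      · have h4 : (Finset.univ.filter fun τ => τ ∉ T).card + T.card = Fintype.card V := by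
          rw [add_comm, ← hn, ← Finset.card_univ (α := K),
            ← Finset.card_filter_add_card_filter_not (s := Finset.univ) (fun τ => τ ∈ T)]
          simp
        have h5 : ((Finset.univ.filter fun τ => τ ∉ T).card : ℝ) ≤
            κ * √(Fintype.card V) * Real.log (Fintype.card V) := by
          have : ((Finset.univ.filter fun τ => τ ∉ T).card : ℝ) + T.card = Fintype.card V := by
            exact_mod_cast h4
          linarith
        have h6 : (t₂ : ℝ) ≤ t' + k * (m * (2 * Fintype.card V)) := by exact_mod_cast h₂.1
        have h7 : (t₃ : ℝ) = t₂ +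
            (Finset.univ.filter fun τ => τ ∉ T).card * Fintype.card V := by
          rw [h₃.1.1, Finset.length_toList]
          push_cast
          ring
        have h8 := mul_le_mul_of_nonneg_right h5 (Nat.cast_nonneg (α := ℝ) (Fintype.card V))
        linarith

end Exchange

/-! ### Leaders -/

section Leaders

variable {V K : Type} [Fintype V] [Fintype K] {G : ℕ → SimpleGraph V} {t : ℕ} {H : Holdings V K}

theorem leaders_spec (hheld : ∀ τ, ∃ v, τ ∈ H v) :
    Hits H (leaders H) ∧ ∀ S', Hits H S' → (leaders H).card ≤ S'.card := by
  classical
  obtain ⟨S, hS, hmin⟩ := Finset.exists_min_image (Finset.univ.filter fun S => Hits H S)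
    Finset.card ⟨Finset.univ, Finset.mem_filter.2 ⟨Finset.mem_univ _,
      fun τ => (hheld τ).imp fun v hv => ⟨Finset.mem_univ v, hv⟩⟩⟩
  exact Classical.epsilon_spec (p := fun S => Hits H S ∧ ∀ S', Hits H S' → S.card ≤ S'.card)
    ⟨S, (Finset.mem_filter.1 hS).2, fun S' hS' => hmin S' (by simpa using hS')⟩

theorem allocation_spec (hheld : ∀ τ, ∃ v, τ ∈ H v) :
    (∀ u ∈ leaders H, allocation H u ⊆ H u) ∧
      ∀ τ, ∃! u, u ∈ leaders H ∧ τ ∈ allocation H u := by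
  classical
  choose f hf hfH using (leaders_spec hheld).1
  refine Classical.epsilon_spec (p := fun A : V → Finset K => (∀ u ∈ leaders H, A u ⊆ H u) ∧
    ∀ τ, ∃! u, u ∈ leaders H ∧ τ ∈ A u) ⟨fun u => Finset.univ.filter fun τ => f τ = u, ?_, ?_⟩
  · intro u _ τ hτ
    obtain rfl : f τ = u := by simpa using hτ
    exact hfH τ
  · intro τ
    refine ⟨f τ, ⟨hf τ, by simp⟩, ?_⟩
    rintro u ⟨-, hu⟩
    exact (Finset.mem_filter.1 hu).2.symm

theorem sum_card_allocation (hheld : ∀ τ, ∃ v, τ ∈ H v) (p : K → Prop) [DecidablePred p] :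
    ∑ u ∈ leaders H, ((allocation H u).filter p).card = (Finset.univ.filter p).card := by
  classical
  have h := (allocation_spec hheld).2
  have h1 : ∀ u, ((allocation H u).filter p).card =
      ∑ τ ∈ Finset.univ.filter p, if τ ∈ allocation H u then 1 else 0 := by
    intro u
    rw [← Finset.card_filter]
    congr 1
    ext τ
    simp [and_comm]
  simp only [h1]
  rw [Finset.sum_comm, Finset.card_eq_sum_ones]
  refine Finset.sum_congr rfl fun τ _ => ?_
  obtain ⟨u, hu, huniq⟩ := h τ
  rw [← Finset.card_filter, Finset.card_eq_one]
  refine ⟨u, ?_⟩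
  ext w
  simp only [Finset.mem_filter, Finset.mem_singleton]
  exact ⟨fun hw => huniq w hw, fun hw => hw ▸ hu⟩

-- Greedy set cover: if every token is held by at least `s` nodes, averaging gives a node that holds
-- an `s / n` fraction of the tokens not yet covered.
open Classical in
theorem exists_hitting_aux {s : ℕ} (hs : ∀ τ, s ≤ (holders τ H).card) (hV : Nonempty V) (m : ℕ) :
    ∃ S : Finset V, S.card ≤ m ∧
      ((Finset.univ.filter fun τ => ∀ v ∈ S, τ ∉ H v).card : ℝ) ≤
        Fintype.card K * Real.exp (-(s / Fintype.card V * m)) := by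
  classical
  induction m with
  | zero => exact ⟨∅, by simp, by simp⟩
  | succ m ih =>
    obtain ⟨S, hS, hU⟩ := ih
    set U := Finset.univ.filter fun τ => ∀ v ∈ S, τ ∉ H v with hUdef
    have hn0 : (0 : ℝ) < Fintype.card V := by exact_mod_cast Fintype.card_pos
    have hsum : s * U.card ≤ ∑ v, (U.filter fun τ => τ ∈ H v).card := by
      simp only [Finset.card_filter]
      rw [Finset.sum_comm, mul_comm]
      simp only [← Finset.card_filter]
      rw [← smul_eq_mul]
      exact Finset.card_nsmul_le_sum _ _ _ fun τ _ => by
        refine (hs τ).trans (Finset.card_le_card fun v hv => ?_)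
        simpa [mem_holders] using hv
    obtain ⟨v, -, hv⟩ := Finset.exists_max_image (Finset.univ : Finset V)
      (fun v => (U.filter fun τ => τ ∈ H v).card) Finset.univ_nonempty
    have h1 : s * U.card ≤ Fintype.card V * (U.filter fun τ => τ ∈ H v).card := by
      refine hsum.trans ((Finset.sum_le_card_nsmul _ _ _ hv).trans ?_)
      rw [smul_eq_mul, Finset.card_univ]
    have h2 := Finset.card_filter_add_card_filter_not (s := U) (fun τ => τ ∈ H v)
    refine ⟨insert v S, (Finset.card_insert_le _ _).trans (by omega), ?_⟩
    have h3 : (Finset.univ.filter fun τ => ∀ w ∈ insert v S, τ ∉ H w) =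
        U.filter fun τ => ¬ τ ∈ H v := by
      ext τ
      simp [hUdef, and_comm]
    rw [h3]
    have h1' : (s : ℝ) / Fintype.card V * U.card ≤ (U.filter fun τ => τ ∈ H v).card := by
      rw [div_mul_eq_mul_div, div_le_iff₀ hn0, mul_comm _ (Fintype.card V : ℝ)]
      exact_mod_cast h1
    have h2' : ((U.filter fun τ => τ ∈ H v).card : ℝ) + (U.filter fun τ => ¬ τ ∈ H v).card =
        U.card := by exact_mod_cast h2
    have h4 := Real.one_sub_le_exp_neg ((s : ℝ) / Fintype.card V)
    calc ((U.filter fun τ => ¬ τ ∈ H v).card : ℝ) ≤ (1 - s / Fintype.card V) * U.card := by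
          linarith
      _ ≤ Real.exp (-(s / Fintype.card V)) * U.card :=
          mul_le_mul_of_nonneg_right h4 (Nat.cast_nonneg _)
      _ ≤ Real.exp (-(s / Fintype.card V)) *
            (Fintype.card K * Real.exp (-(s / Fintype.card V * m))) :=
          mul_le_mul_of_nonneg_left hU (Real.exp_pos _).le
      _ = _ := by
        rw [mul_left_comm, ← Real.exp_add]
        congr 2
        push_cast
        ring

theorem card_leaders_le (hn : Fintype.card K = Fintype.card V) (hV : Nonempty V)
    (hs : ∀ τ, min (Fintype.card V) (⌈√(Fintype.card V)⌉₊ + 1) ≤ (holders τ H).card) :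
    (leaders H).card ≤ ⌈√(Fintype.card V) * Real.log (Fintype.card V)⌉₊ + 1 := by
  classical
  have hn0 : (0 : ℝ) < Fintype.card V := by exact_mod_cast Fintype.card_pos
  have hn1 : (1 : ℝ) ≤ Fintype.card V := by exact_mod_cast Fintype.card_pos
  have hs0 : 0 < √(Fintype.card V : ℝ) := Real.sqrt_pos.2 hn0
  have hheld : ∀ τ, ∃ v, τ ∈ H v := by
    intro τ
    have h1 : 0 < (holders τ H).card :=
      (lt_min Fintype.card_pos (Nat.succ_pos _)).trans_le (hs τ)
    obtain ⟨v, hv⟩ := Finset.card_pos.1 h1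
    exact ⟨v, mem_holders.1 hv⟩
  -- The extra `1` makes the exponent strictly larger than `log n`, so that fewer than one token
  -- remains uncovered.
  obtain ⟨S, hS, hU⟩ := exists_hitting_aux hs hV
    (⌈√(Fintype.card V) * Real.log (Fintype.card V)⌉₊ + 1)
  refine ((leaders_spec hheld).2 S fun τ => ?_).trans hS
  by_contra hτ
  push Not at hτ
  have h1 : (1 : ℝ) ≤ (Finset.univ.filter fun τ => ∀ v ∈ S, τ ∉ H v).card := by
    exact_mod_cast Finset.card_pos.2 ⟨τ, by simpa using hτ⟩
  have h2 : √(Fintype.card V : ℝ) ≤ (min (Fintype.card V) (⌈√(Fintype.card V)⌉₊ + 1) : ℕ) := by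
    rw [Nat.cast_min, le_min_iff]
    constructor
    · rw [Real.sqrt_le_left hn0.le]
      nlinarith
    · push_cast
      linarith [Nat.le_ceil √(Fintype.card V : ℝ)]
  have h3 : 1 / √(Fintype.card V : ℝ) ≤
      (min (Fintype.card V) (⌈√(Fintype.card V)⌉₊ + 1) : ℕ) / (Fintype.card V : ℝ) := by
    rw [div_le_div_iff₀ hs0 hn0, one_mul]
    calc (Fintype.card V : ℝ) = √(Fintype.card V : ℝ) * √(Fintype.card V : ℝ) :=
          (Real.mul_self_sqrt hn0.le).symm
      _ ≤ _ := mul_le_mul_of_nonneg_right h2 hs0.le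
  have h4 : Real.log (Fintype.card V) <
      (min (Fintype.card V) (⌈√(Fintype.card V)⌉₊ + 1) : ℕ) / (Fintype.card V : ℝ) *
        (⌈√(Fintype.card V) * Real.log (Fintype.card V)⌉₊ + 1 : ℕ) := by
    have h5 : √(Fintype.card V) * Real.log (Fintype.card V) <
        (⌈√(Fintype.card V) * Real.log (Fintype.card V)⌉₊ + 1 : ℕ) := by
      push_cast
      linarith [Nat.le_ceil (√(Fintype.card V) * Real.log (Fintype.card V))]
    calc Real.log (Fintype.card V) =
          1 / √(Fintype.card V) * (√(Fintype.card V) * Real.log (Fintype.card V)) := by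
          field_simp
      _ < 1 / √(Fintype.card V) *
          (⌈√(Fintype.card V) * Real.log (Fintype.card V)⌉₊ + 1 : ℕ) :=
          mul_lt_mul_of_pos_left h5 (by positivity)
      _ ≤ _ := mul_le_mul_of_nonneg_right h3 (Nat.cast_nonneg _)
  have h5 := Real.exp_lt_exp.2 (neg_lt_neg h4)
  rw [Real.exp_neg (Real.log _), Real.exp_log hn0] at h5
  rw [hn] at hU
  have h6 := mul_lt_mul_of_pos_left h5 hn0
  rw [mul_inv_cancel₀ hn0.ne'] at h6
  linarith

end Leaders

/-! ### Distribution -/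

section Distribution

variable {V K : Type} [Fintype V] [Fintype K] {G : ℕ → SimpleGraph V} {t : ℕ} {H : Holdings V K}

theorem card_filter_get {α : Type} (l : List α) (p : α → Bool) :
    (Finset.univ.filter fun y : Fin l.length => p (l.get y) = true).card = l.countP p := by
  conv_rhs => rw [← List.map_get_finRange l, List.countP_map, List.countP_eq_length_filter,
    ← List.toFinset_card_of_nodup ((List.nodup_finRange _).filter _)]
  congr 1
  ext y
  simp

theorem length_copies_le (A : Finset K) :
    (copies V A).length ≤ Fintype.card V + ⌈√(Fintype.card V)⌉₊ * A.card := by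
  simp [copies, List.length_flatMap, Finset.length_toList]
  rw [mul_comm]
  omega

theorem le_length_copies (A : Finset K) : Fintype.card V ≤ (copies V A).length := by
  simp only [copies, List.length_append, List.length_replicate]
  omega

theorem mem_of_some_mem_copies {A : Finset K} {τ : K} (h : some τ ∈ copies V A) : τ ∈ A := by
  simp only [copies, List.mem_append, List.mem_flatMap, List.mem_replicate, Finset.mem_toList,
    Option.some.injEq, reduceCtorEq, and_false, or_false] at h
  obtain ⟨τ', h1, -, rfl⟩ := h
  exact h1

theorem countP_copies (A : Finset K) (p : K → Prop) [DecidablePred p] :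
    ⌈√(Fintype.card V)⌉₊ * (A.filter p).card ≤
      (copies V A).countP fun x => x.any fun τ => decide (p τ) := by
  have h : ∀ τ : K, List.countP (fun x : Option K => x.any fun τ => decide (p τ))
      (List.replicate ⌈√(Fintype.card V)⌉₊ (some τ)) =
        if p τ then ⌈√(Fintype.card V)⌉₊ else 0 := by
    intro τ
    rw [List.countP_replicate]
    simp
  simp only [copies, List.countP_append, List.countP_flatMap]
  refine le_trans (le_of_eq ?_) (Nat.le_add_right _ _)
  rw [Function.comp_def]
  simp only [h]
  rw [Finset.sum_map_toList, ← Finset.sum_filter, Finset.sum_const, smul_eq_mul, mul_comm]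

theorem always_distribution_rounds (hG : ∀ t, (G t).Connected) (hV : Nonempty V)
    {B : V → Finset K} (l : List V) (hl : ∀ u ∈ l, B u ⊆ H u) :
    (forEach l fun u => loadBalance {u} (copies V (B u)) Finset.univ >>=
      fun _ => pure () : Protocol V K Unit).Always G t H
      (fun _ t' _ => t' = t + (l.map fun u => (copies V (B u)).length).sum) := by
  induction l generalizing t H with
  | nil => simp [forEach_nil, Protocol.Always]
  | cons u l ih =>
    rw [forEach_cons]
    refine Protocol.Always.bind (p := fun _ t' H' => t' = t + (copies V (B u)).length ∧ H ≤ H')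
      ?_ fun _ t' H' h => ?_
    · refine Protocol.Always.bind (always_loadBalance hG (Finset.singleton_nonempty u)
        Finset.univ_nonempty (by simp) (le_length_copies _) ?_) fun _ t' H' h => ⟨h.2.1, h.2.2.2.1⟩
      intro w hw τ hτ
      rw [Finset.mem_singleton.1 hw]
      exact hl u (by simp) (mem_of_some_mem_copies hτ)
    · refine (ih fun w hw => (hl w (by simp [hw])).trans (h.2 w)).mono fun _ t'' _ h' => ?_
      rw [h', h.1, List.map_cons, List.sum_cons, add_assoc]

/-- Each leader draws its own permutation, so the factors multiply. For the leader `u` with `N`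
items, the nodes of `A` have at least `|A| ⌊N / n⌋` ranks, and each token of `B u` that satisfies
`p` has `⌈√n⌉` copies. -/
theorem prob_distribution_rounds_le (hG : ∀ t, (G t).Connected) (hV : Nonempty V)
    {B : V → Finset K} (l : List V) (hl : ∀ u ∈ l, B u ⊆ H u) (A : Finset V) (p : K → Prop)
    [DecidablePred p] :
    (forEach l fun u => loadBalance {u} (copies V (B u)) Finset.univ >>=
      fun _ => pure () : Protocol V K Unit).prob G t H
      (fun _ _ H' => ∀ v ∈ A, ∀ τ, p τ → τ ∉ H' v) ≤
      ENNReal.ofReal (Real.exp (-((l.map fun u => (A.card : ℝ) * (⌈√(Fintype.card V)⌉₊ *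
        ((B u).filter p).card : ℕ) / (2 * Fintype.card V)).sum))) := by
  classical
  induction l generalizing t H with
  | nil => simpa using Protocol.prob_le_one
  | cons u l ih =>
    have hlu : ∀ w ∈ ({u} : Finset V), ∀ τ, some τ ∈ copies V (B u) → τ ∈ H w := by
      intro w hw τ hτ
      rw [Finset.mem_singleton.1 hw]
      exact hl u (by simp) (mem_of_some_mem_copies hτ)
    rw [forEach_cons, List.map_cons, List.sum_cons, neg_add, Real.exp_add,
      ENNReal.ofReal_mul (Real.exp_pos _).le]
    refine Protocol.prob_bind_le_mul (mid := fun _ _ H' => ∀ v ∈ A, ∀ τ, p τ → τ ∉ H' v) ?_ ?_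
    · set N := (copies V (B u)).length with hN
      have hNn : Fintype.card V ≤ N := le_length_copies _
      have hb := balanced_placement (t := t) (N := N) hG (Finset.singleton_nonempty u)
        Finset.univ_nonempty (by simp) (by rwa [Finset.card_univ]) N le_rfl
      refine (prob_loadBalance_bind_le hG (Finset.singleton_nonempty u)
        Finset.univ_nonempty (by simp) (le_length_copies _) hlu
        (A.biUnion (placement G {u} Finset.univ N t N))
        (Finset.univ.filter fun y => ((copies V (B u)).get y).any fun τ => decide (p τ)) ?_).trans ?_
      · rintro label H' h1 h2 h3 ⟨x, hx, y, hy, hxy⟩ hbad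
        obtain ⟨v, hv, hxv⟩ := Finset.mem_biUnion.1 hx
        have hy := (Finset.mem_filter.1 hy).2
        rw [Option.any_eq_true] at hy
        obtain ⟨τ, hτ, hp⟩ := hy
        exact hbad v hv τ (by simpa using hp) (h1 v x τ hxv (hxy.trans hτ))
      · refine ENNReal.ofReal_le_ofReal (Real.exp_le_exp.2 (neg_le_neg ?_))
        have hn0 : 0 < Fintype.card V := Fintype.card_pos
        have hD : A.card * (N / Fintype.card V) ≤
            (A.biUnion (placement G {u} Finset.univ N t N)).card := by
          rw [Finset.card_biUnion]
          · rw [← smul_eq_mul]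
            refine Finset.card_nsmul_le_sum _ _ _ fun v _ => ?_
            have := hb.le_card (Finset.mem_univ v)
            rwa [Finset.card_univ] at this
          · intro v _ v' _ hvv
            rw [Function.onFun, Finset.disjoint_left]
            exact fun x hx hx' => hvv (hb.disj v v' x hx hx')
        have hP := countP_copies (V := V) (B u) p
        rw [← card_filter_get] at hP
        -- The filling with dummies ensures `N ≥ n`, so rounding down costs at most a factor of two:
        -- the `2` in the exponent.
        have hdiv : N ≤ 2 * Fintype.card V * (N / Fintype.card V) := by
          have h1 := Nat.div_add_mod N (Fintype.card V)
          have h2 := Nat.mod_lt N hn0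
          have h3 : 1 ≤ N / Fintype.card V := Nat.div_pos hNn hn0
          nlinarith
        have hN0 : (0 : ℝ) < N := by exact_mod_cast hn0.trans_le hNn
        have hn0' : (0 : ℝ) < Fintype.card V := by exact_mod_cast hn0
        rw [div_le_div_iff₀ (by positivity) hN0]
        set d := (A.biUnion (placement G {u} Finset.univ N t N)).card
        set P := (Finset.univ.filter fun y : Fin N =>
          ((copies V (B u)).get y).any fun τ => decide (p τ)).card
        have h4 : A.card * (⌈√(Fintype.card V)⌉₊ * ((B u).filter p).card) * N ≤
            d * P * (2 * Fintype.card V) := by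
          calc _ ≤ A.card * P * (2 * Fintype.card V * (N / Fintype.card V)) := by
                gcongr
            _ = (A.card * (N / Fintype.card V)) * P * (2 * Fintype.card V) := by ring
            _ ≤ _ := by gcongr
        exact_mod_cast h4
    · refine Protocol.always_le.mono fun _ t' H' hle => ⟨fun _ => ?_, fun hm => ?_⟩
      · exact ih fun w hw => (hl w (by simp [hw])).trans (hle w)
      · refine Protocol.always_le.mono fun _ _ H'' h'' hbad => hm fun v hv τ hp hτ => ?_
        exact hbad v hv τ hp (h'' v hτ)

theorem distribution_eq : (distribution : Protocol V K Unit) = current >>= fun H =>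
    forEach (leaders H).toList fun u => loadBalance {u} (copies V (allocation H u)) Finset.univ >>=
      fun _ => pure () := rfl

theorem always_distribution (hG : ∀ t, (G t).Connected) (hV : Nonempty V)
    (hheld : ∀ τ, ∃ v, τ ∈ H v) :
    (distribution : Protocol V K Unit).Always G t H (fun _ t' _ => t' ≤ t +
      ((leaders H).card * Fintype.card V + ⌈√(Fintype.card V)⌉₊ * Fintype.card K)) := by
  classical
  rw [distribution_eq]
  refine always_current_bind ((always_distribution_rounds hG hV _ fun u hu =>
    (allocation_spec hheld).1 u (Finset.mem_toList.1 hu)).mono fun _ t' _ h => ?_)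
  rw [h, Finset.sum_map_toList]
  refine Nat.add_le_add_left ((Finset.sum_le_sum fun u _ => length_copies_le _).trans ?_) _
  rw [Finset.sum_add_distrib, Finset.sum_const, smul_eq_mul, ← Finset.mul_sum]
  have := sum_card_allocation hheld (fun _ => True)
  simp only [Finset.filter_true, Finset.card_univ] at this
  rw [this]

/-- Every token is allocated to exactly one leader, so for sets of size `a` the exponents add up to
at least `a √n a / (2 n) = a² / (2 √n)`. It is enough to treat sets of size exactly `a`, and there
are at most `n ^ (2 a)` pairs of them. -/
theorem prob_distribution_le (hG : ∀ t, (G t).Connected) (hV : Nonempty V)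
    (hheld : ∀ τ, ∃ v, τ ∈ H v) (hn : Fintype.card K = Fintype.card V) (a : ℕ) :
    (distribution : Protocol V K Unit).prob G t H (fun _ _ H' => ¬ Expands a H') ≤
      ENNReal.ofReal ((Fintype.card V : ℝ) ^ (2 * a) *
        Real.exp (-((a : ℝ) ^ 2 / (2 * √(Fintype.card V))))) := by
  classical
  rw [distribution_eq, prob_current_bind]
  refine (Protocol.Always.prob_mono (q := fun _ _ H' => ∃ e ∈ Finset.powersetCard a Finset.univ ×ˢ
    Finset.powersetCard a Finset.univ, ∀ v ∈ e.1, ∀ τ, τ ∈ e.2 → τ ∉ H' v)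
    (Protocol.always_of_forall fun _ _ H' => ?_)).trans ((Protocol.prob_exists_le _).trans ?_)
  · intro hbad
    by_contra hall
    push Not at hall
    refine hbad fun A M hA hM => ?_
    obtain ⟨A', hA', hAc⟩ := Finset.exists_subset_card_eq hA
    obtain ⟨M', hM', hMc⟩ := Finset.exists_subset_card_eq hM
    obtain ⟨v, hv, τ, hτ, h⟩ := hall (A', M') (by simp [hAc, hMc])
    exact ⟨v, hA' hv, τ, hM' hτ, h⟩
  · have hn0 : (0 : ℝ) < Fintype.card V := by exact_mod_cast Fintype.card_pos
    have hs0 : 0 < √(Fintype.card V : ℝ) := Real.sqrt_pos.2 hn0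
    refine (Finset.sum_le_card_nsmul _ _ (ENNReal.ofReal
      (Real.exp (-((a : ℝ) ^ 2 / (2 * √(Fintype.card V)))))) ?_).trans ?_
    · rintro ⟨A, M⟩ he
      obtain ⟨hA, hM⟩ := Finset.mem_product.1 he
      have hA := (Finset.mem_powersetCard.1 hA).2
      have hM := (Finset.mem_powersetCard.1 hM).2
      refine (prob_distribution_rounds_le hG hV _ (fun u hu =>
        (allocation_spec hheld).1 u (Finset.mem_toList.1 hu)) A (· ∈ M)).trans ?_
      refine ENNReal.ofReal_le_ofReal (Real.exp_le_exp.2 (neg_le_neg ?_))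
      dsimp only at hA hM
      rw [Finset.sum_map_toList, ← Finset.sum_div, ← Finset.mul_sum, ← Nat.cast_sum,
        ← Finset.mul_sum, sum_card_allocation hheld, hA, Finset.filter_mem_eq_inter,
        Finset.univ_inter, hM, div_le_div_iff₀ (by positivity) (by positivity)]
      have h1 := Nat.le_ceil √(Fintype.card V : ℝ)
      have h2 := Real.mul_self_sqrt hn0.le
      push_cast
      calc (a : ℝ) ^ 2 * (2 * Fintype.card V) =
            a * (√(Fintype.card V) * a) * (2 * √(Fintype.card V)) := by
            rw [← h2]; simp only [Real.sqrt_mul_self hs0.le]; ring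
        _ ≤ _ := by gcongr
    · rw [nsmul_eq_mul, ← ENNReal.ofReal_natCast, ← ENNReal.ofReal_mul (by positivity)]
      refine ENNReal.ofReal_le_ofReal (mul_le_mul_of_nonneg_right ?_ (Real.exp_pos _).le)
      rw [Finset.card_product, Finset.card_powersetCard, Finset.card_powersetCard,
        Finset.card_univ, Finset.card_univ, hn, two_mul, pow_add]
      have := Nat.choose_le_pow (Fintype.card V) a
      exact_mod_cast Nat.mul_le_mul this this

end Distribution

/-! ### The algorithm for `n`-gossip -/

section NGossip

variable {V K : Type} [Fintype V] [Fintype K] {G : ℕ → SimpleGraph V} {t : ℕ} {H : Holdings V K}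

theorem nGossip_eq (κ φ σ : ℝ) : nGossip V K κ φ σ = consolidation >>= fun _ =>
    distribution >>= fun _ => exchange κ φ σ := rfl

theorem prob_nGossip_le (hG : ∀ t, (G t).Connected) (hn : Fintype.card K = Fintype.card V)
    (hheld : ∀ τ, ∃ v, τ ∈ H v) {κ φ σ : ℝ} {a k m : ℕ}
    (ha : 2 * (a : ℝ) ≤ κ * √(Fintype.card V) * Real.log (Fintype.card V))
    (ha' : Fintype.card V ≤ 2 * a ^ 2)
    (hk : k = ⌈σ * Real.log (Fintype.card V)⌉₊)
    (hm : m = ⌈φ * √(Fintype.card V) * Real.log (Fintype.card V)⌉₊)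
    (hk' : 31 ^ k * Fintype.card V < 32 ^ k) {δ ε : ℝ} (hδ : (Fintype.card V : ℝ) ^ 2 *
      Real.exp (-(m * √(Fintype.card V) / 192 / Fintype.card V)) ≤ δ)
    (hε : (Fintype.card V : ℝ) ^ (2 * a) *
        Real.exp (-((a : ℝ) ^ 2 / (2 * √(Fintype.card V)))) ≤ ε) :
    (nGossip V K κ φ σ).prob G t H (fun _ t' H' => ¬ ((∀ v, H' v = Finset.univ) ∧
      (t' : ℝ) ≤ t + Fintype.card V * (2 * ⌈√(Fintype.card V)⌉₊ +
        (⌈√(Fintype.card V) * Real.log (Fintype.card V)⌉₊ + 1) + 2 * a + 2 * k * m +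
        κ * √(Fintype.card V) * Real.log (Fintype.card V)))) ≤
      ENNReal.ofReal (ε + k * δ) := by
  have hV : Nonempty V := (hG 0).nonempty
  have hδ0 : 0 ≤ δ := le_trans (by positivity) hδ
  have hε0 : 0 ≤ ε := le_trans (by positivity) hε
  rw [nGossip_eq, ← zero_add (ENNReal.ofReal _)]
  refine Protocol.prob_bind_le (mid := fun _ _ _ => False)
    (Protocol.Always.prob_eq_zero (Protocol.always_of_forall fun _ _ _ => not_false)).le ?_
  have hcons : (consolidation : Protocol V K Unit).Always G t H _ :=
    always_forEach_flood hG ⌈√(Fintype.card V)⌉₊ (Finset.univ : Finset K).toList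
      fun τ _ => hheld τ
  refine (hcons.and Protocol.always_le).mono fun _ t₁ H₁ h₁ _ => ?_
  obtain ⟨⟨ht₁, hh⟩, hle₁⟩ := h₁
  rw [Finset.length_toList, Finset.card_univ, hn] at ht₁
  have hheld₁ : ∀ τ, ∃ v, τ ∈ H₁ v := fun τ => (hheld τ).imp fun v hv => hle₁ v hv
  have hlead := card_leaders_le hn hV fun τ => hh τ (by simp)
  rw [ENNReal.ofReal_add hε0 (by positivity)]
  refine Protocol.prob_bind_le ((prob_distribution_le hG hV hheld₁ hn a).trans
    (ENNReal.ofReal_le_ofReal hε)) ?_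
  refine ((always_distribution hG hV hheld₁).and Protocol.always_le).mono
    fun _ t₂ H₂ h₂ hexp => ?_
  obtain ⟨ht₂, hle₂⟩ := h₂
  rw [not_not] at hexp
  refine le_trans (Protocol.Always.prob_mono (Protocol.always_of_forall fun _ t₃ H₃ => ?_))
    (prob_exchange_le (t := t₂) hG hn hexp ha ha'
      (fun τ => (hheld₁ τ).imp fun v hv => hle₂ v hv) hk hm hk' hδ)
  refine mt fun h => ⟨h.1, h.2.trans ?_⟩
  have h1 : t₂ ≤ t + Fintype.card V * ⌈√(Fintype.card V)⌉₊ +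
      ((⌈√(Fintype.card V) * Real.log (Fintype.card V)⌉₊ + 1) * Fintype.card V +
        ⌈√(Fintype.card V)⌉₊ * Fintype.card V) := by
    rw [hn] at ht₂
    have := Nat.mul_le_mul_right (Fintype.card V) hlead
    omega
  have h2 : (t₂ : ℝ) ≤ t + Fintype.card V * ⌈√(Fintype.card V)⌉₊ +
      ((⌈√(Fintype.card V) * Real.log (Fintype.card V)⌉₊ + 1) * Fintype.card V +
        ⌈√(Fintype.card V)⌉₊ * Fintype.card V) := by exact_mod_cast h1
  linarith

theorem pow_mul_lt_pow {n : ℕ} (hn : 0 < n) {k : ℕ} (hk : 32 * Real.log n < k) :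
    31 ^ k * n < 32 ^ k := by
  have hn' : (0 : ℝ) < n := by exact_mod_cast hn
  have h1 : (31 / 32 : ℝ) ^ k ≤ Real.exp (-(k / 32)) := by
    calc (31 / 32 : ℝ) ^ k ≤ Real.exp (-(1 / 32)) ^ k := by
          refine pow_le_pow_left₀ (by norm_num) ?_ _
          have := Real.one_sub_le_exp_neg (1 / 32)
          linarith
      _ = _ := by
        rw [← Real.exp_nat_mul]
        congr 1
        ring
  have h2 : Real.exp (-(k / 32)) < (n : ℝ)⁻¹ := by
    rw [← Real.exp_log hn', ← Real.exp_neg]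
    exact Real.exp_lt_exp.2 (by linarith)
  have h3 := h1.trans_lt h2
  rw [div_pow, div_lt_iff₀ (by positivity), inv_mul_eq_div, lt_div_iff₀ hn'] at h3
  exact_mod_cast h3

theorem time_bound {c s L n : ℝ} {a k m : ℕ} (hc : 0 < c) (hn0 : 0 < n) (hs1 : 1 ≤ s)
    (hL1 : 1 / 2 ≤ L) (ha2 : (a : ℝ) ≤ (2 * c + 6) * (s * L) + 1) (hk2 : (k : ℝ) ≤ 33 * L + 1)
    (hm2 : (m : ℝ) ≤ 192 * (c + 10) * s * L + 1) :
    n * (2 * ⌈s⌉₊ + (⌈s * L⌉₊ + 1) + 2 * a + 2 * k * m + 2 * (2 * c + 8) * s * L) ≤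
      (8 + 10 + 8 + 4 * (2 * c + 6) + 8 + 70 * (192 * (c + 10) + 2) + 2 * (2 * (2 * c + 8))) *
        (n * s * L ^ 2) := by
  have hsL : 1 / 2 ≤ s * L := by nlinarith
  have hc1 : (⌈s⌉₊ : ℝ) ≤ s + 1 := (Nat.ceil_lt_add_one (by positivity)).le
  have hc2 : (⌈s * L⌉₊ : ℝ) ≤ s * L + 1 := (Nat.ceil_lt_add_one (by positivity)).le
  obtain ⟨X, hX⟩ : ∃ X, X = s * L ^ 2 := ⟨_, rfl⟩
  have hX3 : s * L ≤ 2 * X := by rw [hX]; nlinarith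
  have hX1 : 1 ≤ 4 * X := by linarith
  have hX2 : s ≤ 4 * X := by rw [hX]; nlinarith
  have hkm : 2 * (k : ℝ) * m ≤ 70 * (192 * (c + 10) + 2) * X := by
    have h3 : (k : ℝ) ≤ 35 * L := by linarith
    have h4 : (m : ℝ) ≤ (192 * (c + 10) + 2) * (s * L) := by linarith
    calc 2 * (k : ℝ) * m ≤ 2 * (35 * L) * ((192 * (c + 10) + 2) * (s * L)) := by gcongr
      _ = _ := by rw [hX]; ring
  rw [mul_assoc n, mul_left_comm, ← hX]
  refine mul_le_mul_of_nonneg_left ?_ hn0.le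
  have h5 : (2 * c + 6) * (s * L) ≤ (2 * c + 6) * (2 * X) := by gcongr
  have h6 : 2 * (2 * c + 8) * (s * L) ≤ 2 * (2 * c + 8) * (2 * X) := by gcongr
  rw [mul_assoc _ s L]
  linarith

/-- Each summand is at most half of `n ^ (-c)`: the first since `n ≥ 2`, the second since `66 n³ ≤ n
^ 10`. -/
theorem failure_bound {c L n k : ℝ} (hn2 : 2 ≤ n) (hL : L = Real.log n)
    (hk : k ≤ 33 * n) :
    Real.exp (-((c + 1) * L)) + k * (n ^ 2 * Real.exp (-((c + 10) * L))) ≤ 1 / n ^ c := by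
  have hn0 : 0 < n := by linarith
  have hexpL : Real.exp L = n := by rw [hL, Real.exp_log hn0]
  have h3 : n ^ c = Real.exp (c * L) := by
    rw [Real.rpow_def_of_pos hn0, ← hL, mul_comm]
  rw [h3, one_div, ← Real.exp_neg]
  have h4 : Real.exp (-((c + 1) * L)) = Real.exp (-(c * L)) / n := by
    rw [← hexpL, ← Real.exp_sub]
    congr 1
    ring
  have h5 : Real.exp (-((c + 10) * L)) = Real.exp (-(c * L)) / n ^ 10 := by
    rw [← hexpL, ← Real.exp_nat_mul, ← Real.exp_sub]
    congr 1
    push_cast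
    ring
  rw [h4, h5]
  have hE := Real.exp_pos (-(c * L))
  have h6 : k * (n ^ 2 * (Real.exp (-(c * L)) / n ^ 10)) ≤ Real.exp (-(c * L)) / 2 := by
    rw [← mul_div_assoc, ← mul_div_assoc, div_le_div_iff₀ (by positivity) (by norm_num)]
    have h7 := hk
    have h8 : (2 : ℝ) ^ 7 ≤ n ^ 7 := pow_le_pow_left₀ (by norm_num) hn2 7
    calc k * (n ^ 2 * Real.exp (-(c * L))) * 2
        ≤ 33 * n * (n ^ 2 * Real.exp (-(c * L))) * 2 := by gcongr
      _ = Real.exp (-(c * L)) * n ^ 3 * 66 := by ring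
      _ ≤ Real.exp (-(c * L)) * n ^ 3 * n ^ 7 := by gcongr; linarith
      _ = _ := by ring
  have h7 : Real.exp (-(c * L)) / n ≤ Real.exp (-(c * L)) / 2 := by gcongr
  linarith

/-- The starting time and token sets are arbitrary because `k`-gossip restarts the algorithm many
times. -/
theorem exists_constants (c : ℝ) (hc : 0 < c) : ∃ κ φ σ C : ℝ, 0 < κ ∧ 0 < φ ∧ 0 < σ ∧ 0 < C ∧
    ∀ (V K : Type) [Fintype V] [Fintype K], 2 ≤ Fintype.card V →
    Fintype.card K = Fintype.card V →
    ∀ G : ℕ → SimpleGraph V, (∀ t, (G t).Connected) → ∀ (t : ℕ) (H : Holdings V K),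
    (∀ τ, ∃ v, τ ∈ H v) →
    (nGossip V K κ φ σ).prob G t H (fun _ t' H' => ¬ ((∀ v, H' v = Finset.univ) ∧
      (t' : ℝ) ≤ t + C * ((Fintype.card V : ℝ) * √(Fintype.card V) *
        Real.log (Fintype.card V) ^ 2))) ≤
      ENNReal.ofReal (1 / (Fintype.card V : ℝ) ^ c) := by
  -- With `a = ⌈(2 c + 6) √n log n⌉`, `a² / (2 √n)` is at least `(c + 3) a log n`, which beats the
  -- `n ^ (2 a)` pairs and leaves `n ^ (-(c + 1))`. The value of `κ` gives `2 a ≤ κ √n log n`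
  -- including rounding, as `√n log n ≥ 1/2`. The factor `192` in `φ` cancels the one of
  -- `exists_good`, and `33` exceeds the `32` required by `pow_mul_lt_pow`.
  refine ⟨2 * (2 * c + 8), 192 * (c + 10), 33, 8 + 10 + 8 + 4 * (2 * c + 6) + 8 +
    70 * (192 * (c + 10) + 2) + 2 * (2 * (2 * c + 8)), by positivity, by positivity, by norm_num,
    by positivity, ?_⟩
  intro V K _ _ h2 hn G hG t H hheld
  obtain ⟨n, hndef⟩ : ∃ n, n = Fintype.card V := ⟨_, rfl⟩
  obtain ⟨s, hs⟩ : ∃ s, s = √(n : ℝ) := ⟨_, rfl⟩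
  obtain ⟨L, hL⟩ : ∃ L, L = Real.log n := ⟨_, rfl⟩
  rw [← hndef] at h2
  have hn2 : (2 : ℝ) ≤ n := by exact_mod_cast h2
  have hn0 : (0 : ℝ) < n := by linarith
  have hss : s * s = n := by rw [hs]; exact Real.mul_self_sqrt hn0.le
  have hs1 : 1 ≤ s := by
    rw [hs, Real.one_le_sqrt]
    linarith
  have hL1 : 1 / 2 ≤ L := by
    have h3 := Real.log_le_log (by norm_num) hn2
    have h4 := Real.log_two_gt_d9
    rw [hL]
    linarith
  have hLn : L ≤ n - 1 := hL ▸ Real.log_le_sub_one_of_pos hn0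
  have hexpL : Real.exp L = n := by rw [hL, Real.exp_log hn0]
  have hsL : 1 / 2 ≤ s * L := by nlinarith
  obtain ⟨a, ha⟩ : ∃ a, a = ⌈(2 * c + 6) * (s * L)⌉₊ := ⟨_, rfl⟩
  obtain ⟨k, hk⟩ : ∃ k, k = ⌈33 * L⌉₊ := ⟨_, rfl⟩
  obtain ⟨m, hm⟩ : ∃ m, m = ⌈192 * (c + 10) * s * L⌉₊ := ⟨_, rfl⟩
  have ha1 : (2 * c + 6) * (s * L) ≤ a := ha ▸ Nat.le_ceil _
  have ha2 : (a : ℝ) ≤ (2 * c + 6) * (s * L) + 1 :=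
    ha ▸ (Nat.ceil_lt_add_one (by positivity)).le
  have hk1 : 33 * L ≤ k := hk ▸ Nat.le_ceil _
  have hk2 : (k : ℝ) ≤ 33 * L + 1 := hk ▸ (Nat.ceil_lt_add_one (by positivity)).le
  have hm1 : 192 * (c + 10) * s * L ≤ m := hm ▸ Nat.le_ceil _
  have hm2 : (m : ℝ) ≤ 192 * (c + 10) * s * L + 1 :=
    hm ▸ (Nat.ceil_lt_add_one (by positivity)).le
  have has : s ≤ a := by nlinarith
  have hag1 : 1 ≤ (a : ℝ) := hs1.trans has
  have hcL : 0 < c * L := by positivity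
  have key := prob_nGossip_le (t := t) (κ := 2 * (2 * c + 8)) (φ := 192 * (c + 10)) (σ := 33)
    (a := a) (k := k) (m := m) (δ := n ^ 2 * Real.exp (-((c + 10) * L)))
    (ε := Real.exp (-((c + 1) * L))) hG hn hheld
    (by
      rw [← hndef, ← hs, ← hL]
      nlinarith)
    (by
      rw [← hndef]
      have : (n : ℝ) ≤ 2 * a ^ 2 := by nlinarith
      exact_mod_cast this)
    (by rw [← hndef, ← hL]; exact hk) (by rw [← hndef, ← hL, ← hs]; exact hm)
    (by
      rw [← hndef]
      exact pow_mul_lt_pow (by omega) (by rw [← hL]; linarith))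
    (by
      rw [← hndef, ← hs]
      refine mul_le_mul_of_nonneg_left (Real.exp_le_exp.2 (neg_le_neg ?_)) (by positivity)
      rw [le_div_iff₀ hn0, le_div_iff₀ (by norm_num), ← hss]
      calc (c + 10) * L * (s * s) * 192 = 192 * (c + 10) * s * L * s := by ring
        _ ≤ _ := mul_le_mul_of_nonneg_right hm1 (by linarith))
    (by
      rw [← hndef, ← hs, ← hexpL, ← Real.exp_nat_mul, ← Real.exp_add]
      refine Real.exp_le_exp.2 ?_
      have h3 : (a : ℝ) * ((c + 3) * L) ≤ a ^ 2 / (2 * s) := by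
        rw [le_div_iff₀ (by positivity)]
        nlinarith
      push_cast
      have h4 : (c + 1) * L ≤ a * ((c + 1) * L) := le_mul_of_one_le_left (by positivity) hag1
      linarith)
  rw [← hndef, ← hs, ← hL] at key ⊢
  refine (Protocol.Always.prob_mono (Protocol.always_of_forall fun _ t' H' => ?_)).trans
    (key.trans (ENNReal.ofReal_le_ofReal ?_))
  · exact mt fun h => ⟨h.1, h.2.trans
      (add_le_add_right (time_bound hc hn0 hs1 hL1 ha2 hk2 hm2) _)⟩
  · exact failure_bound hn2 hL (by linarith)

end NGossip

/-! ### Simulation of an algorithm on other tokens -/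

section Simulation

variable {V K K' : Type} [Fintype K] [Fintype K'] {G : ℕ → SimpleGraph V} {t : ℕ}

/-- Run `A` for at most `B` rounds from the virtual token sets `H`. The virtual token `x` stands for
the token `e x` and is a dummy if `e x = none`. -/
noncomputable def Protocol.simulate (e : K → Option K') (A : Protocol V K Unit) (B : ℕ)
    (H : Holdings V K) : Protocol V K' Unit :=
  match A with
  | .halt _ => .halt ()
  | .look next => (next H).simulate e B H
  | .toss p next => .toss p fun x => (next x).simulate e B H
  | .round send next =>
    match B with
    | 0 => .halt ()
    | B + 1 => .round (fun G u v => (send G u v).bind e)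
        fun G => (next G).simulate e B (deliver G (send G) H)

theorem Protocol.always_time_le {α : Type} {A : Protocol V K α} {H : Holdings V K} :
    A.Always G t H (fun _ t' _ => t ≤ t') := by
  induction A generalizing t H with
  | halt a => exact le_rfl
  | look next ih => exact ih H
  | toss p next ih => exact fun x => ih x
  | round send next ih =>
    exact (ih (G t) (t := t + 1)).mono fun _ _ _ h => (Nat.le_succ t).trans h

theorem Protocol.always_simulate_time (e : K → Option K') (A : Protocol V K Unit) (B : ℕ)
    (Hv : Holdings V K) (H : Holdings V K') :
    (A.simulate e B Hv).Always G t H (fun _ t' _ => t' ≤ t + B) := by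
  induction A generalizing t Hv H B with
  | halt a => exact Nat.le_add_right _ _
  | look next ih => exact ih Hv B Hv H
  | toss p next ih => exact fun x => ih x B Hv H
  | round send next ih =>
    cases B with
    | zero => exact Nat.le_add_right _ _
    | succ B =>
      refine (ih (G t) (t := t + 1) B (deliver (G t) (send (G t)) Hv) _).mono
        fun _ t' _ h => ?_
      omega

theorem Protocol.Always.one_le_prob {α : Type} {A : Protocol V K α} {H : Holdings V K}
    {p : α → ℕ → Holdings V K → Prop} (h : A.Always G t H p) : 1 ≤ A.prob G t H p := by
  rw [← Protocol.ew_const (A := A) (G := G) (t := t) (H := H) 1]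
  exact Protocol.Always.ew_mono (h.mono fun a t' H' h => by simp [h])

theorem Labelled.deliver {e : K → Option K'} {Hv : Holdings V K} {H : Holdings V K'}
    (h : Labelled e Hv H) (G : SimpleGraph V) (s : Sends V K) :
    Labelled e (deliver G s Hv) (Gossip.deliver G (fun u v => (s u v).bind e) H) := by
  classical
  intro v x y hx hy
  simp only [Gossip.deliver, Finset.mem_filter, Finset.mem_univ, true_and] at hx ⊢
  rcases hx with hx | ⟨u, hadj, hxu, hs⟩
  · exact Or.inl (h v x y hx hy)
  · exact Or.inr ⟨u, hadj, h u x y hxu hy, by rw [hs]; exact hy⟩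

/-- The simulation and `A` share coins and networks, and virtual possession always implies real
possession. Truncation only affects runs that need more than `B` rounds, and these count as failures
on the right. -/
theorem Protocol.prob_simulate_le (e : K → Option K') (A : Protocol V K Unit) (B : ℕ)
    {Hv : Holdings V K} {H : Holdings V K'} (h : Labelled e Hv H) :
    (A.simulate e B Hv).prob G t H (fun _ _ H' => ¬ ∀ v x y, e x = some y → y ∈ H' v) ≤
      A.prob G t Hv (fun _ t' H' => ¬ ((∀ v, H' v = Finset.univ) ∧ t' ≤ t + B)) := by
  classical
  induction A generalizing t Hv H B with
  | halt a =>
    by_cases hc : ∀ v, Hv v = Finset.univ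
    · refine (Protocol.Always.prob_eq_zero (A := .halt ()) ?_).le.trans bot_le
      show ¬¬_
      rw [not_not]
      exact fun v x y hxy => h v x y (hc v ▸ Finset.mem_univ x) hxy
    · exact Protocol.prob_le_one.trans (Protocol.Always.one_le_prob fun h => hc h.1)
  | look next ih => exact ih Hv B h
  | toss p next ih => exact ENNReal.tsum_le_tsum fun x => mul_le_mul_right (ih x B h) _
  | round send next ih =>
    cases B with
    | zero =>
      refine Protocol.prob_le_one.trans (Protocol.Always.one_le_prob ?_)
      refine Protocol.Always.mono (Protocol.always_time_le (A := next (G t)) (t := t + 1))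
        fun _ t' _ h => ?_
      omega
    | succ B =>
      refine (ih (G t) (t := t + 1) B (h.deliver (G t) (send (G t)))).trans ?_
      refine Protocol.Always.prob_mono (Protocol.always_of_forall fun _ t' H' => ?_)
      refine mt fun h => ⟨h.1, ?_⟩
      omega

end Simulation

/-! ### `k`-gossip -/

section KGossip

variable {V K K' : Type} [Fintype V] [Fintype K'] {G : ℕ → SimpleGraph V} {t : ℕ}
  {H : Holdings V K'}

open Classical in
/-- The tokens that some node lacks. -/
noncomputable def incomplete (H : Holdings V K') : Finset K' :=
  Finset.univ.filter fun τ => ∃ v, τ ∉ H v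

theorem incomplete_anti {H H' : Holdings V K'} (h : H ≤ H') : incomplete H' ⊆ incomplete H := by
  intro τ hτ
  simp only [incomplete, Finset.mem_filter, Finset.mem_univ, true_and] at hτ ⊢
  exact hτ.imp fun v hv hv' => hv (h v hv')

/-- The first `n` incomplete tokens. -/
noncomputable def selection (n : ℕ) (H : Holdings V K') : Fin n → Option K' :=
  fun x => (incomplete H).toList[x.val]?

open Classical in
/-- The virtual token sets; every node holds all dummies. -/
noncomputable def virtual {n : ℕ} (e : Fin n → Option K') (H : Holdings V K') :
    Holdings V (Fin n) :=
  fun v => Finset.univ.filter fun x => ∀ y, e x = some y → y ∈ H v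

/-- Run `A`, an algorithm for `n` tokens, on `n` incomplete tokens for at most `B` rounds. -/
noncomputable def trial {n : ℕ} (A : Protocol V (Fin n) Unit) (B : ℕ) : Protocol V K' Unit :=
  current >>= fun H => A.simulate (selection n H) B (virtual (selection n H) H)

variable {n : ℕ} {A : Protocol V (Fin n) Unit} {B : ℕ} {p : ℝ≥0∞}

theorem always_trial : (trial A B).Always G t H (fun _ t' _ => t' ≤ t + B) :=
  Protocol.always_simulate_time _ A B _ H

theorem card_incomplete_le {H' : Holdings V K'} (hle : H ≤ H')
    (h : ∀ v x y, selection n H x = some y → y ∈ H' v) :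
    (incomplete H').card ≤ (incomplete H).card - n := by
  classical
  have hsub : incomplete H' ⊆ ((incomplete H).toList.drop n).toFinset := by
    intro τ hτ
    have hτ' := incomplete_anti hle hτ
    rw [← Finset.mem_toList, ← List.take_append_drop n (incomplete H).toList,
      List.mem_append] at hτ'
    rcases hτ' with hτ' | hτ'
    · obtain ⟨i, hi, hiτ⟩ := List.mem_iff_getElem.1 hτ'
      rw [List.length_take] at hi
      rw [List.getElem_take] at hiτ
      simp only [incomplete, Finset.mem_filter, Finset.mem_univ, true_and] at hτ
      obtain ⟨v, hv⟩ := hτ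
      exact absurd (h v ⟨i, by omega⟩ τ
        (by rw [selection, ← hiτ]; exact List.getElem?_eq_getElem _)) hv
    · exact List.mem_toFinset.2 hτ'
  refine (Finset.card_le_card hsub).trans ((List.toFinset_card_le _).trans ?_)
  rw [List.length_drop, Finset.length_toList]

/-- The virtual instance is a legal start of `A`: a selected token is held by some node, and dummies
are held by all. A successful run completes every selected token, that is `n` of them or all that
were left. -/
theorem prob_trial_le [Nonempty V]
    (hA : ∀ (t : ℕ) (H : Holdings V (Fin n)), (∀ τ, ∃ v, τ ∈ H v) →
      A.prob G t H (fun _ t' H' => ¬ ((∀ v, H' v = Finset.univ) ∧ t' ≤ t + B)) ≤ p)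
    (hheld : ∀ τ, ∃ v, τ ∈ H v) :
    (trial A B).prob G t H
      (fun _ _ H' => ¬ (incomplete H').card ≤ (incomplete H).card - n) ≤ p := by
  classical
  rw [trial, prob_current_bind]
  refine le_trans (Protocol.Always.prob_mono (Protocol.always_le.mono fun _ _ H' hle =>
    mt (card_incomplete_le hle))) ((Protocol.prob_simulate_le (selection n H) A B ?_).trans
      (hA t _ ?_))
  · intro v x y hx hy
    exact (Finset.mem_filter.1 hx).2 y hy
  · intro x
    rcases hx : selection n H x with _ | y
    · exact ⟨Classical.arbitrary V, by simp [virtual, hx]⟩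
    · obtain ⟨v, hv⟩ := hheld y
      refine ⟨v, ?_⟩
      simp only [virtual, hx, Finset.mem_filter, Finset.mem_univ, true_and, Option.some.injEq]
      rintro _ rfl
      exact hv

theorem Protocol.prob_bind_le_mul_add {K α β : Type} [Fintype K] {H : Holdings V K}
    {A : Protocol V K α} {B : α → Protocol V K β} {bad : β → ℕ → Holdings V K → Prop}
    {mid : α → ℕ → Holdings V K → Prop} {ε X Y : ℝ≥0∞} (h : A.prob G t H mid ≤ ε)
    (hB : A.Always G t H (fun a t' H' => (B a).prob G t' H' bad ≤ X ∧
      (¬ mid a t' H' → (B a).prob G t' H' bad ≤ Y))) :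
    (A >>= B).prob G t H bad ≤ ε * X + Y := by
  classical
  have key := Protocol.Always.ew_mono (A := A) (G := G) (t := t) (H := H)
    (f := fun a t' H' => (B a).prob G t' H' bad)
    (g := fun a t' H' => (if mid a t' H' then 1 else 0) * X + Y) (hB.mono fun a t' H' h => by
      by_cases hm : mid a t' H'
      · simpa [hm] using h.1.trans le_self_add
      · simpa [hm] using h.2 hm)
  rw [Protocol.ew_add, Protocol.ew_const, Protocol.ew_mul_const] at key
  unfold Protocol.prob at *
  rw [Protocol.ew_bind]
  exact key.trans (add_le_add_left (mul_le_mul_left h _) _)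

/-- If `g` successes are enough, incompleteness after `m` trials needs at least `m + 1 - g`
failures; `2 ^ m` bounds the number of patterns. The induction splits on the first trial: a failure
costs a factor `p`, a success lowers `g` by one. -/
theorem prob_repeat_trial_le [Nonempty V]
    (hA : ∀ (t : ℕ) (H : Holdings V (Fin n)), (∀ τ, ∃ v, τ ∈ H v) →
      A.prob G t H (fun _ t' H' => ¬ ((∀ v, H' v = Finset.univ) ∧ t' ≤ t + B)) ≤ p)
    (hheld : ∀ τ, ∃ v, τ ∈ H v) (m g : ℕ) (hg : (incomplete H).card ≤ g * n) :
    (repeatTimes m (trial A B)).prob G t H (fun _ _ H' => ¬ (incomplete H').card = 0) ≤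
      2 ^ m * p ^ (m + 1 - g) := by
  induction m generalizing t H g with
  | zero =>
    rcases Nat.eq_zero_or_pos g with rfl | hg0
    · refine (Protocol.Always.prob_eq_zero ?_).le.trans bot_le
      show ¬¬_
      rw [not_not]
      omega
    · rw [show 0 + 1 - g = 0 by omega]
      simpa using Protocol.prob_le_one
  | succ m ih =>
    rcases Nat.eq_zero_or_pos g with rfl | hg0
    · refine (Protocol.Always.prob_eq_zero (Protocol.always_le.mono fun _ _ H' hle => ?_)).le.trans
        bot_le
      have := Finset.card_le_card (incomplete_anti hle)
      omega
    rcases le_or_gt g (m + 1) with hgm | hgm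
    · rw [repeatTimes_succ]
      refine (Protocol.prob_bind_le_mul_add (X := 2 ^ m * p ^ (m + 1 - g))
        (Y := 2 ^ m * p ^ (m + 1 - (g - 1))) (prob_trial_le hA hheld)
        (Protocol.always_le.mono fun _ t' H' hle => ⟨?_, fun hm => ?_⟩)).trans (le_of_eq ?_)
      · exact ih (fun τ => (hheld τ).imp fun v hv => hle v hv) g
          ((Finset.card_le_card (incomplete_anti hle)).trans hg)
      · refine ih (fun τ => (hheld τ).imp fun v hv => hle v hv) (g - 1) ?_
        rw [not_not] at hm
        rw [Nat.sub_mul, one_mul]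
        omega
      · rw [show m + 1 - (g - 1) = m + 1 - g + 1 by omega,
          show m + 1 + 1 - g = m + 1 - g + 1 by omega]
        ring
    -- Too few trials for `g` successes: the truncated exponent is `0` and the bound is trivial.
    · rw [show m + 1 + 1 - g = 0 by omega, pow_zero, mul_one]
      exact Protocol.prob_le_one.trans (one_le_pow₀ one_le_two)

theorem always_repeat_trial (m : ℕ) : (repeatTimes m (trial A B)).Always G t H
    (fun _ t' _ => t' ≤ t + m * B) := by
  induction m generalizing t H with
  | zero => simp [repeatTimes_zero, Protocol.Always]
  | succ m ih =>
    rw [repeatTimes_succ]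
    refine Protocol.Always.bind always_trial fun _ t' H' h => ?_
    refine ih.mono fun _ t'' _ h' => ?_
    rw [add_mul, one_mul]
    omega

theorem eq_univ_of_incomplete (h : (incomplete H).card = 0) (v : V) : H v = Finset.univ := by
  refine Finset.eq_univ_iff_forall.2 fun τ => ?_
  by_contra hτ
  have hmem : τ ∈ incomplete H := by
    simp only [incomplete, Finset.mem_filter, Finset.mem_univ, true_and]
    exact ⟨v, hτ⟩
  exact absurd (Finset.card_pos.2 ⟨τ, hmem⟩) (by omega)

theorem prob_repeat_trial_two_mul_le [Nonempty V] (hp : 4 * p ≤ 1)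
    (hA : ∀ (t : ℕ) (H : Holdings V (Fin n)), (∀ τ, ∃ v, τ ∈ H v) →
      A.prob G t H (fun _ t' H' => ¬ ((∀ v, H' v = Finset.univ) ∧ t' ≤ t + B)) ≤ p)
    (hheld : ∀ τ, ∃ v, τ ∈ H v) (g : ℕ) (hg : (incomplete H).card ≤ g * n) {T : ℝ}
    (hT : ((t + 2 * g * B : ℕ) : ℝ) ≤ T) :
    (repeatTimes (2 * g) (trial A B)).prob G t H
      (fun _ t' H' => ¬ ((t' : ℝ) ≤ T ∧ ∀ v, H' v = Finset.univ)) ≤ p := by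
  refine (Protocol.Always.prob_mono (q := fun _ _ H' => ¬ (incomplete H').card = 0)
    ((always_repeat_trial (2 * g)).mono fun _ t' H' h => mt fun h0 => ⟨?_, ?_⟩)).trans
    ((prob_repeat_trial_le hA hheld (2 * g) g hg).trans ?_)
  · exact le_trans (by exact_mod_cast h) hT
  · exact eq_univ_of_incomplete h0
  -- The bound is `(4 p) ^ g p`, so the number of trials does not harm the probability. A union
  -- bound over the trials would depend on `k`.
  · rw [show 2 * g + 1 - g = g + 1 by omega, pow_mul, pow_succ p, ← mul_assoc, ← mul_pow]
    rw [show (2 : ℝ≥0∞) ^ 2 = 4 by norm_num]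
    exact mul_le_of_le_one_left bot_le (pow_le_one₀ bot_le hp)

end KGossip

/-- Flood all tokens, one after the other. -/
noncomputable def floodAll (n k : ℕ) : Protocol (Fin n) (Fin k) Unit :=
  forEach (Finset.univ : Finset (Fin k)).toList fun τ => flood τ n

theorem prob_floodAll {n k : ℕ} {G : ℕ → SimpleGraph (Fin n)} (hG : ∀ t, (G t).Connected)
    {H : Holdings (Fin n) (Fin k)} (hheld : ∀ τ, ∃ v, τ ∈ H v) {T : ℝ} (hT : (n : ℝ) * k ≤ T) :
    (floodAll n k).prob G 0 H (fun _ t' H' => ¬ ((t' : ℝ) ≤ T ∧ ∀ v, H' v = Finset.univ)) = 0 := by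
  classical
  refine Protocol.Always.prob_eq_zero ((always_forEach_flood hG n _ fun τ _ => hheld τ).mono ?_)
  rintro _ t' H' ⟨rfl, h⟩
  rw [not_not]
  refine ⟨?_, fun v => Finset.eq_univ_iff_forall.2 fun τ => ?_⟩
  · rw [Finset.length_toList, Finset.card_univ, Fintype.card_fin, zero_add]
    push_cast
    linarith
  · have h1 := h τ (Finset.mem_toList.2 (Finset.mem_univ τ))
    rw [Fintype.card_fin, min_eq_left (Nat.le_succ n)] at h1
    have h2 : holders τ H' = Finset.univ :=
      Finset.card_eq_iff_eq_univ _ |>.1 (le_antisymm (Finset.card_le_univ _) (by simpa using h1))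
    exact mem_holders.1 (h2 ▸ Finset.mem_univ v)

theorem rpow_three_halves (n : ℕ) : (n : ℝ) ^ (3 / 2 : ℝ) = n * √(n : ℝ) := by
  rcases Nat.eq_zero_or_pos n with rfl | hn
  · norm_num
  · have h : (0 : ℝ) < n := by exact_mod_cast hn
    rw [show (3 / 2 : ℝ) = 1 + 1 / 2 by norm_num, Real.rpow_add h, Real.rpow_one,
      Real.sqrt_eq_rpow]

theorem four_mul_one_div_rpow_le {n : ℕ} (hn : 2 ≤ n) {c : ℝ} (hc : 0 < c) :
    4 * (1 / (n : ℝ) ^ (c + 2)) ≤ 1 := by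
  have h2 : (2 : ℝ) ≤ n := by exact_mod_cast hn
  have h : (4 : ℝ) ≤ (n : ℝ) ^ (c + 2) := by
    calc (4 : ℝ) = 2 ^ (2 : ℝ) := by norm_num
      _ ≤ (n : ℝ) ^ (2 : ℝ) := Real.rpow_le_rpow (by norm_num) h2 (by norm_num)
      _ ≤ (n : ℝ) ^ (c + 2) := Real.rpow_le_rpow_of_exponent_le (by linarith) (by linarith)
  rw [mul_one_div, div_le_one (by linarith)]
  exact h

theorem exists_kGossip {c : ℝ} (hc : 0 < c) : ∃ C : ℝ, 0 < C ∧ ∀ n k : ℕ, 2 ≤ n →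
    ∃ A : Protocol (Fin n) (Fin k) Unit,
    ∀ G : ℕ → SimpleGraph (Fin n), (∀ t, (G t).Connected) →
    ∀ H₀ : Holdings (Fin n) (Fin k), (∀ τ, ∃ v, τ ∈ H₀ v) →
      A.prob G 0 H₀ (fun _ t' H' => ¬ ((t' : ℝ) ≤ C * ((n : ℝ) + k) * √(n : ℝ) * Real.log n ^ 2 ∧
        ∀ v, H' v = Finset.univ)) ≤ ENNReal.ofReal (1 / (n : ℝ) ^ c) := by
  -- The exponent `c + 2` makes `4 p ≤ 1` already for `n = 2`.
  obtain ⟨κ, φ, σ, C, -, -, -, hC, h⟩ := exists_constants (c + 2) (by linarith)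
  refine ⟨2 * C, by linarith, fun n k hn => ?_⟩
  have hn0 : 0 < n := by omega
  have hn1 : (1 : ℝ) ≤ n := by exact_mod_cast hn0
  set B := ⌊C * ((n : ℝ) * √(n : ℝ) * Real.log n ^ 2)⌋₊ with hB
  -- This is `⌈k / n⌉`, and `g n ≤ k + n` is the source of the factor `n + k` in the running time.
  set g := (k + n - 1) / n with hg
  have hkg : k ≤ g * n := by
    have := Nat.lt_div_mul_add (a := k + n - 1) hn0
    rw [← hg] at this
    omega
  have hgk : g * n ≤ k + n := (Nat.div_mul_le_self _ _).trans (by omega)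
  refine ⟨repeatTimes (2 * g) (trial (nGossip (Fin n) (Fin n) κ φ σ) B), fun G hG H₀ hheld => ?_⟩
  have : Nonempty (Fin n) := ⟨⟨0, hn0⟩⟩
  refine (prob_repeat_trial_two_mul_le (p := ENNReal.ofReal (1 / (n : ℝ) ^ (c + 2))) ?_ ?_ hheld g
    ?_ ?_).trans (ENNReal.ofReal_le_ofReal ?_)
  · rw [show (4 : ℝ≥0∞) = ENNReal.ofReal 4 by simp, ← ENNReal.ofReal_mul (by norm_num)]
    exact ENNReal.ofReal_le_one.2 (four_mul_one_div_rpow_le hn hc)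
  · intro t H hH
    have key := h (Fin n) (Fin n) (by simpa using hn) rfl G hG t H hH
    rw [Fintype.card_fin] at key
    refine (Protocol.Always.prob_mono (Protocol.always_of_forall fun _ t' H' => ?_)).trans key
    refine mt fun h => ⟨h.1, ?_⟩
    rcases le_total t' t with htt | htt
    · omega
    · have h1 : t' - t ≤ B := Nat.le_floor (by
        rw [Nat.cast_sub htt]
        linarith [h.2])
      omega
  · exact ((Finset.card_le_univ _).trans_eq (Fintype.card_fin k)).trans hkg
  · have hgk' : (g : ℝ) * n ≤ k + n := by exact_mod_cast hgk
    have hB' : (B : ℝ) ≤ C * ((n : ℝ) * √(n : ℝ) * Real.log n ^ 2) := Nat.floor_le (by positivity)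
    push_cast
    calc 0 + 2 * (g : ℝ) * B ≤ 2 * g * (C * ((n : ℝ) * √(n : ℝ) * Real.log n ^ 2)) := by
          rw [zero_add]
          gcongr
      _ = (2 * C * √(n : ℝ) * Real.log n ^ 2) * (g * n) := by ring
      _ ≤ (2 * C * √(n : ℝ) * Real.log n ^ 2) * (k + n) := by gcongr
      _ = _ := by ring
  · exact one_div_le_one_div_of_le (Real.rpow_pos_of_pos (by linarith) _)
      (Real.rpow_le_rpow_of_exponent_le hn1 (by linarith))

end Gossip

theorem mainTheorem3 :
    (∀ c : ℝ, 0 < c → ∃ κ φ σ C : ℝ, 0 < κ ∧ 0 < φ ∧ 0 < σ ∧ 0 < C ∧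
      ∀ n : ℕ, 2 ≤ n →
      ∀ G : ℕ → SimpleGraph (Fin n), (∀ t, (G t).Connected) →
      ∀ H₀ : Gossip.Holdings (Fin n) (Fin n), (∀ τ, ∃ v, τ ∈ H₀ v) →
        ENNReal.ofReal (1 - 1 / (n : ℝ) ^ c) ≤
          (Gossip.nGossip (Fin n) (Fin n) κ φ σ).completionProb G H₀
            (C * (n : ℝ) ^ (3 / 2 : ℝ) * Real.log n ^ 2)) ∧
    (∃ d : ℕ, ∀ c : ℝ, 0 < c → ∃ C : ℝ, 0 < C ∧
      ∀ n k : ℕ, 2 ≤ n →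
      ∃ A : Gossip.Protocol (Fin n) (Fin k) Unit,
      ∀ G : ℕ → SimpleGraph (Fin n), (∀ t, (G t).Connected) →
      ∀ H₀ : Gossip.Holdings (Fin n) (Fin k), (∀ τ, ∃ v, τ ∈ H₀ v) →
        ENNReal.ofReal (1 - 1 / (n : ℝ) ^ c) ≤
          A.completionProb G H₀
            (min ((n : ℝ) * k) (C * ((n : ℝ) + k) * √(n : ℝ) * Real.log n ^ d))) := by
  refine ⟨fun c hc => ?_, 2, fun c hc => ?_⟩
  · obtain ⟨κ, φ, σ, C, hκ, hφ, hσ, hC, h⟩ := Gossip.exists_constants c hc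
    refine ⟨κ, φ, σ, C, hκ, hφ, hσ, hC, fun n hn G hG H₀ hheld => ?_⟩
    refine Gossip.Protocol.completionProb_ge (by positivity) ?_
    have key := h (Fin n) (Fin n) (by simpa using hn) rfl G hG 0 H₀ hheld
    rw [Fintype.card_fin] at key
    refine (Gossip.Protocol.Always.prob_mono
      (Gossip.Protocol.always_of_forall fun _ t' H' => ?_)).trans key
    refine mt fun h => ⟨?_, h.1⟩
    have ht := h.2
    rw [Nat.cast_zero, zero_add] at ht
    rw [Gossip.rpow_three_halves, mul_assoc]
    exact ht
  · obtain ⟨C, hC, h⟩ := Gossip.exists_kGossip hc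
    refine ⟨C, hC, fun n k hn => ?_⟩
    -- Which bound is smaller depends on `n` and `k` only, so the algorithm can be chosen before the
    -- networks and token sets are given.
    rcases le_total ((n : ℝ) * k) (C * ((n : ℝ) + k) * √(n : ℝ) * Real.log n ^ 2) with hle | hle
    · refine ⟨Gossip.floodAll n k, fun G hG H₀ hheld => ?_⟩
      rw [min_eq_left hle]
      exact Gossip.Protocol.completionProb_ge (by positivity)
        ((Gossip.prob_floodAll hG hheld le_rfl).le.trans bot_le)
    · obtain ⟨A, hA⟩ := h n k hn
      refine ⟨A, fun G hG H₀ hheld => ?_⟩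
      rw [min_eq_right hle]
      exact Gossip.Protocol.completionProb_ge (by positivity) (hA G hG H₀ hheld)
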